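/- Conventions. Graphs are finite, simple and undirected with vertex set $[n]=\{1,\dots,n\}$, given by $n$ and their adjacency matrix. A \emph{canonical form} is a map $f$ from graphs to graphs such that $\Gamma\cong\Delta \iff f(\Gamma)=f(\Delta)$ and $f(\Gamma)\cong\Gamma$ for all graphs $\Gamma,\Delta$; the problem $d\text{-}\mathrm{gcanon}_f$ asks, given a graph $\Gamma$, whether $\Gamma=f(\Gamma)$. $\mathrm{GI}$ is the problem whether two given graphs are isomorphic. For positive integers $n,m$, the row-column symmetry group is $\mathrm{Sym}([n])\times\mathrm{Sym}([m])$ acting on $\Omega=[n]\times[m]$, the first factor on the first component and the second factor on the second component. Boolean circuits have input gates (the variables), AND, OR and NOT gates, and one output gate. For a permutation group $G\le\mathrm{Sym}(\Omega)$, a Boolean circuit $\psi$ with variables from $\Omega\,\dot\cup\,\Omega'$ (where $\Omega'$ is any finite set of additional variables) is a \emph{complete symmetry breaking circuit with additional variables} for $G$ if every orbit of $G$ on the set of assignments $\Omega\to\{0,1\}$ contains an assignment $\tau'$ such that $\psi[\tau']$ is satisfiable (by an assignment to the additional variables), while $\psi[\tau'']$ is unsatisfiable for every other assignment $\tau''\neq\tau'$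 in the same orbit. Theorem. Suppose there is an algorithm that, given positive integers $n$ and $m$, computes in time polynomial in $n$ and $m$ a complete symmetry breaking circuit with additional variables for the row-column symmetry group $\mathrm{Sym}([n])\times\mathrm{Sym}([m])$ on $[n]\times[m]$. Then there exists a canonical form $f$ such that $d\text{-}\mathrm{gcanon}_f\in\mathsf{NP}$, and hence $\mathrm{GI}\in\mathsf{coNP}$. -/

import Mathlib

open Computability

/-! ### Polynomial time and nondeterministic polynomial time -/

/-- `f` is computed in polynomial time by a Turing machine, with respect to the given encodings. -/
def PolyTimeComputable {α β A B : Type} (ea : Encoding α A) (eb : Encoding β B) (f : α → β) :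
    Prop :=
  Nonempty (Turing.TM2ComputableInPolyTime ea.encode eb.encode f)

/-- The decision problem `S`, with instances encoded by `ea`, is in NP: there is a polynomial time
verifier `V` such that the yes-instances are exactly the instances that have a certificate of
polynomially bounded length accepted by `V`. -/
def InNP {α A : Type} (ea : Encoding α A) (S : Set α) : Prop :=
  ∃ (p : Polynomial ℕ) (V : α × List Bool → Bool),
    PolyTimeComputable (encodingProd ea (encodingList Bool)) encodingBoolBool V ∧
    ∀ a : α, a ∈ S ↔ ∃ w : List Bool, w.length ≤ p.eval (ea.encode a).length ∧ V (a, w) = true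

/-- The decision problem `S` is in coNP: its complement is in NP. -/
def InCoNP {α A : Type} (ea : Encoding α A) (S : Set α) : Prop :=
  InNP ea Sᶜ

/-- An injective encoding map, bundled with its partial inverse. -/
noncomputable def Computability.Encoding.ofInjective {α A : Type} (enc : α → List A)
    (h : Function.Injective enc) : Encoding α A where
  encode := enc
  decode := Function.partialInv enc
  decode_encode := Function.partialInv_left h

/-! ### Boolean circuits -/

/-- The gates other than input gates. The arguments are the numbers of the wires that
the gate reads. -/
inductive Gate where
  | not (a : ℕ)
  | and (a b : ℕ)
  | or (a b : ℕ)

namespace Gate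

/-- All wires that the gate reads have numbers below `k`. -/
def Below (k : ℕ) : Gate → Prop
  | not a => a < k
  | and a b => a < k ∧ b < k
  | or a b => a < k ∧ b < k

/-- The value of the gate, given the values of the wires. -/
def eval (v : ℕ → Bool) : Gate → Bool
  | not a => !(v a)
  | and a b => v a && v b
  | or a b => v a || v b

end Gate

/-- A Boolean circuit with AND, OR and NOT gates in topological order. The wires
`0, …, numVars - 1` are the input gates, that is, the variables of the circuit; the wire
`numVars + k` is the output of the `k`-th gate of the list. -/
structure BoolCircuit where
  numVars : ℕ
  gates : List Gate
  output : ℕ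
  gates_below : ∀ (k : ℕ) (h : k < gates.length), (gates[k]).Below (numVars + k)
  output_lt : output < numVars + gates.length

/-- The values of all wires: given the values of the first wires as a list, the gates are
evaluated one after the other, each appending its value. -/
def wireValues (vals : List Bool) (gs : List Gate) : List Bool :=
  gs.foldl (fun vs g => vs ++ [g.eval fun i => vs.getD i false]) vals

namespace BoolCircuit

/-- The value of the output gate when the variable `i < numVars` has the value `θ i`.
(The other values of `θ` are irrelevant.) -/
def eval (ψ : BoolCircuit) (θ : ℕ → Bool) : Bool :=
  (wireValues ((List.range ψ.numVars).map θ) ψ.gates).getD ψ.output false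

/-- `ψ[τ]` is satisfiable, where `τ` is an assignment to the variables in `Ω`, and `x` says which
variable of the circuit each element of `Ω` is. All variables outside of the range of `x` are
additional variables. -/
def SatisfiableUnder (ψ : BoolCircuit) {Ω : Type} (x : Ω ↪ ℕ) (τ : Ω → Bool) : Prop :=
  ∃ θ : ℕ → Bool, (∀ ω, θ (x ω) = τ ω) ∧ ψ.eval θ = true

end BoolCircuit

/-! ### Encoding of circuits -/

/-- The alphabet in which circuits are written; `one` is the unary digit. -/
inductive CircuitSymbol where
  | one
  | sep
  | notGate
  | andGate
  | orGate
  | output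
  deriving DecidableEq

open CircuitSymbol in
/-- A gate is written as its kind followed by the wires it reads, in unary. -/
def Gate.encode : Gate → List CircuitSymbol
  | .not a => notGate :: List.replicate a one
  | .and a b => andGate :: (List.replicate a one ++ sep :: List.replicate b one)
  | .or a b => orGate :: (List.replicate a one ++ sep :: List.replicate b one)

/-- A circuit is written as the number of its variables in unary, followed by its gates in order,
followed by the number of the output wire in unary. -/
def BoolCircuit.encode (ψ : BoolCircuit) : List CircuitSymbol :=
  List.replicate ψ.numVars .one ++
    (ψ.gates.flatMap Gate.encode ++ .output :: List.replicate ψ.output .one)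

theorem CircuitSymbol.replicate_append_inj {a b : ℕ} {s t : List CircuitSymbol}
    (hs : s.head? ≠ some one) (ht : t.head? ≠ some one)
    (h : List.replicate a one ++ s = List.replicate b one ++ t) : a = b ∧ s = t := by
  induction a generalizing b with
  | zero =>
    cases b with
    | zero => simpa using h
    | succ b => exact absurd (by simp at h; simp [h, List.replicate_succ]) hs
  | succ a ih =>
    cases b with
    | zero => exact absurd (by simp at h; simp [← h, List.replicate_succ]) ht
    | succ b =>
      simp only [List.replicate_succ, List.cons_append, List.cons.injEq, true_and] at h
      obtain ⟨h1, h2⟩ := ih h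
      exact ⟨by rw [h1], h2⟩

theorem Gate.encode_append_inj {g g' : Gate} {s t : List CircuitSymbol}
    (hs : s.head? ≠ some .one) (ht : t.head? ≠ some .one)
    (h : g.encode ++ s = g'.encode ++ t) : g = g' ∧ s = t := by
  cases g <;> cases g' <;> simp only [Gate.encode, List.cons_append, List.append_assoc,
    List.cons.injEq, reduceCtorEq, false_and, true_and] at h
  · obtain ⟨h1, h2⟩ := CircuitSymbol.replicate_append_inj hs ht h
    exact ⟨by rw [h1], h2⟩
  all_goals
    obtain ⟨h1, h2⟩ := CircuitSymbol.replicate_append_inj (by simp) (by simp) h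
    obtain ⟨h3, h4⟩ := CircuitSymbol.replicate_append_inj hs ht (List.cons.inj h2).2
    exact ⟨by rw [h1, h3], h4⟩

theorem Gate.flatMap_encode_head (gs : List Gate) (u : List CircuitSymbol) :
    (gs.flatMap Gate.encode ++ CircuitSymbol.output :: u).head? ≠ some .one := by
  cases gs with
  | nil => simp
  | cons g gs => cases g <;> simp [Gate.encode]

theorem Gate.flatMap_encode_inj {gs gs' : List Gate} {u v : List CircuitSymbol}
    (h : gs.flatMap Gate.encode ++ CircuitSymbol.output :: u
      = gs'.flatMap Gate.encode ++ CircuitSymbol.output :: v) : gs = gs' ∧ u = v := by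
  induction gs generalizing gs' with
  | nil =>
    cases gs' with
    | nil => simpa using h
    | cons g gs' => cases g <;> simp [Gate.encode] at h
  | cons g gs ih =>
    cases gs' with
    | nil => cases g <;> simp [Gate.encode] at h
    | cons g' gs' =>
      simp only [List.flatMap_cons, List.append_assoc] at h
      obtain ⟨h1, h2⟩ := Gate.encode_append_inj (Gate.flatMap_encode_head _ _)
        (Gate.flatMap_encode_head _ _) h
      obtain ⟨h3, h4⟩ := ih h2
      exact ⟨by rw [h1, h3], h4⟩

theorem BoolCircuit.encode_injective : Function.Injective BoolCircuit.encode := by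
  rintro ⟨n, gs, o, h1, h2⟩ ⟨n', gs', o', h1', h2'⟩ h
  simp only [BoolCircuit.encode] at h
  obtain ⟨hn, hs⟩ := CircuitSymbol.replicate_append_inj (Gate.flatMap_encode_head _ _)
    (Gate.flatMap_encode_head _ _) h
  obtain ⟨hg, ho⟩ := Gate.flatMap_encode_inj hs
  have ho' : o = o' := by simpa using congrArg List.length ho
  subst hn hg ho'
  rfl

noncomputable def circuitEncoding : Encoding BoolCircuit CircuitSymbol :=
  .ofInjective BoolCircuit.encode BoolCircuit.encode_injective

/-! ### Symmetry breaking -/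

/-- The orbit of an assignment to `Ω` under the natural action of a permutation group on `Ω`. -/
def assignmentOrbit {Ω : Type} (G : Subgroup (Equiv.Perm Ω)) (τ : Ω → Bool) : Set (Ω → Bool) :=
  {τ' | ∃ g ∈ G, τ' = fun ω => τ (g⁻¹ ω)}

/-- `ψ` is a complete symmetry breaking circuit with additional variables for `G`: every orbit of
assignments to `Ω` contains exactly one assignment `τ'` for which `ψ[τ']` is satisfiable.
The variables in `Ω` are identified with variables of the circuit by `x`. -/
def IsCompleteSymmetryBreaking {Ω : Type} (G : Subgroup (Equiv.Perm Ω)) (x : Ω ↪ ℕ)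
    (ψ : BoolCircuit) : Prop :=
  ∀ τ : Ω → Bool, ∃ τ' ∈ assignmentOrbit G τ, ψ.SatisfiableUnder x τ' ∧
    ∀ τ'' ∈ assignmentOrbit G τ, τ' ≠ τ'' → ¬ ψ.SatisfiableUnder x τ''

/-- The row-column symmetry group `Sym([n]) × Sym([m])` acting on `[n] × [m]`. -/
def rowColumnGroup (n m : ℕ) : Subgroup (Equiv.Perm (Fin n × Fin m)) where
  carrier := {g | ∃ (σ : Equiv.Perm (Fin n)) (π : Equiv.Perm (Fin m)), g = Equiv.prodCongr σ π}
  mul_mem' := by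
    rintro _ _ ⟨σ, π, rfl⟩ ⟨σ', π', rfl⟩
    exact ⟨σ * σ', π * π', rfl⟩
  one_mem' := ⟨1, 1, rfl⟩
  inv_mem' := by
    rintro _ ⟨σ, π, rfl⟩
    exact ⟨σ⁻¹, π⁻¹, rfl⟩

/-- The matrix variables `x_{ij}` are the first variables of the circuit, row by row: counting from
`0`, the variable `x_{ij}` has the number `j + m * i`. -/
def matrixVar (n m : ℕ) : Fin n × Fin m ↪ ℕ :=
  finProdFinEquiv.toEmbedding.trans Fin.valEmbedding

/-- Unary encoding of the positive integers. -/
noncomputable def unaryEncodingPNat : Encoding ℕ+ Bool :=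
  .ofInjective (fun n => unaryEncodingNat.encode n)
    (unaryEncodingNat.encode_injective.comp PNat.coe_injective)

/-- `δ` is (the function computed by) a polynomial time algorithm that generates, given positive
integers `n` and `m`, a complete symmetry breaking circuit with additional variables for the
row-column symmetry group on `[n] × [m]`. The running time is polynomial in `n` and `m`. -/
def GeneratesRowColumnSymmetryBreaking (δ : ℕ+ × ℕ+ → BoolCircuit) : Prop :=
  PolyTimeComputable (encodingProd unaryEncodingPNat unaryEncodingPNat) circuitEncoding δ ∧
    ∀ n m : ℕ+, IsCompleteSymmetryBreaking (rowColumnGroup n m) (matrixVar n m) (δ (n, m))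

/-! ### Graphs, graph isomorphism and graph canonization -/

/-- Finite undirected graphs with vertex set `[n]`. -/
abbrev FinGraph : Type := Σ n : ℕ, SimpleGraph (Fin n)

namespace FinGraph

/-- Graph isomorphism. -/
def Isomorphic (Γ Δ : FinGraph) : Prop := Nonempty (Γ.2 ≃g Δ.2)

open Classical in
/-- A graph is given by its number of vertices in unary, terminated by `false`, followed by its
adjacency matrix, row by row. -/
noncomputable def encode (Γ : FinGraph) : List Bool :=
  List.replicate Γ.1 true ++ false ::
    (List.ofFn fun i => List.ofFn fun j => decide (Γ.2.Adj i j)).flatten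

theorem encode_injective : Function.Injective encode := by
  rintro ⟨n, Γ⟩ ⟨n', Δ⟩ h
  simp only [encode] at h
  have hn : n = n' := by
    have key : ∀ (a b : ℕ) (s t : List Bool),
        List.replicate a true ++ false :: s = List.replicate b true ++ false :: t → a = b := by
      intro a
      induction a with
      | zero => intro b s t h; cases b <;> simp_all [List.replicate_succ]
      | succ a ih =>
        intro b s t h
        cases b with
        | zero => simp [List.replicate_succ] at h
        | succ b => simp [List.replicate_succ] at h; rw [ih b s t h]
    exact key _ _ _ _ h
  subst hn
  have h2 := (List.cons.inj (List.append_cancel_left h)).2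
  have h3 := List.eq_iff_flatten_eq.2 ⟨h2, by simp [List.map_ofFn, Function.comp_def]⟩
  have h4 : Γ = Δ := by
    ext i j
    have h5 := congrFun (List.ofFn_injective (congrFun (List.ofFn_injective h3) i)) j
    simpa using h5
  rw [h4]

noncomputable def encoding : Encoding FinGraph Bool := .ofInjective encode encode_injective

end FinGraph

/-- The graph isomorphism problem, as a set of pairs of graphs. -/
def graphIsomorphismProblem : Set (FinGraph × FinGraph) := {p | p.1.Isomorphic p.2}

/-- `f` is a graph canonization function. -/
structure IsCanonicalForm (f : FinGraph → FinGraph) : Prop where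
  iso_iff : ∀ Γ Δ : FinGraph, Γ.Isomorphic Δ ↔ f Γ = f Δ
  iso_self : ∀ Γ : FinGraph, (f Γ).Isomorphic Γ

/-- The decision version of graph canonization: is the given graph the canonical representative
of its isomorphism class? -/
def decisionCanonization (f : FinGraph → FinGraph) : Set FinGraph := {Γ | Γ = f Γ}

/-! Describe a graph on `n` vertices by its `n × n²` incidence matrix: rows are vertices, columns
are ordered pairs, and only the columns of adjacent pairs are nonzero. A vertex permutation induces
a permutation of the columns, so isomorphic graphs give matrices in one orbit of the row-column
group (`SimpleGraph.Iso.incidence_mem_orbit`). Conversely, joining distinct rows that share a `true`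
recovers the graph from its own incidence matrix (`ofMatrix_incidence`), and a graph isomorphic to
it from any matrix in the orbit (`nonempty_iso_ofMatrix`). The circuit selects exactly one matrix
`M` in each orbit. Hence `ofMatrix M` is a canonical form, and two graphs of the same order are
isomorphic exactly when their selected matrices agree (`Represents.nonempty_iso_iff`).

That `M` is the selected matrix has a short proof: `M` itself, values of all wires of the circuit
that are consistent with `M`, with the gates and with output `true` (these include the additional
variables), and a row and a column permutation that take the incidence matrix to `M` (`Certifies`).
By uniqueness in the orbit, no other matrix passes this check. Comparing the graph with `ofMatrix M`
then decides canonization in NP. Non-isomorphism is certified directly, by the proofs for both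
graphs together with an entry where the two matrices differ; the NP statement about canonization is
not used for this.

The rest of the work is to run the check on an actual Turing machine in polynomial time. The circuit
is not guessed: the verifier generates it by calling the given machine, whose output is polynomially
long because its running time is polynomial. The check itself is a formula with bounded quantifiers
about symbols at positions of the word formed by circuit, input and certificate. Such formulas
reduce to `Definable` functions, that is, unary arithmetic with bounded sums, since a positive sum
is an existential quantifier. `Definable.exists_evaluates` compiles every such function to a
polynomial time fragment of a stack machine; `PolyTimeComputable.verifier` joins these fragments to
the generator, and `InNP.of_definable` turns the outcome into membership in NP. Guessing all wire
values matters here: consistency is a local condition on each gate, so no recursion along the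
circuit has to be expressed. -/

/-! ### Program fragments for stack machines -/

namespace Turing.TM2

open Function

variable {K : Type} [DecidableEq K] {Γ : K → Type} {Λ Λ' σ : Type}

/-- Rename the labels of a statement. -/
def Stmt.mapLabels (φ : Λ → Λ') : Stmt Γ Λ σ → Stmt Γ Λ' σ
  | push k f q => push k f (q.mapLabels φ)
  | peek k f q => peek k f (q.mapLabels φ)
  | pop k f q => pop k f (q.mapLabels φ)
  | load f q => load f (q.mapLabels φ)
  | branch p q₁ q₂ => branch p (q₁.mapLabels φ) (q₂.mapLabels φ)
  | goto l => goto fun s => φ (l s)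
  | halt => halt

/-- Rename the label of a configuration. -/
def Cfg.mapLabels (φ : Λ → Λ') (c : Cfg Γ Λ σ) : Cfg Γ Λ' σ := ⟨c.l.map φ, c.var, c.stk⟩

theorem stepAux_mapLabels (φ : Λ → Λ') (q : Stmt Γ Λ σ) (s : σ) (S : ∀ k, List (Γ k)) :
    stepAux (q.mapLabels φ) s S = (stepAux q s S).mapLabels φ := by
  induction q generalizing s S with
  | branch p q₁ q₂ ih₁ ih₂ => cases h : p s <;> simp [Stmt.mapLabels, stepAux, h, ih₁, ih₂]
  | _ => simp_all [Stmt.mapLabels, stepAux, Cfg.mapLabels]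

/-- A program fragment: a finite control graph with one entry and one exit, the label `none`. -/
structure Fragment (Γ : K → Type) (σ : Type) where
  Λ : Type
  [fin : Fintype Λ]
  entry : Option Λ
  code : Λ → Stmt Γ (Option Λ) σ

namespace Fragment

variable (F G H : Fragment Γ σ)

/-- One step of the fragment; there is no step from the exit. -/
def step : Cfg Γ (Option F.Λ) σ → Option (Cfg Γ (Option F.Λ) σ)
  | ⟨some (some l), s, S⟩ => some (stepAux (F.code l) s S)
  | _ => none

/-- `F` leads from the configuration `c` to `c'` in exactly `n` steps. -/
def StepsIn : ℕ → Cfg Γ (Option F.Λ) σ → Cfg Γ (Option F.Λ) σ → Prop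
  | 0, c, c' => c = c'
  | n + 1, c, c' => ∃ d, F.step c = some d ∧ StepsIn n d c'

theorem StepsIn.trans {F : Fragment Γ σ} {m n : ℕ} {a b c : Cfg Γ (Option F.Λ) σ}
    (h₁ : F.StepsIn m a b) (h₂ : F.StepsIn n b c) : F.StepsIn (m + n) a c := by
  induction m generalizing a with
  | zero => cases h₁; simpa using h₂
  | succ m ih =>
    obtain ⟨d, hd, h⟩ := h₁
    rw [Nat.succ_add]
    exact ⟨d, hd, ih h⟩

/-- Started with the stacks `S`, the fragment `F` reaches its exit with the stacks `S'` in
at most `t` steps. -/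
def Runs (t : ℕ) (S S' : ∀ k, List (Γ k)) : Prop :=
  ∀ s, ∃ s' n, n ≤ t ∧ F.StepsIn n ⟨some F.entry, s, S⟩ ⟨some none, s', S'⟩

variable {F G H}

theorem Runs.cast {t : ℕ} {S S' S'' : ∀ k, List (Γ k)} (h : F.Runs t S S') (h' : S' = S'') :
    F.Runs t S S'' := h' ▸ h

theorem Runs.cast_left {t : ℕ} {S S' S'' : ∀ k, List (Γ k)} (h : F.Runs t S S'') (h' : S = S') :
    F.Runs t S' S'' := h' ▸ h

theorem Runs.mono {t t' : ℕ} {S S' : ∀ k, List (Γ k)} (h : F.Runs t S S') (ht : t ≤ t') :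
    F.Runs t' S S' := fun s =>
  let ⟨s', n, hn, hs⟩ := h s
  ⟨s', n, hn.trans ht, hs⟩

/-- All combinators below embed control graphs by relabelling. Only the inner labels are constrained
by `hφ`; the exit may be sent to any label, and sending it to an entry or to a loop head is what
produces sequencing and loops. -/
theorem StepsIn.mapLabels {n : ℕ} {c c' : Cfg Γ (Option F.Λ) σ} (h : F.StepsIn n c c')
    (φ : Option F.Λ → Option G.Λ)
    (hφ : ∀ l, ∃ l', φ (some l) = some l' ∧ G.code l' = (F.code l).mapLabels φ) :
    G.StepsIn n (c.mapLabels φ) (c'.mapLabels φ) := by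
  induction n generalizing c with
  | zero => cases h; rfl
  | succ n ih =>
    obtain ⟨d, hd, h⟩ := h
    refine ⟨d.mapLabels φ, ?_, ih h⟩
    obtain ⟨_ | _ | l, s, S⟩ := c
    · simp [step] at hd
    · simp [step] at hd
    · obtain ⟨l', h₁, h₂⟩ := hφ l
      simp only [step, Option.some.injEq] at hd
      simp [step, Cfg.mapLabels, h₁, h₂, stepAux_mapLabels, ← hd]

/-- The fragment that does nothing. -/
def skip : Fragment Γ σ where
  Λ := Empty
  entry := none
  code := Empty.elim

theorem runs_skip (S : ∀ k, List (Γ k)) : (skip : Fragment Γ σ).Runs 0 S S :=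
  fun s => ⟨s, 0, le_rfl, rfl⟩

/-- Push the symbol `a` on the stack `k`. -/
def push (k : K) (a : Γ k) : Fragment Γ σ where
  Λ := Unit
  entry := some ()
  code _ := .push k (fun _ => a) (.goto fun _ => none)

theorem runs_push (k : K) (a : Γ k) (S : ∀ k, List (Γ k)) :
    (push k a : Fragment Γ σ).Runs 1 S (update S k (a :: S k)) :=
  fun s => ⟨s, 1, le_rfl, _, rfl, rfl⟩

/-- Run `F` and then `G`. -/
def seq (F G : Fragment Γ σ) : Fragment Γ σ :=
  letI := F.fin
  letI := G.fin
  let φ : Option F.Λ → Option (F.Λ ⊕ G.Λ) := fun o => o.elim (G.entry.map .inr) (some ∘ .inl)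
  { Λ := F.Λ ⊕ G.Λ
    entry := φ F.entry
    code := Sum.elim (fun l => (F.code l).mapLabels φ) fun l => (G.code l).mapLabels (Option.map .inr) }

theorem Runs.seq {t u : ℕ} {S S' S'' : ∀ k, List (Γ k)} (hF : F.Runs t S S')
    (hG : G.Runs u S' S'') : (F.seq G).Runs (t + u) S S'' := by
  intro s
  obtain ⟨s', n, hn, h⟩ := hF s
  obtain ⟨s'', m, hm, h'⟩ := hG s'
  refine ⟨s'', n + m, add_le_add hn hm, ?_⟩
  have h₁ := h.mapLabels (G := F.seq G) (fun o => o.elim (G.entry.map .inr) (some ∘ .inl))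
    fun l => ⟨.inl l, rfl, rfl⟩
  have h₂ := h'.mapLabels (G := F.seq G) (Option.map .inr) fun l => ⟨.inr l, rfl, rfl⟩
  exact h₁.trans h₂

/-! The state of the machine has a register for the symbol that has just been read. -/

variable {A τ : Type} [Fintype A] {Γ : K → Type}

/-- Pop a symbol from the stack `k` and continue with the fragment given by the image of that
symbol. -/
def popCase (k : K) (g : Γ k → A) (F : Option A → Fragment Γ (Option A × τ)) :
    Fragment Γ (Option A × τ) :=
  letI := fun o => (F o).fin
  { Λ := Option (Σ o, (F o).Λ)
    entry := some none
    code := fun l => match l with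
      | none => .pop k (fun s o => (o.map g, s.2))
          (.goto fun s => (F s.1).entry.map fun l => some ⟨s.1, l⟩)
      | some ⟨o, l⟩ => ((F o).code l).mapLabels (Option.map fun l => some ⟨o, l⟩) }

theorem runs_popCase {k : K} {g : Γ k → A} {F : Option A → Fragment Γ (Option A × τ)} {t : ℕ}
    {S S' : ∀ k, List (Γ k)}
    (h : (F ((S k).head?.map g)).Runs t (update S k (S k).tail) S') :
    (popCase k g F).Runs (t + 1) S S' := by
  intro s
  obtain ⟨s', n, hn, h'⟩ := h ((S k).head?.map g, s.2)
  have h₁ := h'.mapLabels (G := popCase k g F)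
    (Option.map fun l => some ⟨(S k).head?.map g, l⟩) fun l => ⟨_, rfl, rfl⟩
  exact ⟨s', n + 1, by omega, _, rfl, h₁⟩

/-- Pop symbols from the stack `k` until it is empty, running a fragment after each. -/
def forPop (k : K) (g : Γ k → A) (F : A → Fragment Γ (Option A × τ)) :
    Fragment Γ (Option A × τ) :=
  letI := fun a => (F a).fin
  let φ (a : A) : Option (F a).Λ → Option (Option (Σ a, (F a).Λ)) :=
    fun o => some (o.map fun l => ⟨a, l⟩)
  { Λ := Option (Σ a, (F a).Λ)
    entry := some none
    code := fun l => match l with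
      | none => .pop k (fun s o => (o.map g, s.2))
          (.goto fun s => s.1.elim none fun a => φ a (F a).entry)
      | some ⟨a, l⟩ => ((F a).code l).mapLabels (φ a) }

theorem runs_forPop_nil {k : K} {g : Γ k → A} {F : A → Fragment Γ (Option A × τ)}
    {S : ∀ k, List (Γ k)} (h : S k = []) : (forPop k g F).Runs 1 S S := by
  intro s
  refine ⟨(none, s.2), 1, le_rfl, _, rfl, ?_⟩
  have h' : update S k [] = S := by rw [← h, update_eq_self]
  simp [StepsIn, forPop, h, h']

/-- The exit of the body is identified with the head of the loop, so a run of the body is followed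
by a run of the whole loop on the stacks that the body leaves. -/
theorem runs_forPop_cons {k : K} {g : Γ k → A} {F : A → Fragment Γ (Option A × τ)} {t u : ℕ}
    {S S' S'' : ∀ k, List (Γ k)} {x : Γ k} {l : List (Γ k)} (hS : S k = x :: l)
    (h : (F (g x)).Runs t (update S k l) S') (h' : (forPop k g F).Runs u S' S'') :
    (forPop k g F).Runs (t + u + 1) S S'' := by
  intro s
  obtain ⟨s', n, hn, h₁⟩ := h (some (g x), s.2)
  obtain ⟨s'', m, hm, h₂⟩ := h' s'
  have h₃ := h₁.mapLabels (G := forPop k g F) (fun o => some (o.map fun l => ⟨g x, l⟩))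
    fun l => ⟨some ⟨g x, l⟩, rfl, rfl⟩
  refine ⟨s'', n + m + 1, by omega, _, rfl, ?_⟩
  have h₄ := h₃.trans h₂
  simpa [forPop, hS, Cfg.mapLabels] using h₄

/-- The general rule for loops: `T i` are the stacks when `i` symbols have been popped. -/
theorem runs_forPop {k : K} {g : Γ k → A} {F : A → Fragment Γ (Option A × τ)} {t : ℕ}
    (l : List (Γ k)) (T : ℕ → ∀ k, List (Γ k)) (hT : ∀ i, T i k = l.drop i)
    (h : ∀ i (hi : i < l.length),
      (F (g l[i])).Runs t (update (T i) k (l.drop (i + 1))) (T (i + 1))) :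
    (forPop k g F).Runs (l.length * (t + 1) + 1) (T 0) (T l.length) := by
  have key : ∀ d i, i + d = l.length → (forPop k g F).Runs (d * (t + 1) + 1) (T i) (T l.length) := by
    intro d
    induction d with
    | zero =>
      intro i hi
      obtain rfl : i = l.length := hi
      simpa using runs_forPop_nil (by simp [hT])
    | succ d ih =>
      intro i hi
      have hi' : i < l.length := by omega
      refine (runs_forPop_cons ?_ (h i hi') (ih (i + 1) (by omega))).mono (by linarith)
      rw [hT, List.drop_eq_getElem_cons hi']
  exact key _ 0 (by simp)

end Fragment

end Turing.TM2

/-! ### Fragments that work on stacks with a common alphabet -/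

/-- Coefficients in `ℕ` make every polynomial monotone, so time bounds can be composed without
further assumptions. -/
theorem Polynomial.eval_mono_nat (p : Polynomial ℕ) {m n : ℕ} (h : m ≤ n) :
    p.eval m ≤ p.eval n := by
  induction p using Polynomial.induction_on' with
  | add p q hp hq => simpa using add_le_add hp hq
  | monomial k a => simpa using Nat.mul_le_mul_left a (Nat.pow_le_pow_left h k)

namespace Turing.TM2.Fragment

open Function

variable {K₁ K₂ A τ : Type} {B : K₂ → Type}

/-- The family of alphabets where the stacks in `K₁` have the alphabet `A`. -/
@[reducible] def Alphabets (K₁ A : Type) {K₂ : Type} (B : K₂ → Type) : K₁ ⊕ K₂ → Type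
  | .inl _ => A
  | .inr k => B k

/-- The stacks `P` and `Q` together. -/
def stackPair (P : K₁ → List A) (Q : ∀ k, List (B k)) : ∀ k, List (Alphabets K₁ A B k)
  | .inl i => P i
  | .inr k => Q k

@[simp] theorem stackPair_inl (P : K₁ → List A) (Q : ∀ k, List (B k)) (i : K₁) :
    stackPair P Q (.inl i) = P i := rfl

@[simp] theorem stackPair_inr (P : K₁ → List A) (Q : ∀ k, List (B k)) (k : K₂) :
    stackPair P Q (.inr k) = Q k := rfl

variable [DecidableEq K₁] [DecidableEq K₂]

theorem update_stackPair_inl (P : K₁ → List A) (Q : ∀ k, List (B k)) (i : K₁) (l : List A) :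
    update (stackPair P Q) (.inl i) l = stackPair (update P i l) Q := by
  funext j
  obtain j | j := j
  · by_cases h : j = i
    · subst h; simp
    · simp [h]
  · simp

theorem update_stackPair_inr (P : K₁ → List A) (Q : ∀ k, List (B k)) (k : K₂) (l : List (B k)) :
    update (stackPair P Q) (.inr k) l = stackPair P (update Q k l) := by
  funext j
  obtain j | j := j
  · simp
  · by_cases h : j = k
    · subst h; simp
    · simp [h]

/-! ### Fragments that touch only the stacks with the common alphabet -/

section Left

/-- `F` changes the stacks `P` to `P'` in at most `t` steps and leaves the other stacks alone. -/
def RunsLeft (F : Fragment (Alphabets K₁ A B) (Option A × τ)) (t : ℕ) (P P' : K₁ → List A) :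
    Prop :=
  ∀ Q, F.Runs t (stackPair P Q) (stackPair P' Q)

variable {F G : Fragment (Alphabets K₁ A B) (Option A × τ)}

theorem RunsLeft.mono {t t' : ℕ} {P P' : K₁ → List A} (h : F.RunsLeft t P P') (ht : t ≤ t') :
    F.RunsLeft t' P P' := fun Q => (h Q).mono ht

theorem RunsLeft.seq {t u : ℕ} {P P' P'' : K₁ → List A} (hF : F.RunsLeft t P P')
    (hG : G.RunsLeft u P' P'') : (F.seq G).RunsLeft (t + u) P P'' := fun Q => (hF Q).seq (hG Q)

theorem RunsLeft.of_eq {t : ℕ} {P P' P'' : K₁ → List A} (h : F.RunsLeft t P P') (h' : P' = P'') :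
    F.RunsLeft t P P'' := h' ▸ h

theorem RunsLeft.cast_left {t : ℕ} {P P' P'' : K₁ → List A} (h : F.RunsLeft t P P'')
    (h' : P = P') : F.RunsLeft t P' P'' := h' ▸ h

theorem runsLeft_skip_of_eq {t : ℕ} {P P' : K₁ → List A} (h : P = P') :
    (skip : Fragment (Alphabets K₁ A B) (Option A × τ)).RunsLeft t P P' :=
  h ▸ fun _ => (runs_skip _).mono (Nat.zero_le _)

theorem runsLeft_skip (P : K₁ → List A) :
    (skip : Fragment (Alphabets K₁ A B) (Option A × τ)).RunsLeft 0 P P := fun _ => runs_skip _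

/-- Push a symbol on one of the left stacks. -/
abbrev pushLeft (B : K₂ → Type) (τ : Type) (i : K₁) (a : A) :
    Fragment (Alphabets K₁ A B) (Option A × τ) :=
  push (.inl i) a

theorem runsLeft_push (i : K₁) (a : A) (P : K₁ → List A) :
    (pushLeft B τ i a).RunsLeft 1 P (update P i (a :: P i)) := by
  intro Q
  rw [← update_stackPair_inl]
  exact runs_push _ _ _

variable [Fintype A]

/-- Pop a symbol from one of the left stacks. -/
abbrev caseLeft (i : K₁) (F : Option A → Fragment (Alphabets K₁ A B) (Option A × τ)) :
    Fragment (Alphabets K₁ A B) (Option A × τ) :=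
  popCase (.inl i) id F

theorem runsLeft_case {i : K₁} {F : Option A → Fragment (Alphabets K₁ A B) (Option A × τ)} {t : ℕ}
    {P P' : K₁ → List A} (h : (F (P i).head?).RunsLeft t (update P i (P i).tail) P') :
    (caseLeft i F).RunsLeft (t + 1) P P' := by
  intro Q
  apply runs_popCase
  rw [update_stackPair_inl]
  simpa using h Q

/-- Empty one of the left stacks, running a fragment after each pop. -/
abbrev forLeft (i : K₁) (F : A → Fragment (Alphabets K₁ A B) (Option A × τ)) :
    Fragment (Alphabets K₁ A B) (Option A × τ) :=
  forPop (.inl i) id F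

theorem runsLeft_for {i : K₁} {F : A → Fragment (Alphabets K₁ A B) (Option A × τ)} {t : ℕ}
    (l : List A) (T : ℕ → K₁ → List A) (hT : ∀ j, T j i = l.drop j)
    (h : ∀ j (hj : j < l.length),
      (F l[j]).RunsLeft t (update (T j) i (l.drop (j + 1))) (T (j + 1))) :
    (forLeft i F).RunsLeft (l.length * (t + 1) + 1) (T 0) (T l.length) := by
  intro Q
  refine runs_forPop (Γ := Alphabets K₁ A B) (k := Sum.inl i) (g := id) l (fun j => stackPair (T j) Q)
    hT fun j hj => ?_
  rw [update_stackPair_inl]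
  exact h j hj Q

theorem runsLeft_for_of_eq {i : K₁} {F : A → Fragment (Alphabets K₁ A B) (Option A × τ)} {t : ℕ}
    {P P' : K₁ → List A} (l : List A) (T : ℕ → K₁ → List A) (h0 : P = T 0) (h1 : P' = T l.length)
    (hT : ∀ j, T j i = l.drop j)
    (h : ∀ j (hj : j < l.length),
      (F l[j]).RunsLeft t (update (T j) i (l.drop (j + 1))) (T (j + 1))) :
    (forLeft i F).RunsLeft (l.length * (t + 1) + 1) P P' := by
  rw [h0, h1]; exact runsLeft_for l T hT h

/-- Moving one symbol at a time reverses the word; a second move restores the order. -/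
theorem runsLeft_move {i j : K₁} (hij : i ≠ j) (f : A → A) (P : K₁ → List A) :
    (forLeft i fun a => pushLeft B τ j (f a)).RunsLeft ((P i).length * 2 + 1) P
      (update (update P i []) j (((P i).map f).reverse ++ P j)) := by
  refine runsLeft_for_of_eq (P i) (t := 1)
    (fun n => update (update P i ((P i).drop n)) j ((((P i).take n).map f).reverse ++ P j))
    (by simp) (by simp) (by simp [hij]) fun n hn => ?_
  have e := (List.take_append_getElem hn).symm
  convert runsLeft_push (B := B) (τ := τ) j (f (P i)[n]) _ using 1
  funext k
  by_cases hk : k = j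
  · subst hk
    simp [hij.symm, e, -List.take_append_getElem]
  · by_cases hk' : k = i
    · subst hk'; simp [hk]
    · simp [hk, hk']

theorem runsLeft_clear (i : K₁) (P : K₁ → List A) :
    (forLeft i fun _ : A => (skip : Fragment (Alphabets K₁ A B) (Option A × τ))).RunsLeft
      ((P i).length + 1) P (update P i []) := by
  refine (runsLeft_for_of_eq (P i) (t := 0) (fun n => update P i ((P i).drop n))
    (by simp) (by simp) (by simp) fun n hn => ?_).mono (by omega)
  simpa using runsLeft_skip _

theorem runsLeft_move₂ {i j k : K₁} (hij : i ≠ j) (hik : i ≠ k) (hjk : j ≠ k) (f : A → A)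
    (P : K₁ → List A) :
    (forLeft i fun a => (pushLeft B τ j a).seq (pushLeft B τ k (f a))).RunsLeft
      ((P i).length * 3 + 1) P
      (update (update (update P i []) j ((P i).reverse ++ P j)) k
        (((P i).map f).reverse ++ P k)) := by
  refine runsLeft_for_of_eq (P i) (t := 2)
    (fun n => update (update (update P i ((P i).drop n)) j (((P i).take n).reverse ++ P j)) k
      ((((P i).take n).map f).reverse ++ P k))
    (by simp) (by simp) (by simp [hij, hik]) fun n hn => ?_
  have e := (List.take_append_getElem hn).symm
  convert (runsLeft_push (B := B) (τ := τ) j (P i)[n] _).seq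
    (runsLeft_push (B := B) (τ := τ) k (f (P i)[n]) _) using 1
  funext m
  by_cases hk : m = k
  · subst hk
    simp [hik.symm, hjk.symm, e, -List.take_append_getElem]
  · by_cases hj : m = j
    · subst hj; simp [hjk, hij.symm, e, -List.take_append_getElem]
    · by_cases hi : m = i
      · subst hi; simp [hk, hj]
      · simp [hk, hj, hi]

end Left

end Turing.TM2.Fragment

/-! ### Definable functions and their evaluation by a stack machine -/

/-- The functions that are definable, in unary arithmetic with bounded sums, from the variables
`vars` and the word `word`. The elements of `α` are the contexts. -/
inductive Definable {A : Type} [DecidableEq A] :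
    {α : Type} → (α → List A) → List (α → ℕ) → (α → ℕ) → Prop
  | var {α : Type} {word : α → List A} {vars : List (α → ℕ)} {x : α → ℕ} (h : x ∈ vars) :
      Definable word vars x
  | one {α : Type} {word : α → List A} {vars : List (α → ℕ)} : Definable word vars fun _ => 1
  | length {α : Type} {word : α → List A} {vars : List (α → ℕ)} :
      Definable word vars fun c => (word c).length
  | add {α : Type} {word : α → List A} {vars : List (α → ℕ)} {f g : α → ℕ}
      (hf : Definable word vars f) (hg : Definable word vars g) :
      Definable word vars fun c => f c + g c
  | sub {α : Type} {word : α → List A} {vars : List (α → ℕ)} {f g : α → ℕ}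
      (hf : Definable word vars f) (hg : Definable word vars g) :
      Definable word vars fun c => f c - g c
  | test {α : Type} {word : α → List A} {vars : List (α → ℕ)} {f : α → ℕ} (a : A)
      (hf : Definable word vars f) :
      Definable word vars fun c => if (word c)[f c]? = some a then 1 else 0
  | sum {α : Type} {word : α → List A} {vars : List (α → ℕ)} {f : α → ℕ} {g : α → ℕ → ℕ}
      (hf : Definable word vars f)
      (hg : Definable (fun p : α × ℕ => word p.1)
        (Prod.snd :: vars.map fun x (p : α × ℕ) => x p.1) fun p => g p.1 p.2) :
      Definable word vars fun c => ∑ i ∈ Finset.range (f c), g c i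

/-! ### Unary arithmetic and symbol lookup on stacks -/

namespace Turing.TM2.Fragment

open Function

section Loops

variable {K₁ K₂ A τ : Type} [Fintype A] [DecidableEq K₁] [DecidableEq K₂]
  {B : K₂ → Type} {F G : Fragment (Alphabets K₁ A B) (Option A × τ)} {P : K₁ → List A} {x : A}

/-- Truncated subtraction of unary numbers. -/
def subtract (F G : Fragment (Alphabets K₁ A B) (Option A × τ)) (i j dst : K₁) :
    Fragment (Alphabets K₁ A B) (Option A × τ) :=
  F.seq (G.seq ((forLeft j fun _ => caseLeft i fun _ => skip).seq
    (forLeft i fun a => pushLeft B τ dst a)))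

/-- One symbol is popped from `i` for each symbol on `j`. Popping an empty stack changes nothing,
which is exactly truncation at zero. -/
theorem runsLeft_subtract {i j dst : K₁} (hij : i ≠ j) (hi : i ≠ dst) (hj : j ≠ dst)
    {m n t u : ℕ} (hPi : P i = []) (hPj : P j = [])
    (hF : F.RunsLeft t P (update P i (List.replicate m x)))
    (hG : G.RunsLeft u (update P i (List.replicate m x))
      (update (update P i (List.replicate m x)) j (List.replicate n x))) :
    (subtract F G i j dst).RunsLeft (t + u + (m * 2 + n * 2 + 2)) P
      (update P dst (List.replicate (m - n) x ++ P dst)) := by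
  have h₁ : (forLeft j fun _ : A => caseLeft i fun _ =>
      (skip : Fragment (Alphabets K₁ A B) (Option A × τ))).RunsLeft
      ((List.replicate n x).length * (1 + 1) + 1)
      (update (update P i (List.replicate m x)) j (List.replicate n x))
      (update P i (List.replicate (m - n) x)) := by
    refine runsLeft_for_of_eq (List.replicate n x)
      (fun l => update (update P i (List.replicate (m - l) x)) j (List.replicate (n - l) x))
      (by simp) ?_ (by simp) fun l hl => ?_
    · simp only [List.length_replicate, Nat.sub_self, List.replicate_zero]
      rw [eq_comm, update_eq_self_iff]
      simp [hij.symm, hPj]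
    · apply runsLeft_case
      apply runsLeft_skip_of_eq
      funext k
      by_cases hk : k = i
      · subst hk; simp [hij, Nat.sub_sub]
      · by_cases hk' : k = j
        · subst hk'; simp [hk]
        · simp [hk, hk']
  refine RunsLeft.mono (hF.seq (hG.seq (h₁.seq ?_))) (t := t + (u + (_ + (m * 2 + 1)))) ?_
  · refine ((runsLeft_move (B := B) (τ := τ) hi (fun a => a) _).mono ?_).of_eq ?_
    rotate_left
    · funext k
      by_cases hk : k = dst
      · subst hk; simp [hi.symm]
      · by_cases hk' : k = i
        · subst hk'; simp [hk, hPi]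
        · simp [hk, hk']
    · simp
  · simp; omega

/-- Bounded summation of unary numbers: `G` is run for each value of `j`. -/
def summation (F G : Fragment (Alphabets K₁ A B) (Option A × τ)) (x : A) (i j : K₁) :
    Fragment (Alphabets K₁ A B) (Option A × τ) :=
  F.seq ((forLeft i fun _ => G.seq (pushLeft B τ j x)).seq (forLeft j fun _ => skip))

/-- The stack `i` counts the remaining rounds and `j` the completed ones, so `j` is the summation
index, while the partial sum grows on `dst`. The hypothesis on `G` therefore leaves the contents of
`i` and `dst` arbitrary. -/
theorem runsLeft_summation {i j dst : K₁} (hij : i ≠ j) (hi : i ≠ dst) (hj : j ≠ dst)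
    {m t u : ℕ} {g : ℕ → ℕ} (hPi : P i = []) (hPj : P j = [])
    (hF : F.RunsLeft t P (update P i (List.replicate m x)))
    (hG : ∀ n < m, ∀ P' : K₁ → List A, P' j = List.replicate n x →
      (∀ k, k ≠ i → k ≠ j → k ≠ dst → P' k = P k) →
      G.RunsLeft u P' (update P' dst (List.replicate (g n) x ++ P' dst))) :
    (summation F G x i j).RunsLeft (t + (m * (u + 2) + m + 2)) P
      (update P dst (List.replicate (∑ n ∈ Finset.range m, g n) x ++ P dst)) := by
  have h₁ : (forLeft i fun _ : A => G.seq (pushLeft B τ j x)).RunsLeft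
      ((List.replicate m x).length * (u + 1 + 1) + 1)
      (update P i (List.replicate m x))
      (update (update P j (List.replicate m x)) dst
        (List.replicate (∑ n ∈ Finset.range m, g n) x ++ P dst)) := by
    refine runsLeft_for_of_eq (List.replicate m x)
      (fun l => update (update (update P i (List.replicate (m - l) x)) j (List.replicate l x)) dst
        (List.replicate (∑ n ∈ Finset.range l, g n) x ++ P dst))
      ?_ ?_ (by simp [hij, hi]) fun l hl => ?_
    · funext k
      by_cases hk : k = dst
      · subst hk; simp [hi.symm]
      · by_cases hk' : k = j
        · subst hk'; simp [hk, hPj, hij.symm]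
        · simp [hk, hk']
    · simp only [List.length_replicate, Nat.sub_self, List.replicate_zero]
      rw [← hPi, update_eq_self]
    · rw [List.length_replicate] at hl
      have h := hG l hl (update (update (update (update P i (List.replicate (m - l) x)) j
        (List.replicate l x)) dst (List.replicate (∑ n ∈ Finset.range l, g n) x ++ P dst)) i
        (List.replicate (m - (l + 1)) x)) (by simp [hij.symm, hj])
        (by intro k h1 h2 h3; simp [h1, h2, h3])
      convert h.seq (runsLeft_push (B := B) (τ := τ) j x _) using 1
      · simp
      · funext k
        by_cases hk : k = dst
        · subst hk
          simp [hi.symm, hj.symm, Finset.sum_range_succ, ← List.append_assoc, Nat.add_comm]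
        · by_cases hk' : k = j
          · subst hk'; simp [hk, hij.symm, List.replicate_succ]
          · by_cases hk'' : k = i
            · subst hk''; simp [hk, hij]
            · simp [hk, hk', hk'']
  refine ((hF.seq (h₁.seq ((runsLeft_clear (B := B) (τ := τ) j _).mono (t' := m + 1) ?_))).mono
    ?_).of_eq ?_
  · simp [hj]
  · simp; ring_nf; omega
  · funext k
    by_cases hk : k = dst
    · subst hk; simp [hj.symm]
    · by_cases hk' : k = j
      · subst hk'; simp [hk, hPj]
      · simp [hk, hk']

/-- Push `x` on `dst` if the symbol number `n` of the word on the stack `r` is `a`, where the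
fragment `F` writes `n` on the stack `i`. -/
def testSymbol [DecidableEq A] (F : Fragment (Alphabets K₁ A B) (Option A × τ)) (x a : A)
    (i r l dst : K₁) : Fragment (Alphabets K₁ A B) (Option A × τ) :=
  F.seq ((forLeft i fun _ => caseLeft r fun o => o.elim skip fun b => pushLeft B τ l b).seq
    ((caseLeft r fun o => o.elim skip fun b => (pushLeft B τ r b).seq
      (if b = a then pushLeft B τ dst x else skip)).seq
    (forLeft l fun b => pushLeft B τ r b)))

/-- The stacks `r` and `l` act as the two halves of a tape: the head advances by `n` symbols,
inspects the top of `r`, puts it back, and rewinds. -/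
theorem runsLeft_testSymbol [DecidableEq A] {i r l dst : K₁} (hir : i ≠ r) (hil : i ≠ l)
    (hrl : r ≠ l) (hi : i ≠ dst) (hr : r ≠ dst) (hl : l ≠ dst)
    {n t : ℕ} {a : A} (hPi : P i = []) (hPl : P l = [])
    (hF : F.RunsLeft t P (update P i (List.replicate n x))) :
    (testSymbol F x a i r l dst).RunsLeft (t + (n * 3 + 1) + 3 + ((P r).length * 2 + 1)) P
      (update P dst (List.replicate (if (P r)[n]? = some a then 1 else 0) x ++ P dst)) := by
  have h₁ : (forLeft i fun _ : A => caseLeft r fun o => o.elim skip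
      fun b => pushLeft B τ l b).RunsLeft
      ((List.replicate n x).length * (2 + 1) + 1)
      (update P i (List.replicate n x))
      (update (update P r ((P r).drop n)) l ((P r).take n).reverse) := by
    refine runsLeft_for_of_eq (List.replicate n x)
      (fun m => update (update (update P i (List.replicate (n - m) x)) r ((P r).drop m)) l
        ((P r).take m).reverse)
      ?_ ?_ (by simp [hil, hir]) fun m hm => ?_
    · funext k
      by_cases hk : k = l
      · subst hk; simp [hPl, hil.symm]
      · by_cases hk' : k = r
        · subst hk'; simp [hk, hir.symm]
        · simp [hk, hk']
    · simp only [List.length_replicate, Nat.sub_self, List.replicate_zero]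
      rw [← hPi, update_eq_self]
    · refine runsLeft_case (t := 1) ?_
      rw [List.length_replicate] at hm
      rw [update_of_ne hir.symm, update_of_ne hrl, update_self]
      rcases lt_or_ge m (P r).length with h | h
      · have e := (List.take_append_getElem h).symm
        rw [List.drop_eq_getElem_cons h]
        simp only [List.head?_cons, Option.elim_some, List.tail_cons]
        convert runsLeft_push (B := B) (τ := τ) l (P r)[m] _ using 1
        funext k
        by_cases hk : k = l
        · subst hk; simp [hil.symm, hrl.symm, e, -List.take_append_getElem]
        · by_cases hk' : k = r
          · subst hk'; simp [hk]
          · by_cases hk'' : k = i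
            · subst hk''; simp [hk, hk']
            · simp [hk, hk', hk'']
      -- The word is exhausted: further pops do nothing, and `l` keeps the whole word.
      · simp only [List.drop_eq_nil_of_le h, List.head?_nil, Option.elim_none, List.tail_nil]
        apply runsLeft_skip_of_eq
        funext k
        by_cases hk : k = l
        · subst hk
          simp [hil.symm, hrl.symm, List.take_of_length_le h,
            List.take_of_length_le (h.trans (Nat.le_succ m))]
        · by_cases hk' : k = r
          · subst hk'; simp [hk, h.trans (Nat.le_succ m)]
          · by_cases hk'' : k = i
            · subst hk''; simp [hk, hk']
            · simp [hk, hk', hk'']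
  have h₂ : (caseLeft r fun o => o.elim skip fun b => (pushLeft B τ r b).seq
      (if b = a then pushLeft B τ dst x else skip)).RunsLeft (2 + 1)
      (update (update P r ((P r).drop n)) l ((P r).take n).reverse)
      (update (update (update P r ((P r).drop n)) l ((P r).take n).reverse) dst
        (List.replicate (if (P r)[n]? = some a then 1 else 0) x ++ P dst)) := by
    apply runsLeft_case
    rw [update_of_ne hrl, update_self]
    rcases lt_or_ge n (P r).length with h | h
    · rw [List.drop_eq_getElem_cons h]
      simp only [List.head?_cons, Option.elim_some, List.tail_cons, List.getElem?_eq_getElem h,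
        Option.some.injEq]
      refine RunsLeft.seq (t := 1) (u := 1) (runsLeft_push (B := B) (τ := τ) r _ _) ?_
      split_ifs with hb
      · convert runsLeft_push (B := B) (τ := τ) dst x _ using 1
        funext k
        by_cases hk : k = dst
        · subst hk; simp [hr.symm, hl.symm]
        · by_cases hk' : k = r
          · subst hk'; simp [hk, hrl]
          · simp [hk, hk']
      · apply runsLeft_skip_of_eq
        funext k
        by_cases hk : k = dst
        · subst hk; simp [hr.symm, hl.symm]
        · by_cases hk' : k = r
          · subst hk'; simp [hk, hrl]
          · simp [hk, hk']
    · simp only [List.drop_eq_nil_of_le h, List.head?_nil, Option.elim_none, List.tail_nil,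
        List.getElem?_eq_none h]
      apply runsLeft_skip_of_eq
      funext k
      by_cases hk : k = dst
      · subst hk; simp [hr.symm, hl.symm]
      · by_cases hk' : k = r
        · subst hk'; simp [hk, hrl]
        · simp [hk, hk']
  refine RunsLeft.mono (hF.seq (h₁.seq (h₂.seq ?_)))
    (t := t + (_ + (_ + ((P r).length * 2 + 1)))) ?_
  · refine ((runsLeft_move (B := B) (τ := τ) hrl.symm (fun a => a) _).mono ?_).of_eq ?_
    rotate_left
    · funext k
      by_cases hk : k = dst
      · subst hk; simp [hr.symm, hl.symm]
      · by_cases hk' : k = r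
        · subst hk'; simp [hk, hrl, hl]
        · by_cases hk'' : k = l
          · subst hk''; simp [hk, hk', hPl]
          · simp [hk, hk', hk'']
    · simp [hl]
  · simp; omega

/-- Push as many symbols `x` on `dst` as there are symbols on the stack `i`. -/
def copyLength (x : A) (i j dst : K₁) : Fragment (Alphabets K₁ A B) (Option A × τ) :=
  (forLeft i fun a => (pushLeft B τ j a).seq (pushLeft B τ dst x)).seq
    (forLeft j fun a => pushLeft B τ i a)

theorem runsLeft_copyLength {i j dst : K₁} (hij : i ≠ j) (hi : i ≠ dst) (hj : j ≠ dst)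
    (hPj : P j = []) :
    (copyLength x i j dst : Fragment (Alphabets K₁ A B) (Option A × τ)).RunsLeft
      ((P i).length * 5 + 2) P
      (update P dst (List.replicate (P i).length x ++ P dst)) := by
  refine RunsLeft.mono ((runsLeft_move₂ hij hi hj (fun _ => x) P).seq (u := (P i).length * 2 + 1)
    ?_) (by omega)
  refine ((runsLeft_move (B := B) (τ := τ) hij.symm (fun a => a) _).mono ?_).of_eq ?_
  rotate_left
  · funext k
    by_cases hk : k = dst
    · subst hk; simp [hi.symm, hj.symm]
    · by_cases hk' : k = i
      · subst hk'; simp [hk, hj, hij, hPj]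
      · by_cases hk'' : k = j
        · subst hk''; simp [hk, hk', hPj]
        · simp [hk, hk', hk'']
  · simp [hj, hPj]

end Loops

end Turing.TM2.Fragment

/-- Used to see that the stacks of the variables survive a change of a stack outside `pos`. -/
theorem List.Forall₂.imp_of_mem_right {α β : Type*} {R S : α → β → Prop} {l : List α} {m : List β}
    (h : List.Forall₂ R l m) (H : ∀ a, ∀ b ∈ m, R a b → S a b) : List.Forall₂ S l m := by
  induction h with
  | nil => exact .nil
  | cons h _ ih =>
    exact .cons (H _ _ List.mem_cons_self h) (ih fun a b hb => H a b (List.mem_cons_of_mem _ hb))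

/-! ### Polynomial bounds for definable functions, and their compilation -/

namespace Definable

open Turing.TM2.Fragment Function

variable {A : Type} [DecidableEq A]

/-- The size of a context: the length of the word plus the values of the variables. -/
def size {α : Type} (word : α → List A) (vars : List (α → ℕ)) (c : α) : ℕ :=
  (word c).length + (vars.map fun x => x c).sum

/-- The fragment `F` adds the value of `f` to the stack `dst`, in unary, when the word is on the
stack `inr true` and the variables are, in unary, on the stacks `pos`. The stacks from `k` on are
used as auxiliary stacks. -/
def Evaluates {α K₂ τ : Type} [DecidableEq K₂] {B : K₂ → Type} (x : A) (word : α → List A)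
    (vars : List (α → ℕ)) (f : α → ℕ) (p : Polynomial ℕ) {N : ℕ} (k : ℕ) (pos : List (Fin N))
    (dst : Fin N)
    (F : Turing.TM2.Fragment (Alphabets (Fin N ⊕ Bool) A B) (Option A × τ)) : Prop :=
  ∀ (c : α) (P : Fin N ⊕ Bool → List A), P (.inr true) = word c → P (.inr false) = [] →
    List.Forall₂ (fun y i => P (.inl i) = List.replicate (y c) x) vars pos →
    (∀ i : Fin N, k ≤ i → P (.inl i) = []) →
    F.RunsLeft (p.eval (size word vars c)) P
      (update P (.inl dst) (List.replicate (f c) x ++ P (.inl dst)))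

/-- The only growth beyond addition comes from sums. There are at most `q` summands, and the index
increases the size of the context by at most `q`, whence the factor `q'.comp (.X + q)`. -/
theorem exists_bound {α : Type} {word : α → List A} {vars : List (α → ℕ)} {f : α → ℕ}
    (hf : Definable word vars f) : ∃ q : Polynomial ℕ, ∀ c, f c ≤ q.eval (size word vars c) := by
  induction hf with
  | var h =>
    refine ⟨.X, fun c => ?_⟩
    rw [Polynomial.eval_X]
    exact (List.single_le_sum (by simp) _ (List.mem_map_of_mem (f := fun x => x c) h)).trans
      (Nat.le_add_left _ _)
  | one => exact ⟨1, by simp⟩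
  | length => exact ⟨.X, fun c => by simp [size]⟩
  | add _ _ ihf ihg =>
    obtain ⟨q, hq⟩ := ihf
    obtain ⟨q', hq'⟩ := ihg
    exact ⟨q + q', fun c => by simpa using add_le_add (hq c) (hq' c)⟩
  | sub _ _ ihf _ =>
    obtain ⟨q, hq⟩ := ihf
    exact ⟨q, fun c => (Nat.sub_le _ _).trans (hq c)⟩
  | test _ _ _ => exact ⟨1, fun c => by dsimp only; split_ifs <;> simp⟩
  | @sum α word vars f g _ _ ihf ihg =>
    obtain ⟨q, hq⟩ := ihf
    obtain ⟨q', hq'⟩ := ihg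
    refine ⟨q * q'.comp (.X + q), fun c => ?_⟩
    have h : ∀ i ∈ Finset.range (f c),
        g c i ≤ q'.eval (size word vars c + q.eval (size word vars c)) := by
      intro i hi
      refine (hq' (c, i)).trans (Polynomial.eval_mono_nat _ ?_)
      have := (Finset.mem_range.1 hi).le.trans (hq c)
      simp only [size, List.map_cons, List.map_map, List.sum_cons, Function.comp_def] at this ⊢
      omega
    refine (Finset.sum_le_card_nsmul _ _ _ h).trans ?_
    simpa using Nat.mul_le_mul_right _ (hq c)

/-- Structural induction, where `r` counts the auxiliary stacks. The statement ranges over all `N`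
and `k` so that an operand or an index can be stored at `k` and `k + 1` and subterms compiled with a
larger `k`; it ranges over all `K₂`, `τ` and `B` so that the result can live in one machine with the
circuit generator. The polynomial depends on none of these. -/
theorem exists_evaluates [Fintype A] (x : A) {α : Type} {word : α → List A}
    {vars : List (α → ℕ)} {f : α → ℕ} (hf : Definable word vars f) :
    ∃ (r : ℕ) (p : Polynomial ℕ), ∀ (N k : ℕ) (K₂ τ : Type) [DecidableEq K₂] (B : K₂ → Type)
      (pos : List (Fin N)) (dst : Fin N), k + r ≤ N → (∀ i ∈ pos, i < k) → dst < k → dst ∉ pos →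
      ∃ F : Turing.TM2.Fragment (Alphabets (Fin N ⊕ Bool) A B) (Option A × τ),
        Evaluates x word vars f p k pos dst F := by
  induction hf with
  | @var α word vars y h =>
    refine ⟨1, 5 * .X + 2, fun N k K₂ τ _ B pos dst hk hpos hdst hd => ?_⟩
    by_cases hl : vars.length = pos.length
    · obtain ⟨n, hn, rfl⟩ := List.getElem_of_mem h
      have hn' : n < pos.length := hl ▸ hn
      let t : Fin N := ⟨k, by omega⟩
      refine ⟨copyLength x (.inl pos[n]) (.inl t) (.inl dst), fun c P _ _ hP hPe => ?_⟩
      have hpn := hpos _ (List.getElem_mem hn')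
      have e := (List.forall₂_iff_get.1 hP).2 n hn hn'
      simp only [List.get_eq_getElem] at e
      have hm : vars[n] c ≤ size word vars c :=
        (List.single_le_sum (by simp) _ (List.mem_map_of_mem (f := fun x => x c)
          (List.getElem_mem hn))).trans (Nat.le_add_left _ _)
      have := runsLeft_copyLength (B := B) (τ := τ) (x := x) (P := P) (i := .inl pos[n])
        (j := .inl t) (dst := .inl dst) (by simp [t, Fin.ext_iff]; omega)
        (fun h => hd (Sum.inl_injective h ▸ List.getElem_mem hn'))
        (by simp [t, Fin.ext_iff]; omega) (hPe _ le_rfl)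
      rw [e, List.length_replicate] at this
      refine this.mono ?_
      simp; omega
    -- With lists of different lengths no stacks satisfy the precondition, so any fragment will do.
    · exact ⟨skip, fun c P _ _ hP => absurd hP.length_eq hl⟩
  | one =>
    exact ⟨0, 1, fun N k K₂ τ _ B pos dst hk hpos hdst hd => ⟨pushLeft B τ (.inl dst) x,
      fun c P _ _ hP hPe => by simpa using runsLeft_push (B := B) (τ := τ) (.inl dst) x P⟩⟩
  | length =>
    refine ⟨0, 5 * .X + 2, fun N k K₂ τ _ B pos dst hk hpos hdst hd =>
      ⟨copyLength x (.inr true) (.inr false) (.inl dst), fun c P hw hw' _ _ => ?_⟩⟩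
    have := runsLeft_copyLength (B := B) (τ := τ) (x := x) (P := P) (i := .inr true)
        (j := .inr false) (dst := .inl dst) (by simp) (by simp) (by simp) hw'
    rw [hw] at this
    refine this.mono ?_
    simp [size]; omega
  | add _ _ ihf ihg =>
    obtain ⟨r, p, ih⟩ := ihf
    obtain ⟨r', p', ih'⟩ := ihg
    refine ⟨max r r', p + p', fun N k K₂ τ _ B pos dst hk hpos hdst hd => ?_⟩
    obtain ⟨F, hF⟩ := ih N k K₂ τ B pos dst (by omega) hpos hdst hd
    obtain ⟨G, hG⟩ := ih' N k K₂ τ B pos dst (by omega) hpos hdst hd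
    refine ⟨G.seq F, fun c P hw hw' hP hPe => ?_⟩
    rw [Polynomial.eval_add, Nat.add_comm]
    refine ((hG c P hw hw' hP hPe).seq (hF c _ (by simpa) (by simpa)
      (hP.imp_of_mem_right ?_) ?_)).of_eq ?_
    · intro y i hi e
      rwa [update_of_ne (by simpa using ne_of_mem_of_not_mem hi hd)]
    · intro i hi
      rw [update_of_ne (by simp [Fin.ext_iff]; omega), hPe i hi]
    · simp [← List.append_assoc]
  | @sub α word vars f g hf hg ihf ihg =>
    obtain ⟨r, p, ih⟩ := ihf
    obtain ⟨r', p', ih'⟩ := ihg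
    obtain ⟨q, hq⟩ := hf.exists_bound
    obtain ⟨q', hq'⟩ := hg.exists_bound
    refine ⟨max r r' + 2, p + p' + (2 * q + 2 * q' + 2),
      fun N k K₂ τ _ B pos dst hk hpos hdst hd => ?_⟩
    let t : Fin N := ⟨k, by omega⟩
    let u : Fin N := ⟨k + 1, by omega⟩
    obtain ⟨F, hF⟩ := ih N (k + 2) K₂ τ B pos t (by omega) (fun i hi => (hpos i hi).trans (by omega))
      (by simp [t]) (fun h => (hpos _ h).ne rfl)
    obtain ⟨G, hG⟩ := ih' N (k + 2) K₂ τ B pos u (by omega)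
      (fun i hi => (hpos i hi).trans (by omega)) (by simp [u])
      (fun h => absurd (hpos _ h) (by simp [u]))
    refine ⟨subtract F G (.inl t) (.inl u) (.inl dst), fun c P hw hw' hP hPe => ?_⟩
    refine (runsLeft_subtract (m := f c) (n := g c) (x := x) (by simp [t, u])
      (by simp [t, Fin.ext_iff]; omega)
      (by simp [u, Fin.ext_iff]; omega) (hPe t le_rfl) (hPe u (by simp [u]))
      ((hF c P hw hw' hP fun i hi => hPe i (by omega)).of_eq (by simp [hPe t le_rfl]))
      ((hG c (update P (.inl t) (List.replicate (f c) x)) (by simpa) (by simpa)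
        (hP.imp_of_mem_right ?_) ?_).of_eq ?_)).mono ?_
    · intro y i hi e
      rwa [update_of_ne (by simp only [ne_eq, Sum.inl.injEq]; rintro rfl; exact (hpos _ hi).ne rfl)]
    · intro i hi
      rw [update_of_ne (by simp [t, Fin.ext_iff]; omega), hPe i (by omega)]
    · rw [update_of_ne (by simp [t, u]), hPe u (by simp [u]), List.append_nil]
    · have := hq c
      have := hq' c
      simp only [Polynomial.eval_add, Polynomial.eval_mul, Polynomial.eval_ofNat]
      omega
  | @test α word vars f a hf ih =>
    obtain ⟨r, p, ih⟩ := ih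
    obtain ⟨q, hq⟩ := hf.exists_bound
    refine ⟨r + 1, p + (3 * q + 1) + 3 + (2 * .X + 1),
      fun N k K₂ τ _ B pos dst hk hpos hdst hd => ?_⟩
    let t : Fin N := ⟨k, by omega⟩
    obtain ⟨F, hF⟩ := ih N (k + 1) K₂ τ B pos t (by omega)
      (fun i hi => (hpos i hi).trans (by omega))
      (by simp [t]) (fun h => (hpos _ h).ne rfl)
    refine ⟨testSymbol F x a (.inl t) (.inr true) (.inr false) (.inl dst),
      fun c P hw hw' hP hPe => ?_⟩
    change RunsLeft _ _ _ (update P _ (List.replicate (if (word c)[f c]? = some a then 1 else 0) x ++ _))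
    rw [← hw]
    refine (runsLeft_testSymbol (n := f c) (by simp) (by simp) (by simp)
      (by simp [t, Fin.ext_iff]; omega) (by simp) (by simp) (hPe t le_rfl) hw'
      ((hF c P hw hw' hP fun i hi => hPe i (by omega)).of_eq (by simp [hPe t le_rfl]))).mono ?_
    have := hq c
    simp only [Polynomial.eval_add, Polynomial.eval_mul, Polynomial.eval_ofNat, Polynomial.eval_X,
      Polynomial.eval_one]
    have : (P (.inr true)).length ≤ size word vars c := by simp [hw, size]
    omega
  | @sum α word vars f g hf hg ihf ihg =>
    obtain ⟨r, p, ih⟩ := ihf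
    obtain ⟨r', p', ih'⟩ := ihg
    obtain ⟨q, hq⟩ := hf.exists_bound
    refine ⟨max r r' + 2, p + (q * (p'.comp (.X + q) + 2) + q + 2),
      fun N k K₂ τ _ B pos dst hk hpos hdst hd => ?_⟩
    let t : Fin N := ⟨k, by omega⟩
    let u : Fin N := ⟨k + 1, by omega⟩
    have hdu : dst ≠ u := by simp [u, Fin.ext_iff]; omega
    have hdt : dst ≠ t := by simp [t, Fin.ext_iff]; omega
    obtain ⟨F, hF⟩ := ih N (k + 2) K₂ τ B pos t (by omega) (fun i hi => (hpos i hi).trans (by omega))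
      (by simp [t]) (fun h => (hpos _ h).ne rfl)
    -- The index lives on `u`, in accordance with `Prod.snd` at the head of the variables, and the
    -- summands accumulate directly on `dst`.
    obtain ⟨G, hG⟩ := ih' N (k + 2) K₂ τ B (u :: pos) dst (by omega)
      (by
        intro i hi
        obtain rfl | hi := List.mem_cons.1 hi
        · simp [u]
        · exact (hpos i hi).trans (by omega))
      (by omega) (by simp [hdu, hd])
    refine ⟨summation F G x (.inl t) (.inl u), fun c P hw hw' hP hPe => ?_⟩
    refine (runsLeft_summation (x := x) (m := f c) (g := g c) (dst := .inl dst) (by simp [t, u])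
      (by simpa using hdt.symm) (by simpa using hdu.symm) (hPe t le_rfl) (hPe u (by simp [u]))
      ((hF c P hw hw' hP fun i hi => hPe i (by omega)).of_eq (by simp [hPe t le_rfl]))
      (u := p'.eval (size word vars c + q.eval (size word vars c)))
      fun n hn P' hP' hPP' => ?_).mono ?_
    · refine (hG (c, n) P' ?_ ?_ (.cons hP' ?_) ?_).mono (Polynomial.eval_mono_nat _ ?_)
      · rw [hPP' _ (by simp) (by simp) (by simp), hw]
      · rw [hPP' _ (by simp) (by simp) (by simp), hw']
      · refine (List.forall₂_map_left_iff).2 (hP.imp_of_mem_right fun y i hi e => ?_)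
        have := hpos i hi
        rw [hPP' _ (by simp [t, Fin.ext_iff]; omega) (by simp [u, Fin.ext_iff]; omega)
          (by simpa using ne_of_mem_of_not_mem hi hd), e]
      · intro i hi
        rw [hPP' _ (by simp [t, Fin.ext_iff]; omega) (by simp [u, Fin.ext_iff]; omega)
          (by simp [Fin.ext_iff]; omega), hPe i (by omega)]
      · have := hn.le.trans (hq c)
        simp only [size, List.map_cons, List.map_map, List.sum_cons, Function.comp_def] at this ⊢
        omega
    · have := Nat.mul_le_mul_right (p'.eval (size word vars c + q.eval (size word vars c)) + 2) (hq c)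
      have := hq c
      simp only [Polynomial.eval_add, Polynomial.eval_mul, Polynomial.eval_ofNat, Polynomial.eval_X,
        Polynomial.eval_comp]
      omega

end Definable

/-! ### Stack machines built from fragments -/

theorem Turing.TM2.Fragment.iterate_bind_none {X : Type*} (f : X → Option X) (n : ℕ) :
    (flip bind f)^[n] none = none := by
  induction n with
  | zero => rfl
  | succ n ih => rw [Function.iterate_succ_apply]; exact ih

namespace Turing.TM2

open Function

/-- The largest number of symbols that executing the statement pushes on the stack `k`. -/
def Stmt.pushes {K : Type} [DecidableEq K] {Γ : K → Type} {Λ σ : Type} (k : K) :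
    Stmt Γ Λ σ → ℕ
  | push k' _ q => (if k' = k then 1 else 0) + q.pushes k
  | peek _ _ q => q.pushes k
  | pop _ _ q => q.pushes k
  | load _ q => q.pushes k
  | branch _ q₁ q₂ => max (q₁.pushes k) (q₂.pushes k)
  | goto _ => 0
  | halt => 0

theorem length_stepAux_le {K : Type} [DecidableEq K] {Γ : K → Type} {Λ σ : Type} (k : K)
    (q : Stmt Γ Λ σ) (s : σ) (S : ∀ k, List (Γ k)) :
    ((stepAux q s S).stk k).length ≤ (S k).length + q.pushes k := by
  induction q generalizing s S with
  | push k' f q ih =>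
    refine (ih _ _).trans ?_
    by_cases h : k' = k
    · subst h; simp [Stmt.pushes]; omega
    · simp [Stmt.pushes, h, update_of_ne (Ne.symm h)]
  | peek k' f q ih => exact ih _ _
  | pop k' f q ih =>
    refine (ih _ _).trans ?_
    by_cases h : k = k'
    · subst h; simp [Stmt.pushes]
    · simp [Stmt.pushes, h]
  | load f q ih => exact ih _ _
  | branch p q₁ q₂ ih₁ ih₂ =>
    have := ih₁ s S
    have := ih₂ s S
    cases h : p s <;> simp [stepAux, h, Stmt.pushes] <;> omega
  | goto l => simp [stepAux]
  | halt => simp [stepAux]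

/-- Each step executes one statement and pushes a bounded number of symbols; the sum over the
finitely many labels bounds them all. This is why a circuit generated in polynomial time has
polynomial size. -/
theorem exists_length_le (tm : FinTM2) : ∃ r : ℕ, ∀ l l' t,
    TM2OutputsInTime tm l (some l') t → l'.length ≤ l.length + r * t := by
  let := tm.ΛFin
  refine ⟨∑ x, (tm.m x).pushes tm.k₁, fun l l' t h => ?_⟩
  have key : ∀ (n : ℕ) (c c' : tm.Cfg), (flip bind tm.step)^[n] (some c) = some c' →
      (c'.stk tm.k₁).length ≤ (c.stk tm.k₁).length + (∑ x, (tm.m x).pushes tm.k₁) * n := by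
    intro n
    induction n with
    | zero => intro c c' h; cases h; simp
    | succ n ih =>
      intro c c' h
      rw [iterate_succ_apply] at h
      obtain ⟨_ | x, s, S⟩ := c
      · exact absurd ((Fragment.iterate_bind_none tm.step n).symm.trans h) (by simp)
      · refine (ih _ _ h).trans ?_
        have h₁ := length_stepAux_le tm.k₁ (tm.m x) s S
        have h₂ := Finset.single_le_sum (f := fun x => (tm.m x).pushes tm.k₁)
          (fun _ _ => Nat.zero_le _) (Finset.mem_univ x)
        rw [Nat.mul_succ]
        simp only at h₂ ⊢
        omega
  have h₁ := key h.steps _ _ h.evals_in_steps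
  have h₂ : ((initList tm l).stk tm.k₁).length ≤ l.length := by
    -- The input stack may also be the output stack; otherwise the output stack starts empty.
    by_cases e : tm.k₁ = tm.k₀
    · have : ∀ k (e : k = tm.k₀), ((initList tm l).stk k).length = l.length := by
        rintro _ rfl; simp [initList]
      exact (this _ e).le
    · simp [initList, e]
  have h₃ : ((haltList tm l').stk tm.k₁).length = l'.length := by simp [haltList]
  have h₄ := Nat.mul_le_mul_left (∑ x, (tm.m x).pushes tm.k₁) h.steps_le_m
  simp only [Option.map_some] at h₁
  omega

namespace Fragment

/-- The machine that runs the fragment and halts. -/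
def machine {K : Type} [DecidableEq K] [Fintype K] {Γ : K → Type} {σ : Type} [Fintype σ]
    (F : Fragment Γ σ) (s₀ : σ) (k₀ k₁ : K) [Fintype (Γ k₀)] : FinTM2 :=
  letI := F.fin
  { K := K
    k₀ := k₀
    k₁ := k₁
    Γ := Γ
    Λ := Option F.Λ
    main := F.entry
    σ := σ
    initialState := s₀
    -- A final configuration in the sense of `haltList` has the initial state, so the exit restores
    -- it before halting. This is the extra step in `Runs.outputs`.
    m := fun l => l.elim (.load (fun _ => s₀) .halt) F.code }

theorem Runs.outputs {K : Type} [DecidableEq K] [Fintype K] {Γ : K → Type} {σ : Type} [Fintype σ]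
    {F : Fragment Γ σ} {s₀ : σ} {k₀ k₁ : K} [Fintype (Γ k₀)] {t : ℕ} {l : List (Γ k₀)}
    {l' : List (Γ k₁)}
    (h : F.Runs t (initList (F.machine s₀ k₀ k₁) l).stk (haltList (F.machine s₀ k₀ k₁) l').stk) :
    Nonempty (TM2OutputsInTime (F.machine s₀ k₀ k₁) l (some l') (t + 1)) := by
  have key : ∀ (n : ℕ) (c : Cfg Γ (Option F.Λ) σ) (s' : σ) (S' : ∀ k, List (Γ k)),
      F.StepsIn n c ⟨some none, s', S'⟩ →
      (flip bind (F.machine s₀ k₀ k₁).step)^[n] (some c) = some ⟨some none, s', S'⟩ := by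
    intro n
    induction n with
    | zero => intro c s' S' h; cases h; rfl
    | succ n ih =>
      rintro ⟨_ | _ | l, s, S⟩ s' S' ⟨d, hd, hn⟩
      · simp [Fragment.step] at hd
      · simp [Fragment.step] at hd
      · obtain rfl : _ = d := Option.some.inj hd
        rw [iterate_succ_apply]
        exact ih _ s' S' hn
  obtain ⟨s', n, hn, h⟩ := h s₀
  refine ⟨⟨⟨n + 1, ?_⟩, Nat.succ_le_succ hn⟩⟩
  rw [iterate_succ_apply']
  exact congrArg (flip bind (F.machine s₀ k₀ k₁).step) (key n _ s' _ h)

/-! ### Calling a machine -/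

variable {K₁ A I : Type}

/-- The alphabets of the input stack, the output stack, and the stacks of the machine `tm`. -/
@[reducible] def CallAlphabets (I : Type) (tm : FinTM2) : Bool ⊕ tm.K → Type
  | .inl b => cond b I Bool
  | .inr k => tm.Γ k

/-- An input stack, an output stack, and stacks of the machine `tm` together. -/
def callStacks {tm : FinTM2} (x : List I) (y : List Bool) (z : ∀ k, List (tm.Γ k)) :
    ∀ k, List (CallAlphabets I tm k)
  | .inl true => x
  | .inl false => y
  | .inr k => z k

theorem update_callStacks_input {tm : FinTM2} (x x' : List I) (y : List Bool)
    (z : ∀ k, List (tm.Γ k)) :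
    update (callStacks x y z) (.inl true) x' = callStacks x' y z := by
  funext k
  obtain (_ | _) | k := k
  · exact update_of_ne (by simp) _ _
  · exact update_self _ _ _
  · exact update_of_ne (by simp) _ _

theorem update_callStacks_output {tm : FinTM2} (x : List I) (y y' : List Bool)
    (z : ∀ k, List (tm.Γ k)) :
    update (callStacks x y z) (.inl false) y' = callStacks x y' z := by
  funext k
  obtain (_ | _) | k := k
  · exact update_self _ _ _
  · exact update_of_ne (by simp) _ _
  · exact update_of_ne (by simp) _ _

theorem update_callStacks {tm : FinTM2} (x : List I) (y : List Bool)
    (z : ∀ k, List (tm.Γ k)) (k : tm.K) (l : List (tm.Γ k)) :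
    update (callStacks x y z) (.inr k) l = callStacks x y (update z k l) := by
  funext j
  obtain (_ | _) | j := j
  · exact update_of_ne (by simp) _ _
  · exact update_of_ne (by simp) _ _
  · by_cases h : j = k
    · subst h; exact (update_self _ _ _).trans (update_self (f := z) _ _).symm
    · exact (update_of_ne (by simpa using h) _ _).trans (update_of_ne (f := z) h _).symm

variable [DecidableEq K₁]

/-- A statement of the machine `tm` as a part of a fragment. -/
def embedStmt (K₁ A I : Type) (tm : FinTM2) : Stmt tm.Γ tm.Λ tm.σ →
    Stmt (Alphabets K₁ A (CallAlphabets I tm)) (Option (Option tm.Λ)) (Option A × tm.σ)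
  | .push k f q => .push (.inr (.inr k)) (fun s => f s.2) (embedStmt K₁ A I tm q)
  | .peek k f q => .peek (.inr (.inr k)) (fun s o => (s.1, f s.2 o)) (embedStmt K₁ A I tm q)
  | .pop k f q => .pop (.inr (.inr k)) (fun s o => (s.1, f s.2 o)) (embedStmt K₁ A I tm q)
  | .load f q => .load (fun s => (s.1, f s.2)) (embedStmt K₁ A I tm q)
  | .branch p q₁ q₂ => .branch (fun s => p s.2) (embedStmt K₁ A I tm q₁) (embedStmt K₁ A I tm q₂)
  | .goto l => .goto fun s => some (some (l s.2))
  | .halt => .goto fun _ => none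

/-- A configuration of the machine `tm` as a part of a larger configuration. -/
def embedCfg {tm : FinTM2} (P : K₁ → List A) (x : List I) (y : List Bool) (o : Option A)
    (c : Cfg tm.Γ tm.Λ tm.σ) :
    Cfg (Alphabets K₁ A (CallAlphabets I tm)) (Option (Option tm.Λ)) (Option A × tm.σ) :=
  ⟨some (c.l.map some), (o, c.var), stackPair P (callStacks x y c.stk)⟩

theorem stepAux_embedStmt {tm : FinTM2} (P : K₁ → List A) (x : List I) (y : List Bool)
    (o : Option A) (q : Stmt tm.Γ tm.Λ tm.σ) (s : tm.σ) (z : ∀ k, List (tm.Γ k)) :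
    stepAux (embedStmt K₁ A I tm q) (o, s) (stackPair P (callStacks x y z)) =
      embedCfg P x y o (stepAux q s z) := by
  induction q generalizing s z with
  | push k f q ih =>
    simp only [embedStmt, stepAux, update_stackPair_inr, update_callStacks]
    exact ih _ _
  | peek k f q ih => exact ih _ _
  | pop k f q ih =>
    simp only [embedStmt, stepAux, update_stackPair_inr, update_callStacks]
    exact ih _ _
  | load f q ih => exact ih _ _
  | branch p q₁ q₂ ih₁ ih₂ => cases h : p s <;> simp [embedStmt, stepAux, h, ih₁, ih₂]
  | goto l => rfl
  | halt => rfl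

/-- The fragment that runs the machine `tm` on its own stacks. -/
def call (K₁ A I : Type) (tm : FinTM2) :
    Fragment (Alphabets K₁ A (CallAlphabets I tm)) (Option A × tm.σ) :=
  letI := tm.ΛFin
  { Λ := Option tm.Λ
    entry := some none
    code := fun l => l.elim (.load (fun s => (s.1, tm.initialState))
      (.goto fun _ => some (some tm.main))) fun l => embedStmt K₁ A I tm (tm.m l) }

/-- A fragment can be entered in any state, so one additional step loads the initial state of `tm`.
From then on the simulation is step by step, with halting of `tm` read as the exit of the fragment.
-/
theorem runs_call {tm : FinTM2} (P : K₁ → List A) (x : List I) (y : List Bool)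
    {l : List (tm.Γ tm.k₀)} {l' : List (tm.Γ tm.k₁)} {t : ℕ}
    (h : TM2OutputsInTime tm l (some l') t) :
    (call K₁ A I tm).Runs (t + 1) (stackPair P (callStacks x y (initList tm l).stk))
      (stackPair P (callStacks x y (haltList tm l').stk)) := by
  have key : ∀ (o : Option A) (n : ℕ) (c c' : tm.Cfg),
      (flip bind tm.step)^[n] (some c) = some c' →
      (call K₁ A I tm).StepsIn n (embedCfg P x y o c) (embedCfg P x y o c') := by
    intro o n
    induction n with
    | zero => intro c c' h; cases h; rfl
    | succ n ih =>
      intro c c' h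
      rw [iterate_succ_apply] at h
      obtain ⟨_ | k, s, S⟩ := c
      · exact absurd ((iterate_bind_none tm.step n).symm.trans h) (by simp)
      · exact ⟨_, congrArg some (stepAux_embedStmt P x y o (tm.m k) s S), ih _ _ h⟩
  intro s
  exact ⟨(s.1, tm.initialState), h.steps + 1, Nat.succ_le_succ h.steps_le_m, _, rfl,
    key s.1 h.steps _ _ h.evals_in_steps⟩

end Fragment

end Turing.TM2

/-! ### Transfer between stacks, and the verifying machine -/

namespace Turing.TM2.Fragment

open Function

section Transfer

variable {K₁ K₂ A τ : Type} [Fintype A] [DecidableEq K₁] [DecidableEq K₂] {B : K₂ → Type}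

theorem runs_fetch_reverse (k : K₂) (i : K₁) (g : B k → A) (P : K₁ → List A) (Q : ∀ k, List (B k)) :
    (forPop (.inr k) g fun a => push (.inl i) a :
      Fragment (Alphabets K₁ A B) (Option A × τ)).Runs ((Q k).length * 2 + 1) (stackPair P Q)
      (stackPair (update P i (((Q k).map g).reverse ++ P i)) (update Q k [])) := by
  have := runs_forPop (Γ := Alphabets K₁ A B) (τ := τ) (k := Sum.inr k) (g := g)
    (F := fun a => push (.inl i) a) (t := 1) (Q k)
    (fun n => stackPair (update P i ((((Q k).take n).map g).reverse ++ P i))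
      (update Q k ((Q k).drop n))) (by simp) fun n hn => ?_
  · simpa using this
  · have e := (List.take_append_getElem hn).symm
    rw [update_stackPair_inr]
    refine (runs_push _ _ _).cast ?_
    rw [update_stackPair_inl]
    simp [e, -List.take_append_getElem]

/-- Move the contents of the stack `k` on top of the stack `j`, by way of the stack `i`. -/
def fetch (k : K₂) (g : B k → A) (i j : K₁) : Fragment (Alphabets K₁ A B) (Option A × τ) :=
  (forPop (Sum.inr k) g fun a => push (Sum.inl i) a).seq (forLeft i fun a => pushLeft B τ j a)

/-- Passing through the auxiliary stack `i` reverses the word twice. -/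
theorem runs_fetch {k : K₂} {g : B k → A} {i j : K₁} {P : K₁ → List A} {Q : ∀ k, List (B k)}
    (hij : i ≠ j) (hP : P i = []) :
    (fetch k g i j : Fragment (Alphabets K₁ A B) (Option A × τ)).Runs ((Q k).length * 4 + 2)
      (stackPair P Q) (stackPair (update P j ((Q k).map g ++ P j)) (update Q k [])) := by
  refine (((runs_fetch_reverse k i g P Q).seq (runsLeft_move hij (fun a => a) _ _)).cast ?_).mono ?_
  · congr 1
    funext l
    by_cases hj : l = j
    · subst hj; simp [hij.symm, hP]
    · by_cases hi : l = i
      · subst hi; simp [hj, hP]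
      · simp [hj, hi]
  · simp [hP]; omega

/-- Replace each symbol on the stack `i` by the symbol `b` on the stack `k`. -/
def feed (i : K₁) (k : K₂) (b : B k) : Fragment (Alphabets K₁ A B) (Option A × τ) :=
  forPop (Sum.inl i) id fun _ => push (Sum.inr k) b

theorem runs_feed (k : K₂) (i : K₁) (b : B k) (P : K₁ → List A) (Q : ∀ k, List (B k)) :
    (feed i k b : Fragment (Alphabets K₁ A B) (Option A × τ)).Runs ((P i).length * 2 + 1) (stackPair P Q)
      (stackPair (update P i []) (update Q k (List.replicate (P i).length b ++ Q k))) := by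
  have := runs_forPop (Γ := Alphabets K₁ A B) (τ := τ) (k := Sum.inl i) (A := A) (g := id)
    (F := fun _ => push (.inr k) b) (t := 1) (P i)
    (fun n => stackPair (update P i ((P i).drop n)) (update Q k (List.replicate n b ++ Q k)))
    (by simp) fun n hn => ?_
  · simpa [feed] using this
  · rw [update_stackPair_inl]
    refine (runs_push _ _ _).cast ?_
    rw [update_stackPair_inr]
    simp [List.replicate_succ]

end Transfer

section Verifier

variable {I O : Type} [Fintype I] [Fintype O] {tm : FinTM2} {N : ℕ}

/-- The fragment that reads the input, evaluates `F` to prepare the input of the machine `tm`,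
appends the output of `tm` to the word, evaluates `G`, and outputs whether the result is
positive. -/
def verifier (g : tm.Γ tm.k₁ → O) (b b' : tm.Γ tm.k₀)
    (F G : Fragment (Alphabets (Fin (N + 2) ⊕ Bool) (I ⊕ O) (CallAlphabets I tm))
      (Option (I ⊕ O) × tm.σ)) :
    Fragment (Alphabets (Fin (N + 2) ⊕ Bool) (I ⊕ O) (CallAlphabets I tm))
      (Option (I ⊕ O) × tm.σ) :=
  (fetch (A := I ⊕ O) (B := CallAlphabets I tm) (Sum.inl true) Sum.inl (Sum.inr false)
    (Sum.inr true)).seq <| F.seq <|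
  -- The second component is fed first, since what is pushed later comes earlier in the input of
  -- `tm`.
  (feed (Sum.inl 1) (Sum.inr tm.k₀) b').seq <| (feed (Sum.inl 0) (Sum.inr tm.k₀) b).seq <|
  (call _ _ _ tm).seq <|
  (fetch (A := I ⊕ O) (B := CallAlphabets I tm) (Sum.inr tm.k₁) (Sum.inr ∘ g) (Sum.inr false)
    (Sum.inr true)).seq <| G.seq <|
  -- The first digit decides positivity. The remaining digits and the word are then erased, because
  -- all stacks except the output must be empty at the end.
  (popCase (Sum.inl (Sum.inl 0)) id fun o => push (Sum.inr (Sum.inl false)) o.isSome).seq <|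
  (forLeft (Sum.inl 0) fun _ => skip).seq (forLeft (Sum.inr true) fun _ => skip)

theorem runs_verifier {g : tm.Γ tm.k₁ → O} {b b' : tm.Γ tm.k₀}
    {F G : Fragment (Alphabets (Fin (N + 2) ⊕ Bool) (I ⊕ O) (CallAlphabets I tm))
      (Option (I ⊕ O) × tm.σ)} {x : I ⊕ O} {l : List I} {y : List (tm.Γ tm.k₁)} {n m v t u r : ℕ}
    (hF : F.RunsLeft t (update (fun _ => []) (Sum.inr true) (l.map Sum.inl))
      (update (update (update (fun _ => []) (Sum.inr true) (l.map Sum.inl)) (Sum.inl 1)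
        (List.replicate m x)) (Sum.inl 0) (List.replicate n x)))
    (htm : TM2OutputsInTime tm (List.replicate n b ++ List.replicate m b') (some y) u)
    (hG : G.RunsLeft r (update (fun _ => []) (Sum.inr true) (y.map (Sum.inr ∘ g) ++ l.map Sum.inl))
      (update (update (fun _ => []) (Sum.inr true) (y.map (Sum.inr ∘ g) ++ l.map Sum.inl)) (Sum.inl 0)
        (List.replicate v x))) :
    (verifier g b b' F G).Runs
      (l.length * 5 + y.length * 5 + m * 2 + n * 2 + v + t + u + r + 12)
      (stackPair (fun _ => []) (callStacks l [] fun _ => []))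
      (stackPair (fun _ => []) (callStacks [] [decide (0 < v)] fun _ => [])) := by
  have h₁ : (fetch (Sum.inl true) Sum.inl (Sum.inr false) (Sum.inr true) :
      Fragment (Alphabets (Fin (N + 2) ⊕ Bool) (I ⊕ O) (CallAlphabets I tm))
        (Option (I ⊕ O) × tm.σ)).Runs
      (l.length * 4 + 2) (stackPair (fun _ => []) (callStacks l [] fun _ => []))
      (stackPair (update (fun _ => []) (Sum.inr true) (l.map Sum.inl))
        (callStacks [] [] fun _ => [])) := by
    refine Runs.cast (runs_fetch (τ := tm.σ) (A := I ⊕ O) (B := CallAlphabets I tm)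
      (k := Sum.inl true) (g := Sum.inl) (i := Sum.inr false) (j := Sum.inr true)
      (P := fun _ : Fin (N + 2) ⊕ Bool => []) (Q := callStacks l [] fun _ => []) (by simp) rfl) ?_
    rw [update_callStacks_input]
    refine congrArg₂ stackPair (congrArg _ ?_) rfl
    exact List.append_nil _
  have h₂ : (feed (Sum.inl 1) (Sum.inr tm.k₀) b' :
      Fragment (Alphabets (Fin (N + 2) ⊕ Bool) (I ⊕ O) (CallAlphabets I tm))
        (Option (I ⊕ O) × tm.σ)).Runs (m * 2 + 1)
      (stackPair (update (update (update (fun _ => []) (Sum.inr true) (l.map Sum.inl)) (Sum.inl 1)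
        (List.replicate m x)) (Sum.inl 0) (List.replicate n x)) (callStacks [] [] fun _ => []))
      (stackPair (update (update (fun _ => []) (Sum.inr true) (l.map Sum.inl)) (Sum.inl 0)
        (List.replicate n x))
        (callStacks [] [] (update (fun _ => []) tm.k₀ (List.replicate m b')))) := by
    refine ((runs_feed _ _ _ _ _).cast ?_).mono ?_
    · rw [update_callStacks]
      refine congrArg₂ stackPair ?_ (congrArg _ ?_)
      · funext k
        by_cases hk : k = Sum.inl 1
        · subst hk; simp
        · by_cases hk' : k = Sum.inl 0
          · subst hk'; simp
          · simp [hk, hk']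
      · simp [callStacks]
    · simp
  have h₃ : (feed (Sum.inl 0) (Sum.inr tm.k₀) b :
      Fragment (Alphabets (Fin (N + 2) ⊕ Bool) (I ⊕ O) (CallAlphabets I tm))
        (Option (I ⊕ O) × tm.σ)).Runs (n * 2 + 1)
      (stackPair (update (update (fun _ => []) (Sum.inr true) (l.map Sum.inl)) (Sum.inl 0)
        (List.replicate n x))
        (callStacks [] [] (update (fun _ => []) tm.k₀ (List.replicate m b'))))
      (stackPair (update (fun _ => []) (Sum.inr true) (l.map Sum.inl))
        (callStacks [] [] (initList tm (List.replicate n b ++ List.replicate m b')).stk)) := by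
    refine ((runs_feed _ _ _ _ _).cast ?_).mono ?_
    · rw [update_callStacks]
      refine congrArg₂ stackPair ?_ (congrArg _ ?_)
      · funext k
        by_cases hk : k = Sum.inl 0
        · subst hk; simp
        · simp [hk]
      · funext k
        by_cases hk : k = tm.k₀
        · subst hk; simp [callStacks, initList]
        · simp [hk, initList]
    · simp
  have h₄ : (fetch (Sum.inr tm.k₁) (Sum.inr ∘ g) (Sum.inr false) (Sum.inr true) :
      Fragment (Alphabets (Fin (N + 2) ⊕ Bool) (I ⊕ O) (CallAlphabets I tm))
        (Option (I ⊕ O) × tm.σ)).Runs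
      (y.length * 4 + 2) (stackPair (update (fun _ => []) (Sum.inr true) (l.map Sum.inl))
        (callStacks [] [] (haltList tm y).stk))
      (stackPair (update (fun _ => []) (Sum.inr true) (y.map (Sum.inr ∘ g) ++ l.map Sum.inl))
        (callStacks [] [] fun _ => [])) := by
    have e : (callStacks [] [] (haltList tm y).stk : ∀ k, List (CallAlphabets I tm k))
        (Sum.inr tm.k₁) = y := by simp [callStacks, haltList]
    refine ((runs_fetch (i := Sum.inr false) (j := Sum.inr true) (by simp) (by simp)).cast ?_).mono
      (by rw [e])
    rw [update_callStacks, e]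
    refine congrArg₂ stackPair ?_ (congrArg _ ?_)
    · simp
    · funext k
      by_cases hk : k = tm.k₁
      · subst hk; simp
      · simp [hk, haltList]
  have h₅ : (popCase (Sum.inl (Sum.inl 0)) id fun o => push (Sum.inr (Sum.inl false)) o.isSome :
      Fragment (Alphabets (Fin (N + 2) ⊕ Bool) (I ⊕ O) (CallAlphabets I tm))
        (Option (I ⊕ O) × tm.σ)).Runs 2
      (stackPair (update (update (fun _ => []) (Sum.inr true)
        (y.map (Sum.inr ∘ g) ++ l.map Sum.inl)) (Sum.inl 0) (List.replicate v x))
        (callStacks [] [] fun _ => []))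
      (stackPair (update (update (fun _ => []) (Sum.inr true)
        (y.map (Sum.inr ∘ g) ++ l.map Sum.inl)) (Sum.inl 0) (List.replicate (v - 1) x))
        (callStacks [] [decide (0 < v)] fun _ => [])) := by
    refine runs_popCase (t := 1) ((runs_push _ _ _).cast ?_)
    rw [update_stackPair_inl, update_stackPair_inr, update_callStacks_output]
    refine congrArg₂ stackPair ?_ ?_
    · simp
    · cases v <;> simp [callStacks, List.replicate_succ]
  refine (h₁.seq <| (hF _).seq <| h₂.seq <| h₃.seq <| (runs_call _ _ _ htm).seq <| h₄.seq <|
    (hG _).seq <| h₅.seq <| ((runsLeft_clear _ _ _).seq (runsLeft_clear _ _ _)).cast ?_).mono ?_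
  · refine congrArg₂ stackPair ?_ rfl
    funext k
    by_cases hk : k = Sum.inr true
    · subst hk; simp
    · by_cases hk' : k = Sum.inl 0
      · subst hk'; simp
      · simp [hk, hk']
  · simp; omega

end Verifier

end Turing.TM2.Fragment

/-! ### Verifiers that call a circuit generator -/

instance : Fintype CircuitSymbol where
  elems := {.one, .sep, .notGate, .andGate, .orGate, .output}
  complete a := by cases a <;> simp

theorem encode_pnat_pair (n m : ℕ+) :
    (encodingProd unaryEncodingPNat unaryEncodingPNat).encode (n, m) =
      List.replicate n (.inl true) ++ List.replicate m (.inr true) := by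
  have h : ∀ k : ℕ+, unaryEncodingPNat.encode k = List.replicate k true := by
    intro k
    have : ∀ k, unaryEncodeNat k = List.replicate k true := by
      intro k
      induction k with
      | zero => rfl
      | succ k ih => simp [unaryEncodeNat, ih, List.replicate_succ]
    exact this k
  simp [encodingProd, h]

theorem PolyTimeComputable.exists_length_le {α β A B : Type} {ea : Encoding α A}
    {eb : Encoding β B} {f : α → β} (h : PolyTimeComputable ea eb f) :
    ∃ q : Polynomial ℕ, ∀ a, (eb.encode (f a)).length ≤ q.eval (ea.encode a).length := by
  obtain ⟨h⟩ := h
  obtain ⟨r, hr⟩ := Turing.TM2.exists_length_le h.tm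
  refine ⟨.X + .C r * h.time, fun a => ?_⟩
  simpa using hr _ _ _ (h.outputsFun a)

theorem Turing.TM2OutputsInTime.nonempty_cast {tm : Turing.FinTM2} {l l₁ : List (tm.Γ tm.k₀)}
    {o o₁ : Option (List (tm.Γ tm.k₁))} {t t₁ : ℕ}
    (h : Nonempty (Turing.TM2OutputsInTime tm l o t)) (hl : l = l₁) (ho : o = o₁) (ht : t ≤ t₁) :
    Nonempty (Turing.TM2OutputsInTime tm l₁ o₁ t₁) := by
  subst hl ho
  exact h.map fun h => ⟨h.toEvalsTo, h.steps_le_m.trans ht⟩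

-- The functions `en` and `em` see the bare input, as they prepare the call of the generator, while
-- `ev` sees the generated circuit in front of the input. The length of the circuit is polynomial in
-- `n a + m a`, hence in the input length, and so is the time for evaluating `ev` on the combined
-- word.
open Turing Turing.TM2 Turing.TM2.Fragment Function in
theorem PolyTimeComputable.verifier {α I : Type} [Fintype I] [DecidableEq I] (ea : Encoding α I)
    {δ : ℕ+ × ℕ+ → BoolCircuit}
    (hδ : PolyTimeComputable (encodingProd unaryEncodingPNat unaryEncodingPNat) circuitEncoding δ)
    (n m : α → ℕ+) {en em ev : List (I ⊕ CircuitSymbol) → ℕ}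
    (hn : Definable id [] en) (hm : Definable id [] em) (hv : Definable id [] ev)
    (hn' : ∀ a, en ((ea.encode a).map .inl) = n a) (hm' : ∀ a, em ((ea.encode a).map .inl) = m a) :
    PolyTimeComputable ea encodingBoolBool fun a =>
      decide (0 < ev ((δ (n a, m a)).encode.map .inr ++ (ea.encode a).map .inl)) := by
  classical
  obtain ⟨q, hq⟩ := hδ.exists_length_le
  obtain ⟨h⟩ := hδ
  let := h.tm.kFin
  let := h.tm.σFin
  -- Any symbol could serve as unary digit, since numbers and the word are kept on separate stacks.
  let x : I ⊕ CircuitSymbol := .inr .one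
  obtain ⟨rn, pn, In⟩ := hn.exists_evaluates x
  obtain ⟨rm, pm, Im⟩ := hm.exists_evaluates x
  obtain ⟨rv, pv, Iv⟩ := hv.exists_evaluates x
  obtain ⟨qn, hqn⟩ := hn.exists_bound
  obtain ⟨qm, hqm⟩ := hm.exists_bound
  obtain ⟨qv, hqv⟩ := hv.exists_bound
  let N := max rn (max rm rv)
  -- There are no free variables, so `pos` is empty; the stacks `0` and `1` receive results, and the
  -- auxiliary stacks start at `2`.
  obtain ⟨Fn, hFn⟩ := In (N + 2) 2 (Bool ⊕ h.tm.K) h.tm.σ (CallAlphabets I h.tm) [] 0 (by omega)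
    (by simp) (by simp) (by simp)
  obtain ⟨Fm, hFm⟩ := Im (N + 2) 2 (Bool ⊕ h.tm.K) h.tm.σ (CallAlphabets I h.tm) [] 1 (by omega)
    (by simp) (by simp) (by simp)
  obtain ⟨Fv, hFv⟩ := Iv (N + 2) 2 (Bool ⊕ h.tm.K) h.tm.σ (CallAlphabets I h.tm) [] 0 (by omega)
    (by simp) (by simp) (by simp)
  let F := TM2.Fragment.verifier (fun b => h.outputAlphabet b) (h.inputAlphabet.symm (.inl true))
    (h.inputAlphabet.symm (.inr true)) (Fm.seq Fn) Fv
  let y : Polynomial ℕ := q.comp (qn + qm)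
  let : Fintype (Alphabets (Fin (N + 2) ⊕ Bool) (I ⊕ CircuitSymbol) (CallAlphabets I h.tm)
    (.inr (.inl true))) := ‹Fintype I›
  refine ⟨⟨⟨F.machine (none, h.tm.initialState) (.inr (.inl true)) (.inr (.inl false)),
    Equiv.refl I, Equiv.refl Bool⟩, .X * 5 + y * 5 + qm * 2 + qn * 2 + qv.comp (y + .X) + (pm + pn) +
      h.time.comp (qn + qm) + pv.comp (y + .X) + 12 + 1, fun a => Classical.choice ?_⟩⟩
  let l := ea.encode a
  let w : List (I ⊕ CircuitSymbol) := (δ (n a, m a)).encode.map .inr ++ l.map .inl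
  have hl : Definable.size id [] (l.map .inl : List (I ⊕ CircuitSymbol)) = l.length := by
    simp [Definable.size]
  have hsn : (n a : ℕ) ≤ qn.eval l.length := by
    have := hqn (l.map .inl)
    rwa [show en (l.map .inl) = n a from hn' a,
      hl] at this
  have hsm : (m a : ℕ) ≤ qm.eval l.length := by
    have := hqm (l.map .inl)
    rwa [show em (l.map .inl) = m a from hm' a,
      hl] at this
  have hin : ((encodingProd unaryEncodingPNat unaryEncodingPNat).encode (n a, m a)).length =
      n a + m a := by simp [encode_pnat_pair]
  have hy : (δ (n a, m a)).encode.length ≤ y.eval l.length := by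
    refine (hq (n a, m a)).trans ?_
    rw [hin, Polynomial.eval_comp, Polynomial.eval_add]
    exact Polynomial.eval_mono_nat _ (add_le_add hsn hsm)
  have hsize : Definable.size id [] w ≤ y.eval l.length + l.length := by
    simpa [Definable.size, w] using hy
  have hF₁ := (hFm (l.map .inl) (update (fun _ => []) (.inr true) (l.map .inl))
    (by simp) (by simp) .nil (by simp))
  have hF₂ := hFn (l.map .inl) (update (update (fun _ => []) (.inr true) (l.map .inl))
    (.inl 1) (List.replicate (m a) x)) (by simp) (by simp) .nil
    (fun i hi => by
      have : i ≠ 1 := by rintro rfl; simp at hi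
      simp [this])
  have hF := hF₁.seq (hF₂.cast_left (by simp [show em (l.map .inl) = m a from hm' a]))
  have hF₃ := hFv w (update (fun _ => []) (.inr true) w) (by simp) (by simp) .nil (by simp)
  have htm := h.outputsFun (n a, m a)
  have e : List.map h.inputAlphabet.invFun
      ((encodingProd unaryEncodingPNat unaryEncodingPNat).encode (n a, m a)) =
      List.replicate (n a) (h.inputAlphabet.symm (.inl true)) ++
        List.replicate (m a) (h.inputAlphabet.symm (.inr true)) := by
    simp [encode_pnat_pair]
  rw [e, hin] at htm
  have hy' := hqv w
  have hv' := Polynomial.eval_mono_nat qv hsize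
  have hp' := Polynomial.eval_mono_nat pv hsize
  have hu' := Polynomial.eval_mono_nat h.time (add_le_add hsn hsm)
  have ew : (List.map h.outputAlphabet.invFun (circuitEncoding.encode (δ (n a, m a)))).map
      (Sum.inr ∘ fun b => h.outputAlphabet b) ++ l.map .inl = w := by
    rw [List.map_map]
    congr 1
    refine List.map_congr_left fun b _ => ?_
    simp
  have hy₂ : (List.map h.outputAlphabet.invFun
      (circuitEncoding.encode (δ (n a, m a)))).length ≤ y.eval l.length := by
    rw [List.length_map]
    exact hy
  have key := runs_verifier (g := fun b => h.outputAlphabet b) (x := x) (l := l)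
    (v := ev w) (hF.of_eq ?_) htm ((hF₃.of_eq ?_).cast_left ?_)
  · have H := Runs.outputs (F := F) (s₀ := (none, h.tm.initialState)) (k₀ := .inr (.inl true))
      (k₁ := .inr (.inl false)) (l := l) (l' := [decide (0 < ev w)]) ((key.cast ?_).cast_left ?_)
    · refine TM2OutputsInTime.nonempty_cast H (List.map_id _).symm ?_ ?_
      · simp [encodingBoolBool, encodeBool]
        rfl
      · simp only [Polynomial.eval_add, Polynomial.eval_mul, Polynomial.eval_ofNat,
          Polynomial.eval_comp, Polynomial.eval_X, Polynomial.eval_one] at *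
        generalize (List.map h.outputAlphabet.invFun
          (circuitEncoding.encode (δ (n a, m a)))).length = k at *
        rw [hl, show ea.encode a = l from rfl]
        omega
    · funext k
      obtain (i | i) | (_ | _) | i := k <;> rfl
    · funext k
      obtain (i | i) | (_ | _) | i := k <;> rfl
  · simp [show en (l.map .inl) = n a from hn' a]
  · rw [ew]
    simp
  · rw [ew]

/-! ### Closure properties of definable functions and predicates -/

section

variable {α β A : Type} [DecidableEq A] {word : α → List A} {vars : List (α → ℕ)}

namespace Definable

variable {f g : α → ℕ}

theorem of_eq (hf : Definable word vars f) (h : ∀ c, f c = g c) : Definable word vars g :=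
  funext h ▸ hf

/-- This renaming of variables precedes `subst`, which needs its special case `weaken` to pass under
a sum. -/
theorem comap (hf : Definable word vars f) {φ : β → α} {vars' : List (β → ℕ)}
    (h : ∀ x ∈ vars, x ∘ φ ∈ vars') : Definable (word ∘ φ) vars' (f ∘ φ) := by
  induction hf generalizing β with
  | var hx => exact .var (h _ hx)
  | one => exact .one
  | length => exact .length (word := _ ∘ φ)
  | add _ _ hf hg => exact .add (hf h) (hg h)
  | sub _ _ hf hg => exact .sub (hf h) (hg h)
  | test a _ hf => exact .test (word := _ ∘ φ) a (hf h)
  | sum _ _ hf hg =>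
    refine .sum (word := _ ∘ φ) (hf h) (hg (φ := Prod.map φ id) fun x hx => ?_)
    simp only [List.mem_cons, List.mem_map] at hx ⊢
    obtain rfl | ⟨y, hy, rfl⟩ := hx
    · exact .inl rfl
    · exact .inr ⟨_, h y hy, rfl⟩

theorem weaken (hf : Definable word vars f) : Definable (fun p : α × ℕ => word p.1)
    (Prod.snd :: vars.map fun x (p : α × ℕ) => x p.1) fun p => f p.1 :=
  hf.comap (φ := Prod.fst) fun _ hx => .tail _ (List.mem_map.2 ⟨_, hx, rfl⟩)

theorem subst (hf : Definable word vars f) {φ : β → α} {vars' : List (β → ℕ)}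
    (h : ∀ x ∈ vars, Definable (word ∘ φ) vars' (x ∘ φ)) :
    Definable (word ∘ φ) vars' (f ∘ φ) := by
  induction hf generalizing β with
  | var hx => exact h _ hx
  | one => exact .one
  | length => exact .length (word := _ ∘ φ)
  | add _ _ hf hg => exact .add (hf h) (hg h)
  | sub _ _ hf hg => exact .sub (hf h) (hg h)
  | test a _ hf => exact .test (word := _ ∘ φ) a (hf h)
  | sum _ _ hf hg =>
    refine .sum (word := _ ∘ φ) (hf h) (hg (φ := Prod.map φ id) fun x hx => ?_)
    simp only [List.mem_cons, List.mem_map] at hx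
    obtain rfl | ⟨y, hy, rfl⟩ := hx
    · exact .var (.head _)
    · exact (h y hy).weaken

/-- Quantities read off the word alone are defined once without variables and then reused under any
number of quantifiers. -/
theorem closed {f : List A → ℕ} (hf : Definable id [] f) :
    Definable word vars fun c => f (word c) :=
  hf.comap (φ := word) (by simp)

theorem const (k : ℕ) : Definable word vars fun _ => k := by
  induction k with
  | zero => exact (sub one one).of_eq (by simp)
  | succ k ih => exact ih.add one

theorem mul (hf : Definable word vars f) (hg : Definable word vars g) :
    Definable word vars fun c => f c * g c :=
  (hf.sum (g := fun c _ => g c) hg.weaken).of_eq (by simp)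

end Definable

/-! ### Definable predicates: connectives and bounded quantifiers -/

/-- The predicate is decided by the positivity of a definable function. -/
def DefinablePred (word : α → List A) (vars : List (α → ℕ)) (P : α → Prop) : Prop :=
  ∃ f, Definable word vars f ∧ ∀ c, P c ↔ 0 < f c

namespace DefinablePred

variable {P Q : α → Prop} {f g : α → ℕ}

theorem of_iff (hP : DefinablePred word vars P) (h : ∀ c, P c ↔ Q c) :
    DefinablePred word vars Q :=
  (funext fun c => propext (h c) : P = Q) ▸ hP

theorem subst₁ {P : List A → ℕ → Prop}
    (hP : DefinablePred Prod.fst [Prod.snd] fun p => P p.1 p.2) (hf : Definable word vars f) :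
    DefinablePred word vars fun c => P (word c) (f c) :=
  let ⟨_, hg, h⟩ := hP
  ⟨_, hg.subst (φ := fun c => (word c, f c)) (List.forall_mem_singleton.2 hf), fun c =>
    h (word c, f c)⟩

theorem subst₂ {P : List A → ℕ → ℕ → Prop}
    (hP : DefinablePred (fun p : List A × ℕ × ℕ => p.1) [fun p => p.2.1, fun p => p.2.2]
      fun p => P p.1 p.2.1 p.2.2)
    (hf : Definable word vars f) (hg : Definable word vars g) :
    DefinablePred word vars fun c => P (word c) (f c) (g c) :=
  let ⟨_, hk, h⟩ := hP
  ⟨_, hk.subst (φ := fun c => (word c, f c, g c))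
    (List.forall_mem_cons.2 ⟨hf, List.forall_mem_singleton.2 hg⟩), fun c =>
    h (word c, f c, g c)⟩

theorem not (hP : DefinablePred word vars P) : DefinablePred word vars fun c => ¬ P c :=
  let ⟨_, hf, h⟩ := hP
  ⟨_, Definable.one.sub hf, fun c => by simp [h c]⟩

theorem and (hP : DefinablePred word vars P) (hQ : DefinablePred word vars Q) :
    DefinablePred word vars fun c => P c ∧ Q c :=
  let ⟨_, hf, h⟩ := hP
  let ⟨_, hg, h'⟩ := hQ
  ⟨_, hf.mul hg, fun c => by simp [h c, h' c]⟩

theorem or (hP : DefinablePred word vars P) (hQ : DefinablePred word vars Q) :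
    DefinablePred word vars fun c => P c ∨ Q c :=
  let ⟨_, hf, h⟩ := hP
  let ⟨_, hg, h'⟩ := hQ
  ⟨_, hf.add hg, fun c => by simp [h c, h' c]⟩

theorem imp (hP : DefinablePred word vars P) (hQ : DefinablePred word vars Q) :
    DefinablePred word vars fun c => P c → Q c :=
  (hP.not.or hQ).of_iff fun _ => imp_iff_not_or.symm

theorem iff (hP : DefinablePred word vars P) (hQ : DefinablePred word vars Q) :
    DefinablePred word vars fun c => P c ↔ Q c :=
  ((hP.imp hQ).and (hQ.imp hP)).of_iff fun _ => iff_def.symm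

theorem lt (hf : Definable word vars f) (hg : Definable word vars g) :
    DefinablePred word vars fun c => f c < g c :=
  ⟨_, hg.sub hf, fun _ => tsub_pos_iff_lt.symm⟩

theorem eq (hf : Definable word vars f) (hg : Definable word vars g) :
    DefinablePred word vars fun c => f c = g c :=
  ((lt hf hg).or (lt hg hf)).not.of_iff fun c => by omega

theorem test (a : A) (hf : Definable word vars f) :
    DefinablePred word vars fun c => (word c)[f c]? = some a :=
  ⟨_, hf.test a, fun c => by split <;> simp_all⟩

/-- A sum of natural numbers is positive exactly when some summand is. -/
theorem exists_lt {P : α → ℕ → Prop} (hf : Definable word vars f)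
    (hP : DefinablePred (fun p : α × ℕ => word p.1)
      (Prod.snd :: vars.map fun x (p : α × ℕ) => x p.1) fun p => P p.1 p.2) :
    DefinablePred word vars fun c => ∃ x < f c, P c x :=
  let ⟨k, hg, h⟩ := hP
  ⟨_, hf.sum (g := fun c x => k (c, x)) hg, fun c => by
    simp [Finset.sum_pos_iff, fun x => h (c, x)]⟩

theorem forall_lt {P : α → ℕ → Prop} (hf : Definable word vars f)
    (hP : DefinablePred (fun p : α × ℕ => word p.1)
      (Prod.snd :: vars.map fun x (p : α × ℕ) => x p.1) fun p => P p.1 p.2) :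
    DefinablePred word vars fun c => ∀ x < f c, P c x :=
  (exists_lt (P := fun c x => ¬ P c x) hf hP.not).not.of_iff fun c => by simp

-- The double complement `1 - (1 - k)` turns a positive value into `1`, so the sum counts.
open Classical in
theorem _root_.Definable.card {P : α → ℕ → Prop} (hf : Definable word vars f)
    (hP : DefinablePred (fun p : α × ℕ => word p.1)
      (Prod.snd :: vars.map fun x (p : α × ℕ) => x p.1) fun p => P p.1 p.2) :
    Definable word vars fun c => ((Finset.range (f c)).filter (P c)).card :=
  let ⟨k, hg, h⟩ := hP
  (hf.sum (g := fun c x => 1 - (1 - k (c, x)))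
    (Definable.one.sub (Definable.one.sub hg))).of_eq fun c => by
      rw [Finset.card_filter]
      refine Finset.sum_congr rfl fun x _ => ?_
      have : P c x ↔ 0 < k (c, x) := h (c, x)
      split <;> simp_all
      omega

/-- The symbol at a definable position exists and belongs to a given set. -/
theorem any [Fintype A] (s : A → Bool) (hf : Definable word vars f) :
    DefinablePred word vars fun c => ((word c)[f c]?).any s := by
  have : ∀ S : Finset A, DefinablePred word vars fun c => ∃ a ∈ S, (word c)[f c]? = some a := by
    intro S
    induction S using Finset.induction with
    | empty => exact ((eq .one .one).not).of_iff (by simp)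
    | insert a S _ ih => exact ((test a hf).or ih).of_iff (by simp)
  exact (this (Finset.univ.filter (s · = true))).of_iff fun c => by
    cases (word c)[f c]? <;> simp

end DefinablePred

/-! ### Initial runs and counts of symbols -/

namespace List

/-- The length of the longest initial segment with elements from `s`. -/
def runLength (s : A → Bool) (l : List A) : ℕ := (l.takeWhile s).length

-- Replaces the recursion in `takeWhile` by a bounded quantifier. The bound is `k + 1` because
-- position `k` must itself belong to the run.
omit [DecidableEq A] in
theorem lt_runLength_iff {s : A → Bool} {l : List A} {k : ℕ} :
    k < l.runLength s ↔ ∀ j < k + 1, (l[j]?).any s := by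
  induction l generalizing k with
  | nil => simpa [runLength] using ⟨0, by simp⟩
  | cons a l ih =>
    rw [runLength, takeWhile_cons]
    by_cases h : s a
    · cases k with
      | zero => simp [h]
      | succ k =>
        have := ih (k := k)
        simp only [runLength] at this
        simp only [h, if_true, length_cons, add_lt_add_iff_right, this]
        refine ⟨fun H j hj => ?_, fun H j hj => by simpa using H (j + 1) (by omega)⟩
        cases j with
        | zero => simpa using h
        | succ j => simpa using H j (by omega)
    · simpa [h] using ⟨0, by simp [h]⟩

end List

namespace Definable

variable [Fintype A] {f : α → ℕ}

/-- The length of the run is the number of indices `k` that lie inside it, and being inside is a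
bounded quantifier. -/
theorem runLength (s : A → Bool) (hf : Definable word vars f) :
    Definable word vars fun c => ((word c).drop (f c)).runLength s := by
  classical
  refine (card (f := fun c => (word c).length) .length (P := fun c k => ∀ j < k + 1,
    ((word c)[f c + j]?).any s) (.forall_lt (.add (.var (.head _)) .one) (.any s
      (.add hf.weaken.weaken (.var (.head _)))))).of_eq fun c => ?_
  have : ((Finset.range (word c).length).filter fun k => ∀ j < k + 1,
      ((word c)[f c + j]?).any s) = Finset.range (((word c).drop (f c)).runLength s) := by
    ext k
    have := List.lt_runLength_iff (s := s) (l := (word c).drop (f c)) (k := k)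
    simp only [List.getElem?_drop] at this
    rw [Finset.mem_filter, Finset.mem_range, Finset.mem_range, this, and_iff_right_iff_imp,
      ← this]
    intro h
    refine h.trans_le ((List.takeWhile_sublist s).length_le.trans ?_)
    simp
  exact (by congr! : _ = _).trans ((congrArg Finset.card this).trans (Finset.card_range _))

theorem countP_take (s : A → Bool) (hf : Definable word vars f) :
    Definable word vars fun c => ((word c).take (f c)).countP s := by
  classical
  refine (card hf (P := fun c k => ((word c)[k]?).any s) (.any s (.var (.head _)))).of_eq
    fun c => ?_
  generalize f c = n
  generalize word c = l
  induction n with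
  | zero => simp
  | succ n ih =>
    rw [Finset.range_add_one, Finset.filter_insert, List.take_add_one, List.countP_append, ← ih]
    cases l[n]? <;> simp [List.countP_cons]
    split <;> simp_all

theorem countP (s : A → Bool) : Definable word vars fun c => (word c).countP s :=
  (countP_take s .length).of_eq fun _ => by rw [List.take_length]

end Definable

end

/-! ### Evaluation of circuits by consistent wire values -/

theorem Gate.eval_congr {k : ℕ} {g : Gate} (hg : g.Below k) {u v : ℕ → Bool}
    (h : ∀ i < k, u i = v i) : g.eval u = g.eval v := by
  cases g with
  | not a => simp [Gate.eval, h a hg]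
  | and a b => simp [Gate.eval, h a hg.1, h b hg.2]
  | or a b => simp [Gate.eval, h a hg.1, h b hg.2]

/-- Consistent values are unique: a gate reads only earlier wires, so the first gate can be treated
as one more input, which is why `n` varies in the induction. -/
theorem wireValues_eq {u : ℕ → Bool} {n : ℕ} {gs : List Gate}
    (hb : ∀ (k : ℕ) (h : k < gs.length), (gs[k]).Below (n + k))
    (hu : ∀ (k : ℕ) (h : k < gs.length), u (n + k) = (gs[k]).eval u) :
    wireValues ((List.range n).map u) gs = (List.range (n + gs.length)).map u := by
  induction gs generalizing n with
  | nil => rfl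
  | cons g gs ih =>
    have h₀ : (List.range n).map u ++ [g.eval fun i => ((List.range n).map u).getD i false] =
        (List.range (n + 1)).map u := by
      rw [List.range_succ, List.map_append]
      have := hu 0 (by simp)
      simp only [Nat.add_zero, List.getElem_cons_zero] at this
      simp only [List.map_cons, List.map_nil, this]
      congr 2
      exact Gate.eval_congr (hb 0 (by simp)) fun i hi => by
        simp [List.getD_eq_getElem?_getD, List.getElem?_range (show i < n from hi)]
    rw [wireValues, List.foldl_cons, h₀, ← wireValues, ih (fun k h => ?_) fun k h => ?_]
    · simp [Nat.add_comm, Nat.add_left_comm]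
    · rw [Nat.add_right_comm]
      exact hb (k + 1) (by simpa using h)
    · rw [Nat.add_right_comm]
      exact hu (k + 1) (by simpa using h)

/-- Induction from the end of the list: no gate reads the wire of the last gate, so its value can be
set without disturbing the others. -/
theorem exists_wires (n : ℕ) (gs : List Gate)
    (hb : ∀ (k : ℕ) (h : k < gs.length), (gs[k]).Below (n + k)) (θ : ℕ → Bool) :
    ∃ u : ℕ → Bool, (∀ i < n, u i = θ i) ∧
      ∀ (k : ℕ) (h : k < gs.length), u (n + k) = (gs[k]).eval u := by
  induction gs using List.reverseRecOn with
  | nil => exact ⟨θ, by simp, by simp⟩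
  | append_singleton gs g ih =>
    have hb' : ∀ (k : ℕ) (h : k < gs.length), (gs[k]).Below (n + k) := fun k h =>
      List.getElem_append_left h ▸ hb k (by simp; omega)
    obtain ⟨u, hu, hu'⟩ := ih hb'
    refine ⟨Function.update u (n + gs.length) (g.eval u), fun i hi => ?_, fun k h => ?_⟩
    · rw [Function.update_of_ne (by omega), hu i hi]
    · have hw : ∀ i < n + gs.length, u i =
          Function.update u (n + gs.length) (g.eval u) i := fun i hi => by
        rw [Function.update_of_ne (by omega)]
      obtain h | h := Nat.lt_or_eq_of_le (Nat.le_of_lt_succ (by simpa using h) :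
        k ≤ gs.length)
      · rw [← hw _ (by omega), List.getElem_append_left h, hu' k h]
        exact Gate.eval_congr (hb' k h) fun i hi => hw i (by omega)
      · subst h
        have := hb gs.length (by simp)
        simp only [List.getElem_concat_length] at this ⊢
        rw [Function.update_self]
        exact Gate.eval_congr this hw

namespace BoolCircuit

variable {ψ : BoolCircuit} {θ u : ℕ → Bool}

theorem eval_eq (h : ∀ i < ψ.numVars, u i = θ i)
    (hu : ∀ (k : ℕ) (h : k < ψ.gates.length), u (ψ.numVars + k) = (ψ.gates[k]).eval u) :
    ψ.eval θ = u ψ.output := by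
  rw [eval, show (List.range ψ.numVars).map θ = (List.range ψ.numVars).map u from
    List.map_congr_left fun i hi => (h i (List.mem_range.1 hi)).symm,
    wireValues_eq ψ.gates_below hu]
  simp [List.getD_eq_getElem?_getD, List.getElem?_range ψ.output_lt]

end BoolCircuit

/-! ### Reading circuits -/

namespace CircuitSymbol

/-- Symbols that start the description of a gate. -/
def isGate : CircuitSymbol → Bool
  | notGate | andGate | orGate => true
  | _ => false

end CircuitSymbol

section

variable {I : Type} [DecidableEq I]

/-- The number of unary digits at the start of a word. -/
def unaryLength (l : List (I ⊕ CircuitSymbol)) : ℕ := l.runLength fun s => decide (s = .inr .one)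

/-- The number of such symbols before a position is the index of the gate that is described there.
-/
def isGateSymbol : I ⊕ CircuitSymbol → Bool
  | .inl _ => false
  | .inr s => s.isGate

/-- The wire `i` has a value as required by the gate with description `s :: l`, or the output wire
described by `s :: l` has the value `true`. -/
def SymbolHolds (u : ℕ → Bool) (i : ℕ) (s : I ⊕ CircuitSymbol) (l : List (I ⊕ CircuitSymbol)) :
    Prop :=
  (s = .inr .notGate → (u i = true ↔ ¬ u (unaryLength l) = true)) ∧
  (s = .inr .andGate → (u i = true ↔ u (unaryLength l) = true ∧
    u (unaryLength (l.drop (unaryLength l + 1))) = true)) ∧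
  (s = .inr .orGate → (u i = true ↔ u (unaryLength l) = true ∨
    u (unaryLength (l.drop (unaryLength l + 1))) = true)) ∧
  (s = .inr .output → u (unaryLength l) = true)

/-- The wires, numbered from `i`, have values as required by the gates in the word. -/
def WordHolds (u : ℕ → Bool) : ℕ → List (I ⊕ CircuitSymbol) → Prop
  | _, [] => True
  | i, s :: l => SymbolHolds u i s l ∧ WordHolds u (if isGateSymbol s then i + 1 else i) l

/-- The running wire number of the recursion becomes a count over a prefix, which makes the
condition definable position by position; the recursive form suits induction over the gates. -/
theorem wordHolds_iff {u : ℕ → Bool} {i : ℕ} {l : List (I ⊕ CircuitSymbol)} :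
    WordHolds u i l ↔ ∀ (p : ℕ) (h : p < l.length),
      SymbolHolds u (i + (l.take p).countP isGateSymbol) l[p] (l.drop (p + 1)) := by
  induction l generalizing i with
  | nil => simp [WordHolds]
  | cons s l ih =>
    have key : ∀ p, (if isGateSymbol s then i + 1 else i) + (l.take p).countP isGateSymbol =
        i + ((s :: l).take (p + 1)).countP isGateSymbol := fun p => by
      simp only [List.take_succ_cons, List.countP_cons]
      split <;> omega
    rw [WordHolds, ih]
    constructor
    · rintro ⟨h₀, h⟩ (_ | p) hp
      · exact h₀
      · have := h p (by simpa using hp)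
        rwa [key] at this
    · refine fun h => ⟨h 0 (by simp), fun p hp => ?_⟩
      rw [key]
      exact h (p + 1) (by simpa using hp)

theorem unaryLength_replicate {a : ℕ} {l : List (I ⊕ CircuitSymbol)}
    (h : l.head? ≠ some (.inr .one)) :
    unaryLength (List.replicate a (.inr .one) ++ l) = a := by
  induction a with
  | zero =>
    cases l with
    | nil => rfl
    | cons s l =>
      have : s ≠ .inr .one := by simpa using h
      simp [unaryLength, List.runLength, this]
  | succ a ih => simpa [unaryLength, List.runLength, List.replicate_succ]
      using ih

theorem wordHolds_replicate {u : ℕ → Bool} {i a : ℕ} {l : List (I ⊕ CircuitSymbol)} :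
    WordHolds u i (List.replicate a (.inr .one) ++ l) ↔ WordHolds u i l := by
  induction a with
  | zero => rfl
  | succ a ih => simpa [List.replicate_succ, WordHolds, SymbolHolds, isGateSymbol,
      CircuitSymbol.isGate] using ih

theorem wordHolds_inl {u : ℕ → Bool} {i : ℕ} {l : List I} :
    WordHolds u i (l.map (.inl : I → I ⊕ CircuitSymbol)) := by
  induction l with
  | nil => trivial
  | cons a l ih => simpa [WordHolds, SymbolHolds, isGateSymbol] using ih

/-- Digits and separators impose no condition, so only the leading symbol of a gate contributes. The
hypothesis on `l` prevents its last operand from running on into what follows. -/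
theorem wordHolds_gate {u : ℕ → Bool} {i : ℕ} {g : Gate} {l : List (I ⊕ CircuitSymbol)}
    (h : l.head? ≠ some (.inr .one)) :
    WordHolds u i (g.encode.map .inr ++ l) ↔ u i = g.eval u ∧ WordHolds u (i + 1) l := by
  have key : ∀ a b, unaryLength (List.drop (a + 1) (List.replicate a (.inr .one) ++
      .inr .sep :: (List.replicate b (.inr .one) ++ l))) = b := fun a b => by
    rw [show List.replicate a (Sum.inr CircuitSymbol.one : I ⊕ _) ++
      .inr .sep :: (List.replicate b (.inr .one) ++ l) = (List.replicate a (.inr .one) ++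
        [.inr .sep]) ++ (List.replicate b (.inr .one) ++ l) by simp,
      List.drop_left' (by simp), unaryLength_replicate h]
  have key' : ∀ a b, unaryLength (List.replicate a (.inr .one) ++
      .inr .sep :: (List.replicate b (.inr .one) ++ l)) = a := fun a b =>
    unaryLength_replicate (by simp)
  cases g with
  | not a =>
    simp [Gate.encode, WordHolds, SymbolHolds, isGateSymbol, CircuitSymbol.isGate, Gate.eval,
      wordHolds_replicate, unaryLength_replicate h]
  | and a b =>
    simp [Gate.encode, WordHolds, SymbolHolds, isGateSymbol, CircuitSymbol.isGate, Gate.eval,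
      wordHolds_replicate, key, key']
    intro _
    cases u i <;> cases u a <;> simp
  | or a b =>
    simp [Gate.encode, WordHolds, SymbolHolds, isGateSymbol, CircuitSymbol.isGate, Gate.eval,
      wordHolds_replicate, key, key']
    intro _
    cases u i <;> cases u a <;> simp

omit [DecidableEq I] in
theorem head?_flatMap_encode (gs : List Gate) (w : List CircuitSymbol)
    (l : List (I ⊕ CircuitSymbol)) :
    ((gs.flatMap Gate.encode ++ CircuitSymbol.output :: w).map Sum.inr ++ l).head? ≠ some (.inr .one) := by
  cases gs with
  | nil => simp
  | cons g gs => cases g <;> simp [Gate.encode]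

theorem wordHolds_gates {u : ℕ → Bool} {i o : ℕ} {gs : List Gate} {l : List I} :
    WordHolds u i ((gs.flatMap Gate.encode ++ CircuitSymbol.output :: List.replicate o .one).map .inr ++
      l.map .inl) ↔ (∀ (k : ℕ) (h : k < gs.length), u (i + k) = (gs[k]).eval u) ∧ u o = true := by
  induction gs generalizing i with
  | nil =>
    have : (l.map (Sum.inl : I → I ⊕ CircuitSymbol)).head? ≠ some (.inr .one) := by
      cases l <;> simp
    simp [WordHolds, SymbolHolds, unaryLength_replicate this, wordHolds_replicate, wordHolds_inl]
  | cons g gs ih =>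
    rw [List.flatMap_cons, List.append_assoc, List.map_append, List.append_assoc,
      wordHolds_gate (head?_flatMap_encode _ _ _), ih, ← and_assoc]
    refine and_congr_left fun _ => ⟨?_, fun h => ⟨h 0 (by simp), fun k hk => ?_⟩⟩
    · rintro ⟨h₀, h⟩ (_ | k) hk
      · exact h₀
      · rw [← Nat.add_assoc, Nat.add_right_comm]
        exact h k (by simpa using hk)
    · rw [Nat.add_right_comm]
      exact h (k + 1) (by simpa using hk)

/-- The word starts with a circuit, and the wires have values that are consistent with the gates
and with the variables, and for which the output is `true`. -/
def Accepts (W : List (I ⊕ CircuitSymbol)) (u : ℕ → Bool) : Prop :=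
  WordHolds u (unaryLength W) W

theorem unaryLength_encode (ψ : BoolCircuit) (l : List I) :
    unaryLength (ψ.encode.map .inr ++ l.map .inl) = ψ.numVars := by
  rw [BoolCircuit.encode, List.map_append, List.append_assoc, List.map_replicate,
    unaryLength_replicate (head?_flatMap_encode _ _ _)]

theorem accepts_iff {ψ : BoolCircuit} {l : List I} {u : ℕ → Bool} :
    Accepts (ψ.encode.map .inr ++ l.map .inl) u ↔
      (∀ (k : ℕ) (h : k < ψ.gates.length), u (ψ.numVars + k) = (ψ.gates[k]).eval u) ∧
        u ψ.output = true := by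
  rw [Accepts, unaryLength_encode, BoolCircuit.encode, List.map_append, List.append_assoc,
    List.map_replicate, wordHolds_replicate, wordHolds_gates]

/-- Satisfying assignments correspond to consistent values of the wires, and only the values of
the wires of the circuit matter. -/
theorem BoolCircuit.satisfiableUnder_iff {ψ : BoolCircuit} {Ω : Type} {x : Ω ↪ ℕ} {τ : Ω → Bool} :
    ψ.SatisfiableUnder x τ ↔ ∃ θ u : ℕ → Bool, (∀ ω, θ (x ω) = τ ω) ∧
      (∀ i < ψ.numVars, u i = θ i) ∧
      (∀ (k : ℕ) (h : k < ψ.gates.length), u (ψ.numVars + k) = (ψ.gates[k]).eval u) ∧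
        u ψ.output = true := by
  constructor
  · rintro ⟨θ, hθ, h⟩
    obtain ⟨u, hu, hu'⟩ := exists_wires _ _ ψ.gates_below θ
    exact ⟨θ, u, hθ, hu, hu', (eval_eq hu hu').symm.trans h⟩
  · rintro ⟨θ, u, hθ, hu, hu', h⟩
    exact ⟨θ, hθ, (eval_eq hu hu').trans h⟩

/-- Lets an infinite array of values be replaced by the finitely many bits of a certificate, and the
rest of the word be changed at the same time. -/
theorem Accepts.congr {ψ : BoolCircuit} {l l' : List I} {u v : ℕ → Bool}
    (h : Accepts (ψ.encode.map .inr ++ l.map .inl) u)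
    (huv : ∀ i < ψ.numVars + ψ.gates.length, u i = v i) :
    Accepts (ψ.encode.map .inr ++ l'.map .inl) v := by
  rw [accepts_iff] at h ⊢
  refine ⟨fun k hk => ?_, (huv _ ψ.output_lt).symm.trans h.2⟩
  rw [← huv _ (by omega), h.1 k hk]
  exact Gate.eval_congr (ψ.gates_below k hk) fun i hi => huv i (by omega)

theorem BoolCircuit.numVars_add_le (ψ : BoolCircuit) :
    ψ.numVars + ψ.gates.length ≤ ψ.encode.length := by
  have : ∀ gs : List Gate, gs.length ≤ (gs.flatMap Gate.encode).length := fun gs => by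
    induction gs with
    | nil => simp
    | cons g gs ih =>
      have : 0 < g.encode.length := by cases g <;> simp [Gate.encode]
      simp only [List.length_cons, List.flatMap_cons, List.length_append]
      omega
  have := this ψ.gates
  simp only [encode, List.length_append, List.length_replicate]
  omega

theorem Definable.unaryLength [Fintype I] {α : Type} {word : α → List (I ⊕ CircuitSymbol)}
    {vars : List (α → ℕ)} {f : α → ℕ} (hf : Definable word vars f) :
    Definable word vars fun c => _root_.unaryLength ((word c).drop (f c)) :=
  hf.runLength _

theorem DefinablePred.accepts [Fintype I] {u : List (I ⊕ CircuitSymbol) → ℕ → Bool}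
    (hu : DefinablePred Prod.fst [Prod.snd] fun p => u p.1 p.2 = true) :
    DefinablePred id [] fun W => Accepts W (u W) := by
  let i (W : List (I ⊕ CircuitSymbol)) (p : ℕ) : ℕ :=
    -- The trivial `drop 0` matches the shape of `Definable.unaryLength`.
    _root_.unaryLength (W.drop 0) + (W.take p).countP isGateSymbol
  let a (W : List (I ⊕ CircuitSymbol)) (p : ℕ) : ℕ := _root_.unaryLength (W.drop (p + 1))
  let b (W : List (I ⊕ CircuitSymbol)) (p : ℕ) : ℕ :=
    _root_.unaryLength (W.drop (p + 1 + (a W p + 1)))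
  have hp : Definable (fun q : List (I ⊕ CircuitSymbol) × ℕ => q.1) [Prod.snd] Prod.snd :=
    .var (.head _)
  have hi := hu.subst₁ (P := fun W i => u W i = true)
    ((Definable.const 0).unaryLength.add (.countP_take isGateSymbol hp))
  have ha := (hp.add .one).unaryLength
  have hb := hu.subst₁ (P := fun W i => u W i = true) ((hp.add .one).add (ha.add .one)).unaryLength
  have ha := hu.subst₁ (P := fun W i => u W i = true) ha
  refine (forall_lt (f := fun W => W.length) (P := fun W p =>
    (W[p]? = some (.inr .notGate) → (u W (i W p) = true ↔ ¬ u W (a W p) = true)) ∧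
    (W[p]? = some (.inr .andGate) → (u W (i W p) = true ↔
      u W (a W p) = true ∧ u W (b W p) = true)) ∧
    (W[p]? = some (.inr .orGate) → (u W (i W p) = true ↔
      u W (a W p) = true ∨ u W (b W p) = true)) ∧
    (W[p]? = some (.inr .output) → u W (a W p) = true)) .length
    (.and (.imp (.test _ hp) (.iff hi ha.not)) (.and (.imp (.test _ hp) (.iff hi (ha.and hb)))
      (.and (.imp (.test _ hp) (.iff hi (ha.or hb))) (.imp (.test _ hp) ha))))).of_iff fun W => ?_
  rw [Accepts, wordHolds_iff]
  refine forall₂_congr fun p hp => ?_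
  simp [SymbolHolds, i, a, b, List.getElem?_eq_getElem hp, List.drop_drop]

end

/-! ### Orbits of matrices -/

section

variable {n m : ℕ}

theorem mem_assignmentOrbit_iff {M M' : Fin n × Fin m → Bool} :
    M' ∈ assignmentOrbit (rowColumnGroup n m) M ↔
      ∃ (σ : Equiv.Perm (Fin n)) (π : Equiv.Perm (Fin m)), ∀ i q, M' (σ i, π q) = M (i, q) := by
  constructor
  · rintro ⟨_, ⟨σ, π, rfl⟩, rfl⟩
    refine ⟨σ, π, fun i q => congrArg M ?_⟩
    exact (Equiv.prodCongr σ π).symm_apply_apply (i, q)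
  · rintro ⟨σ, π, h⟩
    refine ⟨_, ⟨σ, π, rfl⟩, funext fun ω => ?_⟩
    obtain ⟨⟨i, q⟩, rfl⟩ := (Equiv.prodCongr σ π).surjective ω
    refine (h i q).trans (congrArg M ?_)
    exact ((Equiv.prodCongr σ π).symm_apply_apply (i, q)).symm

theorem assignmentOrbit_symm {M M' : Fin n × Fin m → Bool}
    (h : M' ∈ assignmentOrbit (rowColumnGroup n m) M) :
    M ∈ assignmentOrbit (rowColumnGroup n m) M' := by
  rw [mem_assignmentOrbit_iff] at h ⊢
  obtain ⟨σ, π, h⟩ := h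
  exact ⟨σ.symm, π.symm, fun i q => by simp [← h]⟩

theorem assignmentOrbit_trans {M M' M'' : Fin n × Fin m → Bool}
    (h : M' ∈ assignmentOrbit (rowColumnGroup n m) M)
    (h' : M'' ∈ assignmentOrbit (rowColumnGroup n m) M') :
    M'' ∈ assignmentOrbit (rowColumnGroup n m) M := by
  rw [mem_assignmentOrbit_iff] at h h' ⊢
  obtain ⟨σ, π, h⟩ := h
  obtain ⟨σ', π', h'⟩ := h'
  exact ⟨σ.trans σ', π.trans π', fun i q => by simp [← h, ← h']⟩

end

/-! ### Graphs as matrices -/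

namespace SimpleGraph

variable {n m : ℕ}

open Classical in
/-- The matrix with a column for each pair of vertices; the columns of adjacent pairs are incidence
vectors and the other columns are zero. -/
noncomputable def incidence (G : SimpleGraph (Fin n)) : Fin n × Fin (n * n) → Bool := fun ω =>
  decide (G.Adj (finProdFinEquiv.symm ω.2).1 (finProdFinEquiv.symm ω.2).2 ∧
    (ω.1 = (finProdFinEquiv.symm ω.2).1 ∨ ω.1 = (finProdFinEquiv.symm ω.2).2))

theorem incidence_eq_true {G : SimpleGraph (Fin n)} {i a b : Fin n} :
    G.incidence (i, finProdFinEquiv (a, b)) = true ↔ G.Adj a b ∧ (i = a ∨ i = b) := by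
  simp [incidence, -finProdFinEquiv_apply_val]

/-- The graph in which distinct rows with a common `true` are adjacent. -/
def ofMatrix (M : Fin n × Fin m → Bool) : SimpleGraph (Fin n) where
  Adj a b := a ≠ b ∧ ∃ q, M (a, q) = true ∧ M (b, q) = true
  symm := ⟨fun _ _ h => ⟨h.1.symm, h.2.imp fun _ h => h.symm⟩⟩
  loopless := ⟨fun _ h => h.1 rfl⟩

/-- Two distinct rows can share a `true` only in the column of an adjacent pair that consists of
exactly these two vertices. -/
theorem ofMatrix_incidence (G : SimpleGraph (Fin n)) : ofMatrix G.incidence = G := by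
  ext a b
  constructor
  · rintro ⟨hab, q, h, h'⟩
    obtain ⟨⟨c, d⟩, rfl⟩ := finProdFinEquiv.surjective q
    rw [incidence_eq_true] at h h'
    obtain ⟨h, rfl | rfl⟩ := h <;> obtain ⟨-, rfl | rfl⟩ := h'
    exacts [absurd rfl hab, h, h.symm, absurd rfl hab]
  · exact fun h => ⟨h.ne, finProdFinEquiv (a, b), by simp [incidence_eq_true, h],
      by simp [incidence_eq_true, h]⟩

/-- The existence of a common `true` is insensitive to the order of the columns, so the row
permutation is an isomorphism. -/
theorem nonempty_iso_ofMatrix {M M' : Fin n × Fin m → Bool}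
    (h : M' ∈ assignmentOrbit (rowColumnGroup n m) M) :
    Nonempty (ofMatrix M ≃g ofMatrix M') := by
  obtain ⟨σ, π, h⟩ := mem_assignmentOrbit_iff.1 h
  refine ⟨⟨σ, fun {a b} => ?_⟩⟩
  simp only [ofMatrix, ne_eq, EmbeddingLike.apply_eq_iff_eq, ← h]
  refine and_congr_right fun _ => ⟨?_, fun ⟨q, hq⟩ => ⟨π q, hq⟩⟩
  rintro ⟨q, hq⟩
  obtain ⟨q, rfl⟩ := π.surjective q
  exact ⟨q, hq⟩

/-- The columns are indexed by all ordered pairs, so a vertex permutation acts on them whatever the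
edges are. -/
theorem Iso.incidence_mem_orbit {G H : SimpleGraph (Fin n)} (e : G ≃g H) :
    H.incidence ∈ assignmentOrbit (rowColumnGroup n (n * n)) G.incidence := by
  rw [mem_assignmentOrbit_iff]
  let σ := e.toEquiv
  refine ⟨σ, finProdFinEquiv.symm.trans ((Equiv.prodCongr σ σ).trans finProdFinEquiv),
    fun i q => ?_⟩
  obtain ⟨⟨a, b⟩, rfl⟩ := finProdFinEquiv.surjective q
  simp only [Equiv.trans_apply, Equiv.symm_apply_apply, Equiv.prodCongr_apply, Prod.map_apply]
  rw [Bool.eq_iff_iff, incidence_eq_true, incidence_eq_true]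
  exact and_congr e.map_adj_iff (by simp)

/-- `M` is the representative, selected by the circuit, of the matrices that describe graphs
isomorphic to `G`. -/
def Represents (ψ : BoolCircuit) (G : SimpleGraph (Fin n)) (M : Fin n × Fin (n * n) → Bool) :
    Prop :=
  M ∈ assignmentOrbit (rowColumnGroup n (n * n)) G.incidence ∧
    ψ.SatisfiableUnder (matrixVar n (n * n)) M

variable {ψ : BoolCircuit} {G H : SimpleGraph (Fin n)} {M M' : Fin n × Fin (n * n) → Bool}

theorem exists_represents
    (hψ : IsCompleteSymmetryBreaking (rowColumnGroup n (n * n)) (matrixVar n (n * n)) ψ)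
    (G : SimpleGraph (Fin n)) : ∃ M, Represents ψ G M :=
  let ⟨M, hM, h, _⟩ := hψ G.incidence
  ⟨M, hM, h⟩

theorem Represents.unique (h : Represents ψ G M) (h' : Represents ψ G M')
    (hψ : IsCompleteSymmetryBreaking (rowColumnGroup n (n * n)) (matrixVar n (n * n)) ψ) :
    M = M' := by
  obtain ⟨N, -, -, hN⟩ := hψ G.incidence
  have : ∀ M, Represents ψ G M → N = M := fun M h => by_contra fun hne => hN M h.1 hne h.2
  rw [← this M h, ← this M' h']

theorem Represents.of_iso (h : Represents ψ G M) (e : G ≃g H) : Represents ψ H M :=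
  ⟨assignmentOrbit_trans (assignmentOrbit_symm e.incidence_mem_orbit) h.1, h.2⟩

theorem Represents.iso_ofMatrix (h : Represents ψ G M) : Nonempty (ofMatrix M ≃g G) := by
  have := nonempty_iso_ofMatrix (assignmentOrbit_symm h.1)
  rwa [ofMatrix_incidence] at this

theorem Represents.nonempty_iso_iff (h : Represents ψ G M) (h' : Represents ψ H M')
    (hψ : IsCompleteSymmetryBreaking (rowColumnGroup n (n * n)) (matrixVar n (n * n)) ψ) :
    Nonempty (G ≃g H) ↔ M = M' := by
  constructor
  · rintro ⟨e⟩
    exact (h.of_iso e).unique h' hψ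
  · rintro rfl
    obtain ⟨e⟩ := h.iso_ofMatrix
    obtain ⟨e'⟩ := h'.iso_ofMatrix
    exact ⟨e.symm.trans e'⟩

end SimpleGraph

/-! ### The canonical form -/

namespace FinGraph

open Classical SimpleGraph

/-- The canonical form of a graph, selected by the circuit `C n` for graphs with `n` vertices. -/
noncomputable def canonize (C : ℕ → BoolCircuit) (Γ : FinGraph) : FinGraph :=
  ⟨Γ.1, if h : ∃ M, Represents (C Γ.1) Γ.2 M then ofMatrix h.choose else Γ.2⟩

theorem isomorphic_iff {n : ℕ} {G H : SimpleGraph (Fin n)} :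
    Isomorphic ⟨n, G⟩ ⟨n, H⟩ ↔ Nonempty (G ≃g H) := Iff.rfl

theorem Isomorphic.order_eq {Γ Δ : FinGraph} (h : Γ.Isomorphic Δ) : Γ.1 = Δ.1 := by
  obtain ⟨e⟩ := h
  simpa using Fintype.card_congr e.toEquiv

variable {C : ℕ → BoolCircuit}

theorem canonize_eq {n : ℕ} {G : SimpleGraph (Fin n)} {M : Fin n × Fin (n * n) → Bool}
    (h : Represents (C n) G M)
    (hC : IsCompleteSymmetryBreaking (rowColumnGroup n (n * n)) (matrixVar n (n * n)) (C n)) :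
    canonize C ⟨n, G⟩ = ⟨n, ofMatrix M⟩ := by
  have h' : ∃ M, Represents (C n) G M := ⟨M, h⟩
  rw [canonize, dif_pos h', h'.choose_spec.unique h hC]

theorem canonize_isomorphic (Γ : FinGraph) : (canonize C Γ).Isomorphic Γ := by
  unfold canonize
  split
  case isTrue h => exact h.choose_spec.iso_ofMatrix
  case isFalse => exact ⟨Iso.refl⟩

theorem Isomorphic.canonize_eq {Γ Δ : FinGraph} (h : Γ.Isomorphic Δ)
    (hC : ∀ n, 0 < n →
      IsCompleteSymmetryBreaking (rowColumnGroup n (n * n)) (matrixVar n (n * n)) (C n)) :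
    canonize C Γ = canonize C Δ := by
  obtain ⟨n, G⟩ := Γ
  obtain ⟨n', H⟩ := Δ
  obtain rfl : n = n' := h.order_eq
  obtain rfl | hn := Nat.eq_zero_or_pos n
  · rw [Subsingleton.elim G H]
  · obtain ⟨M, hM⟩ := exists_represents (hC n hn) G
    obtain ⟨e⟩ := h
    rw [FinGraph.canonize_eq hM (hC n hn), FinGraph.canonize_eq (hM.of_iso e) (hC n hn)]

theorem isCanonicalForm_canonize (hC : ∀ n, 0 < n →
    IsCompleteSymmetryBreaking (rowColumnGroup n (n * n)) (matrixVar n (n * n)) (C n)) :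
    IsCanonicalForm (canonize C) where
  iso_iff Γ Δ := by
    refine ⟨fun h => h.canonize_eq hC, fun h => ?_⟩
    obtain ⟨e⟩ := canonize_isomorphic (C := C) Γ
    obtain ⟨e'⟩ := canonize_isomorphic (C := C) Δ
    rw [h] at e
    exact ⟨e.symm.trans e'⟩
  iso_self := canonize_isomorphic

/-- The order zero is separate, as circuits are guaranteed only for positive dimensions; there is
just one graph of that order. -/
theorem eq_canonize_iff {n : ℕ} {G : SimpleGraph (Fin n)} (hC : 0 < n →
    IsCompleteSymmetryBreaking (rowColumnGroup n (n * n)) (matrixVar n (n * n)) (C n)) :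
    (⟨n, G⟩ : FinGraph) = canonize C ⟨n, G⟩ ↔
      n = 0 ∨ ∃ M, Represents (C n) G M ∧ G = ofMatrix M := by
  obtain rfl | hn := Nat.eq_zero_or_pos n
  · simp only [true_or, iff_true]
    unfold canonize
    congr
    exact Subsingleton.elim _ _
  · obtain ⟨M, hM⟩ := exists_represents (hC hn) G
    rw [canonize_eq hM (hC hn)]
    simp only [Sigma.mk.injEq, heq_eq_eq, true_and, hn.ne', false_or]
    refine ⟨fun h => ⟨M, hM, h⟩, ?_⟩
    rintro ⟨M', hM', h⟩
    rwa [hM.unique hM' (hC hn)]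

theorem not_isomorphic_iff {n : ℕ} {G H : SimpleGraph (Fin n)} (hC : 0 < n →
    IsCompleteSymmetryBreaking (rowColumnGroup n (n * n)) (matrixVar n (n * n)) (C n)) :
    ¬ Isomorphic ⟨n, G⟩ ⟨n, H⟩ ↔ 0 < n ∧
      ∃ M M', Represents (C n) G M ∧ Represents (C n) H M' ∧ M ≠ M' := by
  obtain rfl | hn := Nat.eq_zero_or_pos n
  · simp only [lt_irrefl, false_and, iff_false, not_not]
    rw [Subsingleton.elim G H]
    exact ⟨Iso.refl⟩
  · obtain ⟨M, hM⟩ := exists_represents (hC hn) G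
    obtain ⟨M', hM'⟩ := exists_represents (hC hn) H
    rw [isomorphic_iff, hM.nonempty_iso_iff hM' (hC hn)]
    refine ⟨fun h => ⟨hn, M, M', hM, hM', h⟩, ?_⟩
    rintro ⟨-, N, N', h, h', hne⟩
    rwa [hM.unique h (hC hn), hM'.unique h' (hC hn)]

end FinGraph

/-! ### Certificates -/

/-- The pairs `(p, q)` for which `P (q + k * p)` holds include the graph of a permutation. -/
def CodesPerm (k : ℕ) (P : ℕ → Bool) : Prop :=
  (∀ p < k, ∃ q < k, P (q + k * p) = true) ∧
    ∀ p < k, ∀ p' < k, ∀ q < k, P (q + k * p) = true → P (q + k * p') = true → p = p'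

theorem add_mul_lt {a b k l : ℕ} (ha : a < k) (hb : b < l) : a + k * b < k * l :=
  calc a + k * b < k + k * b := by omega
    _ = k * (b + 1) := by ring
    _ ≤ k * l := Nat.mul_le_mul_left k hb

theorem CodesPerm.congr {k B : ℕ} {P P' : ℕ → Bool} (h : CodesPerm k P) (hB : k * k ≤ B)
    (hP : ∀ i < B, P i = P' i) : CodesPerm k P' := by
  have hP' : ∀ p < k, ∀ q < k, P (q + k * p) = P' (q + k * p) := fun p hp q hq =>
    hP _ ((add_mul_lt hq hp).trans_le hB)
  refine ⟨fun p hp => ?_, fun p hp p' hp' q hq => ?_⟩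
  · obtain ⟨q, hq, h⟩ := h.1 p hp
    exact ⟨q, hq, hP' p hp q hq ▸ h⟩
  · rw [← hP' p hp q hq, ← hP' p' hp' q hq]
    exact h.2 p hp p' hp' q hq

/-- Any choice of values gives an injective map on a finite set, hence a bijection; the coded
relation need not be single-valued. -/
theorem CodesPerm.exists_perm {k : ℕ} {P : ℕ → Bool} (h : CodesPerm k P) :
    ∃ π : Equiv.Perm (Fin k), ∀ p : Fin k, P (π p + k * p) = true := by
  choose f hf hf' using h.1
  let g (p : Fin k) : Fin k := ⟨f p p.2, hf p p.2⟩
  have hg : g.Injective := fun p p' hpp => Fin.ext (h.2 p p.2 p' p'.2 (g p) (g p).2 (hf' p p.2)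
    (by rw [hpp]; exact hf' p' p'.2))
  exact ⟨.ofBijective g (Finite.injective_iff_bijective.1 hg), fun p => hf' p p.2⟩

theorem exists_codesPerm {k : ℕ} (π : Equiv.Perm (Fin k)) :
    ∃ P, CodesPerm k P ∧ ∀ p q : Fin k, P (q + k * p) = true ↔ π p = q := by
  classical
  let P (i : ℕ) : Bool := decide (∃ p : Fin k, i = π p + k * p)
  have hP : ∀ p q : Fin k, P (q + k * p) = true ↔ π p = q := fun p q => by
    simp only [P, decide_eq_true_eq]
    refine ⟨?_, fun h => ⟨p, h ▸ rfl⟩⟩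
    rintro ⟨p', h⟩
    have := finProdFinEquiv.injective (a₁ := (p, q)) (a₂ := (p', π p'))
      (Fin.ext (by simpa using h))
    simp only [Prod.mk.injEq] at this
    rw [this.1, this.2]
  refine ⟨P, ⟨fun p hp => ⟨π ⟨p, hp⟩, (π _).2, (hP ⟨p, hp⟩ _).2 rfl⟩,
    fun p hp p' hp' q hq h h' => ?_⟩, hP⟩
  have h₁ := (hP ⟨p, hp⟩ ⟨q, hq⟩).1 h
  have h₂ := (hP ⟨p', hp'⟩ ⟨q, hq⟩).1 h'
  exact congrArg Fin.val (π.injective (h₁.trans h₂.symm))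

section

variable {I : Type} [DecidableEq I]

/-- `θ` contains a matrix of a graph isomorphic to the graph `adj` on `n` vertices, as witnessed
by row and column permutations coded by `Q` and `P`, and extends to consistent and accepting
values `u` of the wires of the circuit at the start of the word. -/
def Certifies (W : List (I ⊕ CircuitSymbol)) (n : ℕ) (adj : ℕ → ℕ → Prop) (θ u P Q : ℕ → Bool) :
    Prop :=
  (∀ i < unaryLength W, u i = true ↔ θ i = true) ∧ Accepts W u ∧ CodesPerm n Q ∧
    CodesPerm (n * n) P ∧ ∀ i < n, ∀ i' < n, Q (i' + n * i) = true →
      ∀ a < n, ∀ b < n, ∀ q < n * n, P (q + n * n * (b + n * a)) = true →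
        (θ (q + n * n * i') = true ↔ adj a b ∧ (i = a ∨ i = b))

variable {ψ : BoolCircuit} {l : List I} {n : ℕ} {adj : ℕ → ℕ → Prop} {θ u P Q : ℕ → Bool}
  {G : SimpleGraph (Fin n)} {M : Fin n × Fin (n * n) → Bool}

theorem matrixVar_apply {n m : ℕ} (i : Fin n) (q : Fin m) :
    matrixVar n m (i, q) = q + m * i := rfl

/-- Truncation to `B` bits. The length of the circuit bounds the number of its wires, and `n⁴` bits
accommodate the permutation of the `n²` columns and therefore also the row permutation and the
matrix. -/
theorem Certifies.congr (h : Certifies (ψ.encode.map .inr ++ l.map .inl) n adj θ u P Q)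
    {l' : List I} {adj' : ℕ → ℕ → Prop} {θ' u' P' Q' : ℕ → Bool} {B : ℕ} (hψ : ψ.encode.length ≤ B)
    (hn : n * n * (n * n) ≤ B) (hθ : ∀ i < B, θ i = θ' i) (hu : ∀ i < B, u i = u' i) (hP : ∀ i < B, P i = P' i)
    (hQ : ∀ i < B, Q i = Q' i) (hadj : ∀ a < n, ∀ b < n, adj a b ↔ adj' a b) :
    Certifies (ψ.encode.map .inr ++ l'.map .inl) n adj' θ' u' P' Q' := by
  obtain ⟨h₁, h₂, h₃, h₄, h₅⟩ := h
  have hb := ψ.numVars_add_le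
  have hn' : n * n ≤ n * n * (n * n) := Nat.le_mul_self _
  refine ⟨fun i hi => ?_, h₂.congr fun i hi => hu i (by omega), h₃.congr (hn'.trans hn) hQ,
    h₄.congr hn hP, fun i hi i' hi' hQi a ha b hb q hq hPq => ?_⟩
  · rw [unaryLength_encode] at hi
    rw [unaryLength_encode] at h₁
    have := h₁ i hi
    rwa [hθ i (by omega), hu i (by omega)] at this
  · rw [← hQ _ ((add_mul_lt hi' hi).trans_le (hn'.trans hn))] at hQi
    rw [← hP _ ((add_mul_lt hq (add_mul_lt hb ha)).trans_le hn)] at hPq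
    rw [← hθ _ ((add_mul_lt hq (hi'.trans_le (Nat.le_mul_self n))).trans_le hn), ← hadj a ha b hb]
    exact h₅ i hi i' hi' hQi a ha b hb q hq hPq

/-- Soundness of certificates. The arrays `θ` and `u` are separate because the circuit may have
fewer variables than the matrix has entries: beyond `numVars`, `u` holds values of gates and `θ`
still holds the matrix. -/
theorem Certifies.represents (h : Certifies (ψ.encode.map .inr ++ l.map .inl) n adj θ u P Q)
    (hG : ∀ a b : Fin n, adj a b ↔ G.Adj a b) :
    G.Represents ψ fun ω => θ (matrixVar n (n * n) ω) := by
  obtain ⟨h₁, h₂, h₃, h₄, h₅⟩ := h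
  rw [unaryLength_encode] at h₁
  rw [accepts_iff] at h₂
  refine ⟨mem_assignmentOrbit_iff.2 ?_, BoolCircuit.satisfiableUnder_iff.2
    ⟨θ, u, fun _ => rfl, fun i hi => Bool.eq_iff_iff.2 (h₁ i hi), h₂⟩⟩
  obtain ⟨σ, hσ⟩ := h₃.exists_perm
  obtain ⟨π, hπ⟩ := h₄.exists_perm
  refine ⟨σ, π, fun i q => ?_⟩
  obtain ⟨⟨a, b⟩, rfl⟩ := finProdFinEquiv.surjective q
  rw [Bool.eq_iff_iff, SimpleGraph.incidence_eq_true, matrixVar_apply]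
  refine (h₅ i i.2 (σ i) (σ i).2 (hσ i) a a.2 b b.2 _ (π _).2 (hπ _)).trans ?_
  simp [hG, Fin.ext_iff]

/-- Adjacency of vertices that are given as natural numbers. -/
def SimpleGraph.AdjVal (G : SimpleGraph (Fin n)) (a b : ℕ) : Prop :=
  ∃ (ha : a < n) (hb : b < n), G.Adj ⟨a, ha⟩ ⟨b, hb⟩

theorem SimpleGraph.adjVal_iff (a b : Fin n) : G.AdjVal a b ↔ G.Adj a b := by
  simp [AdjVal]

theorem SimpleGraph.Represents.exists_certifies (h : G.Represents ψ M) (l : List I) :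
    ∃ θ u P Q, Certifies (ψ.encode.map .inr ++ l.map .inl) n G.AdjVal θ u P Q ∧
      ∀ ω, θ (matrixVar n (n * n) ω) = M ω := by
  obtain ⟨hM, hψ⟩ := h
  obtain ⟨σ, π, h⟩ := mem_assignmentOrbit_iff.1 hM
  obtain ⟨θ, u, hθ, hu, hu'⟩ := BoolCircuit.satisfiableUnder_iff.1 hψ
  obtain ⟨Q, hQ, hQσ⟩ := exists_codesPerm σ
  obtain ⟨P, hP, hPπ⟩ := exists_codesPerm π
  refine ⟨θ, u, P, Q, ⟨fun i hi => ?_, accepts_iff.2 hu', hQ, hP,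
    fun i hi i' hi' hQi a ha b hb q hq hPq => ?_⟩, hθ⟩
  · rw [unaryLength_encode] at hi
    rw [hu i hi]
  -- Here the codes are exactly the graphs of `σ` and `π`, so each coded pair is a value of the
  -- permutation.
  · have h₁ := (hQσ ⟨i, hi⟩ ⟨i', hi'⟩).1 hQi
    have h₂ := (hPπ (finProdFinEquiv (⟨a, ha⟩, ⟨b, hb⟩)) ⟨q, hq⟩).1 hPq
    have h₃ := h ⟨i, hi⟩ (finProdFinEquiv (⟨a, ha⟩, ⟨b, hb⟩))
    rw [h₁, h₂, ← hθ, Bool.eq_iff_iff, SimpleGraph.incidence_eq_true, ← adjVal_iff] at h₃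
    simpa [matrixVar_apply] using h₃

theorem DefinablePred.codesPerm {A : Type} [DecidableEq A] {k : List A → ℕ}
    {P : List A → ℕ → Bool} (hk : Definable id [] k)
    (hP : DefinablePred Prod.fst [Prod.snd] fun p => P p.1 p.2 = true) :
    DefinablePred id [] fun W => CodesPerm (k W) (P W) := by
  have hP' {α : Type} {word : α → List A} {vars : List (α → ℕ)} {f : α → ℕ}
      (hf : Definable word vars f) : DefinablePred word vars fun c => P (word c) (f c) = true :=
    hP.subst₁ (P := fun W i => P W i = true) hf
  refine .and (.forall_lt hk (.exists_lt hk.closed (hP' (.add (.var (by simp))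
      (.mul hk.closed (.var (by simp)))))))
    (.forall_lt hk (.forall_lt hk.closed (.forall_lt hk.closed (.imp
      (hP' (.add (.var (by simp)) (.mul hk.closed (.var (by simp))))) (.imp
      (hP' (.add (.var (by simp)) (.mul hk.closed (.var (by simp)))))
      (.eq (.var (by simp)) (.var (by simp))))))))

end

theorem DefinablePred.certifies {I : Type} [Fintype I] [DecidableEq I]
    {n : List (I ⊕ CircuitSymbol) → ℕ} {adj : List (I ⊕ CircuitSymbol) → ℕ → ℕ → Prop}
    {θ u P Q : List (I ⊕ CircuitSymbol) → ℕ → Bool} (hn : Definable id [] n)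
    (hadj : DefinablePred (fun p : List (I ⊕ CircuitSymbol) × ℕ × ℕ => p.1)
      [fun p => p.2.1, fun p => p.2.2] fun p => adj p.1 p.2.1 p.2.2)
    (hθ : DefinablePred Prod.fst [Prod.snd] fun p => θ p.1 p.2 = true)
    (hu : DefinablePred Prod.fst [Prod.snd] fun p => u p.1 p.2 = true)
    (hP : DefinablePred Prod.fst [Prod.snd] fun p => P p.1 p.2 = true)
    (hQ : DefinablePred Prod.fst [Prod.snd] fun p => Q p.1 p.2 = true) :
    DefinablePred id [] fun W => Certifies W (n W) (adj W) (θ W) (u W) (P W) (Q W) := by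
  have hnn := hn.mul hn
  refine .and ?_ (.and (.accepts hu) (.and (.codesPerm hn hQ) (.and (.codesPerm hnn hP) ?_)))
  · exact .forall_lt (Definable.const 0).unaryLength (.iff
      (.subst₁ (P := fun W i => u W i = true) hu (.var (by simp)))
      (.subst₁ (P := fun W i => θ W i = true) hθ (.var (by simp))))
  · refine .forall_lt hn (.forall_lt hn.closed (.imp (.subst₁ (P := fun W i => Q W i = true) hQ
      (.add (.var (by simp)) (.mul hn.closed (.var (by simp))))) (.forall_lt hn.closed
      (.forall_lt hn.closed (.forall_lt (hn.closed.mul hn.closed) (.imp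
      (.subst₁ (P := fun W i => P W i = true) hP (.add (.var (by simp))
        (.mul (hn.closed.mul hn.closed) (.add (.var (by simp))
          (.mul hn.closed (.var (by simp)))))))
      (.iff (.subst₁ (P := fun W i => θ W i = true) hθ (.add (.var (by simp))
        (.mul (hn.closed.mul hn.closed) (.var (by simp)))))
      (.and (.subst₂ (P := adj) hadj (.var (by simp)) (.var (by simp)))
        (.or (.eq (.var (by simp)) (.var (by simp)))
          (.eq (.var (by simp)) (.var (by simp))))))))))))

/-! ### Reading certificates -/

section

variable {J : Type} [DecidableEq J]

/-- The symbol is not part of the certificate. -/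
def notCertificate : (J ⊕ Bool) ⊕ CircuitSymbol → Bool
  | .inl (.inr _) => false
  | _ => true

/-- The bit with index `i` of the array `r`, where certificates contain eight arrays, with the bits
of the same index next to each other. -/
def certificateBit (r : ℕ) (W : List ((J ⊕ Bool) ⊕ CircuitSymbol)) (i : ℕ) : Bool :=
  decide (W[W.countP notCertificate + (8 * i + r)]? = some (.inl (.inr true)))

theorem DefinablePred.certificateBit [Fintype J] (r : ℕ) :
    DefinablePred (Prod.fst : List ((J ⊕ Bool) ⊕ CircuitSymbol) × ℕ → _) [Prod.snd]
      fun p => certificateBit r p.1 p.2 = true :=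
  (test (.inl (.inr true)) (.add (.countP notCertificate) (.add (.mul (.const 8)
    (.var (.head _))) (.const r)))).of_iff fun _ => by simp [_root_.certificateBit]

/-- The certificate with the first `B` bits of eight arrays. -/
def interleave (B : ℕ) (X : ℕ → ℕ → Bool) : List Bool :=
  (List.range (8 * B)).map fun k => X (k % 8) (k / 8)

theorem certificateBit_interleave {C : List CircuitSymbol} {x : List J} {B r i : ℕ}
    {X : ℕ → ℕ → Bool} (hr : r < 8) (hi : i < B) :
    certificateBit r (C.map .inr ++ (x.map Sum.inl ++ (interleave B X).map Sum.inr).map .inl) i =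
      X r i := by
  have h : (C.map .inr ++ (x.map Sum.inl ++ (interleave B X).map Sum.inr).map .inl :
      List ((J ⊕ Bool) ⊕ CircuitSymbol)).countP notCertificate = C.length + x.length := by
    have h₁ : notCertificate ∘ (Sum.inr : _ → (J ⊕ Bool) ⊕ CircuitSymbol) = fun _ => true := rfl
    have h₂ : notCertificate ∘ Sum.inl ∘ (Sum.inl : J → J ⊕ Bool) = fun _ => true := rfl
    have h₃ : notCertificate ∘ Sum.inl ∘ (Sum.inr : _ → J ⊕ Bool) = fun _ => false := rfl
    simp [List.countP_map, h₁, h₂, h₃]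
  rw [certificateBit, h, List.getElem?_append_right (by simp; omega), List.length_map,
    Nat.add_assoc, Nat.add_sub_cancel_left, List.map_append,
    List.getElem?_append_right (by simp), List.length_map, List.length_map,
    Nat.add_sub_cancel_left, List.getElem?_map, List.getElem?_map, interleave, List.getElem?_map,
    List.getElem?_range (by omega)]
  simp [Nat.mul_add_div, Nat.mod_eq_of_lt hr, Nat.div_eq_of_lt hr]

end

/-! ### Reading graphs -/

theorem FinGraph.getElem?_encode (Γ : FinGraph) (a b : Fin Γ.1) [Decidable (Γ.2.Adj a b)] :
    Γ.encode[Γ.1 + 1 + (b + Γ.1 * a)]? = some (decide (Γ.2.Adj a b)) := by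
  classical
  obtain ⟨n, G⟩ := Γ
  have h := List.ofFn_mul' fun k : Fin (n * n) =>
    decide (G.Adj (finProdFinEquiv.symm k).1 (finProdFinEquiv.symm k).2)
  have h' : ∀ (i j : Fin n) (h : n * i + j < n * n),
      finProdFinEquiv.symm ⟨n * i + j, h⟩ = (i, j) := fun i j h => by
    rw [Equiv.symm_apply_eq]
    exact Fin.ext (Nat.add_comm _ _)
  simp only [h'] at h
  simp only [encode]
  rw [List.append_cons, List.getElem?_append_right (by simp), ← h]
  have hk : (b : ℕ) + n * a < n * n := add_mul_lt b.2 a.2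
  have := h' a b (by omega)
  simp only [Nat.add_comm (n * (a : ℕ))] at this
  simp [hk, this, -finProdFinEquiv_symm_apply]

theorem FinGraph.runLength_encode (Γ : FinGraph) :
    Γ.encode.runLength id = Γ.1 := by
  simp only [encode, List.runLength]
  have (n : ℕ) (l : List Bool) :
      ((List.replicate n true ++ false :: l).takeWhile id).length = n := by
    induction n with
    | zero => simp
    | succ n ih => simp [List.replicate_succ]
  exact this _ _

section

variable {A : Type} [DecidableEq A]

/-- The number of vertices of a graph written with the digit `s` after the first `o` symbols. -/
def graphOrder (s : A) (o : List A → ℕ) (W : List A) : ℕ :=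
  (W.drop (o W)).runLength fun a => decide (a = s)

/-- The adjacency in a graph written with the digit `s` after the first `o` symbols. -/
def GraphAdj (s : A) (o : List A → ℕ) (W : List A) (a b : ℕ) : Prop :=
  W[o W + (graphOrder s o W + 1 + (b + graphOrder s o W * a))]? = some s

variable {s : A} {o : List A → ℕ}

theorem Definable.graphOrder [Fintype A] (ho : Definable id [] o) :
    Definable id [] (graphOrder s o) :=
  ho.runLength _

theorem DefinablePred.graphAdj [Fintype A] (ho : Definable id [] o) :
    DefinablePred (fun p : List A × ℕ × ℕ => p.1) [fun p => p.2.1, fun p => p.2.2]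
      fun p => GraphAdj s o p.1 p.2.1 p.2.2 :=
  have hn := ho.graphOrder (s := s)
  .test s (.add ho.closed (.add (.add hn.closed .one)
    (.add (.var (by simp)) (.mul hn.closed (.var (by simp))))))

/-- The terminating `false` ends the run inside `l`, so the order of a graph can be read whatever
comes after it. -/
theorem List.runLength_map_append {f : Bool → A} (hf : f.Injective) {l : List Bool} {Y : List A}
    (hl : false ∈ l) :
    (l.map f ++ Y).runLength (fun a => decide (a = f true)) = l.runLength id := by
  induction l with
  | nil => simp at hl
  | cons b l ih =>
    cases b with
    | false => simp [runLength, hf.eq_iff]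
    | true => simpa [runLength] using ih (by simpa using hl)

theorem graphOrder_eq {X Y : List A} {f : Bool → A} (hf : f.Injective) {Γ : FinGraph}
    (ho : o (X ++ (Γ.encode.map f ++ Y)) = X.length) :
    graphOrder (f true) o (X ++ (Γ.encode.map f ++ Y)) = Γ.1 := by
  rw [graphOrder, ho, List.drop_left, List.runLength_map_append hf (by simp [FinGraph.encode]),
    FinGraph.runLength_encode]

theorem graphAdj_iff {X Y : List A} {f : Bool → A} (hf : f.Injective) {Γ : FinGraph}
    (ho : o (X ++ (Γ.encode.map f ++ Y)) = X.length) (a b : Fin Γ.1) :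
    GraphAdj (f true) o (X ++ (Γ.encode.map f ++ Y)) a b ↔ Γ.2.Adj a b := by
  classical
  rw [GraphAdj, graphOrder_eq hf ho, ho, List.getElem?_append_right (by omega),
    Nat.add_sub_cancel_left]
  have h := Γ.getElem?_encode a b
  have h' := (List.getElem?_eq_some_iff.1 h).1
  rw [List.getElem?_append_left (by simpa using h'), List.getElem?_map, h]
  simp [hf.eq_iff]

end

/-! ### Problems in NP -/

/-- The circuit that breaks the symmetries of the matrices of graphs with `n` vertices. -/
def graphCircuit (δ : ℕ+ × ℕ+ → BoolCircuit) (n : ℕ) : BoolCircuit :=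
  δ (n.toPNat', (n * n).toPNat')

theorem GeneratesRowColumnSymmetryBreaking.graphCircuit {δ : ℕ+ × ℕ+ → BoolCircuit}
    (h : GeneratesRowColumnSymmetryBreaking δ) {n : ℕ} (hn : 0 < n) :
    IsCompleteSymmetryBreaking (rowColumnGroup n (n * n)) (matrixVar n (n * n))
      (graphCircuit δ n) := by
  have h₁ : n.toPNat' = ⟨n, hn⟩ := PNat.eq (by simp [hn])
  have h₂ : (n * n).toPNat' = ⟨n * n, Nat.mul_pos hn hn⟩ := PNat.eq (by simp [hn])
  rw [_root_.graphCircuit, h₁, h₂]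
  exact h.2 ⟨n, hn⟩ ⟨n * n, Nat.mul_pos hn hn⟩

/-- Eight arrays, each with as many bits as the circuit has symbols plus `n⁴`. -/
theorem exists_certificate_bound {δ : ℕ+ × ℕ+ → BoolCircuit}
    (hδ : PolyTimeComputable (encodingProd unaryEncodingPNat unaryEncodingPNat)
      circuitEncoding δ) :
    ∃ p : Polynomial ℕ, ∀ n x, n ≤ x →
      8 * ((graphCircuit δ n).encode.length + n * n * (n * n)) ≤ p.eval x := by
  obtain ⟨q, hq⟩ := hδ.exists_length_le
  refine ⟨8 * (q.comp (.X + 1 + (.X * .X + 1)) + .X * .X * (.X * .X)), fun n x hx => ?_⟩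
  have h : ∀ k : ℕ, (k.toPNat' : ℕ) ≤ k + 1 := fun k => by
    rw [Nat.toPNat'_coe]
    split <;> omega
  have h₁ := hq (n.toPNat', (n * n).toPNat')
  rw [encode_pnat_pair, List.length_append, List.length_replicate, List.length_replicate] at h₁
  have h₂ := Polynomial.eval_mono_nat q (add_le_add ((h n).trans (Nat.add_le_add_right hx 1))
    ((h (n * n)).trans (Nat.add_le_add_right (Nat.mul_le_mul hx hx) 1)))
  have h₃ := Nat.mul_le_mul (Nat.mul_le_mul hx hx) (Nat.mul_le_mul hx hx)
  simp only [Polynomial.eval_mul, Polynomial.eval_add, Polynomial.eval_ofNat,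
    Polynomial.eval_comp, Polynomial.eval_X, Polynomial.eval_one]
  have h₄ := h₁.trans h₂
  exact Nat.mul_le_mul_left 8 (add_le_add h₄ h₃)

/-- The order of the graph must be readable before the circuit exists, so `hn'` concerns the word
without the circuit, whereas `F` is evaluated on the word with the circuit in front. -/
theorem InNP.of_definable {α J : Type} [Fintype J] [DecidableEq J] {ea : Encoding α J}
    {δ : ℕ+ × ℕ+ → BoolCircuit}
    (hδ : PolyTimeComputable (encodingProd unaryEncodingPNat unaryEncodingPNat)
      circuitEncoding δ)
    {n : List ((J ⊕ Bool) ⊕ CircuitSymbol) → ℕ} (hn : Definable id [] n) (n' : α → ℕ)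
    (hn' : ∀ a (w : List Bool),
      n (((ea.encode a).map Sum.inl ++ w.map Sum.inr).map Sum.inl) = n' a)
    {F : List ((J ⊕ Bool) ⊕ CircuitSymbol) → Prop} (hF : DefinablePred id [] F)
    (p : Polynomial ℕ) {S : Set α}
    (hS : ∀ a, a ∈ S ↔ ∃ w : List Bool, w.length ≤ p.eval (ea.encode a).length ∧
      F ((graphCircuit δ (n' a)).encode.map .inr ++
        ((ea.encode a).map Sum.inl ++ w.map Sum.inr).map .inl)) :
    InNP ea S := by
  obtain ⟨ev, hv, hFv⟩ := hF
  refine ⟨p, _, PolyTimeComputable.verifier (encodingProd ea (encodingList Bool)) hδ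
    (fun a => (n' a.1).toPNat') (fun a => (n' a.1 * n' a.1).toPNat')
    -- The expression `n + (1 - n)` replaces zero by one, as `toPNat'` does.
    (hn.add (Definable.one.sub hn)) ((hn.mul hn).add (Definable.one.sub (hn.mul hn))) hv
    (fun a => ?_) (fun a => ?_), fun a => ?_⟩
  · have := hn' a.1 a.2
    simp only [encodingProd, encodingList, id, this, Nat.toPNat'_coe]
    split <;> omega
  · have := hn' a.1 a.2
    simp only [encodingProd, encodingList, id, this, Nat.toPNat'_coe]
    generalize n' a.1 * n' a.1 = k
    split <;> omega
  · rw [hS a]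
    refine exists_congr fun w => and_congr_right fun _ => ?_
    rw [hFv, decide_eq_true_eq]
    rfl

section

variable {J : Type} [Fintype J] [DecidableEq J]

/-- The certificate contains, in the arrays from `r` on, a proof that the array `r` is the matrix of
the representative of the graph with digit `s` after the first `o` symbols. -/
def GraphCertified (s : (J ⊕ Bool) ⊕ CircuitSymbol)
    (o : List ((J ⊕ Bool) ⊕ CircuitSymbol) → ℕ) (r : ℕ)
    (W : List ((J ⊕ Bool) ⊕ CircuitSymbol)) : Prop :=
  Certifies W (graphOrder s o W) (GraphAdj s o W) (certificateBit r W) (certificateBit (r + 1) W)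
    (certificateBit (r + 2) W) (certificateBit (r + 3) W)

theorem DefinablePred.graphCertified {s : (J ⊕ Bool) ⊕ CircuitSymbol}
    {o : List ((J ⊕ Bool) ⊕ CircuitSymbol) → ℕ} (ho : Definable id [] o) (r : ℕ) :
    DefinablePred id [] (GraphCertified s o r) :=
  .certifies ho.graphOrder (.graphAdj ho) (.certificateBit _) (.certificateBit _)
    (.certificateBit _) (.certificateBit _)

variable {s : (J ⊕ Bool) ⊕ CircuitSymbol} {o : List ((J ⊕ Bool) ⊕ CircuitSymbol) → ℕ} {n r : ℕ}
  {ψ : BoolCircuit} {x : List J} {G : SimpleGraph (Fin n)}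

omit [Fintype J] in
theorem GraphCertified.represents {W : List ((J ⊕ Bool) ⊕ CircuitSymbol)} {l : List (J ⊕ Bool)}
    (hW : W = ψ.encode.map .inr ++ l.map .inl)
    (hn : graphOrder s o W = n) (hG : ∀ a b : Fin n, GraphAdj s o W a b ↔ G.Adj a b)
    (h : GraphCertified s o r W) :
    G.Represents ψ fun ω => certificateBit r W (matrixVar n (n * n) ω) := by
  rw [GraphCertified, hn] at h
  subst hW
  exact h.represents hG

omit [Fintype J] in
theorem graphCertified_interleave {X : ℕ → ℕ → Bool} {B : ℕ}
    {W : List ((J ⊕ Bool) ⊕ CircuitSymbol)}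
    (hW : W = ψ.encode.map .inr ++ (x.map Sum.inl ++ (interleave B X).map Sum.inr).map .inl)
    (hr : r + 3 < 8) (hn : graphOrder s o W = n) (hψ : ψ.encode.length ≤ B)
    (hB : n * n * (n * n) ≤ B)
    (hG : ∀ a b : Fin n, GraphAdj s o W a b ↔ G.Adj a b) {l : List (J ⊕ Bool)}
    (h : Certifies (ψ.encode.map .inr ++ l.map .inl) n G.AdjVal (X r) (X (r + 1)) (X (r + 2))
      (X (r + 3))) :
    GraphCertified s o r W ∧
      ∀ ω, certificateBit r W (matrixVar n (n * n) ω) = X r (matrixVar n (n * n) ω) := by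
  subst hW
  rw [GraphCertified, hn]
  refine ⟨h.congr hψ hB (fun i hi => (certificateBit_interleave (by omega) hi).symm)
    (fun i hi => (certificateBit_interleave (by omega) hi).symm)
    (fun i hi => (certificateBit_interleave (by omega) hi).symm)
    (fun i hi => (certificateBit_interleave (by omega) hi).symm) fun a ha b hb =>
      (SimpleGraph.adjVal_iff ⟨a, ha⟩ ⟨b, hb⟩).trans (hG ⟨a, ha⟩ ⟨b, hb⟩).symm,
    fun ⟨i, q⟩ => ?_⟩
  refine certificateBit_interleave (by omega) ?_
  rw [matrixVar_apply]
  exact (add_mul_lt q.2 (i.2.trans_le (Nat.le_mul_self n))).trans_le hB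

end

/-! ### Canonization in NP, and graph isomorphism in coNP -/

/-- The number of symbols of the circuit in front of the input. -/
def circuitOffset {J : Type} (W : List (J ⊕ CircuitSymbol)) : ℕ := W.countP Sum.isRight

theorem circuitOffset_eq {J : Type} (C : List CircuitSymbol) (l : List J) :
    circuitOffset (C.map .inr ++ l.map .inl) = C.length := by
  have h₁ : Sum.isRight ∘ (Sum.inr : _ → J ⊕ CircuitSymbol) = fun _ => true := rfl
  have h₂ : Sum.isRight ∘ (Sum.inl : _ → J ⊕ CircuitSymbol) = fun _ => false := rfl
  simp [circuitOffset, List.countP_map, h₁, h₂]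

theorem SimpleGraph.eq_ofMatrix_iff {n m : ℕ} {G : SimpleGraph (Fin n)} {adj : ℕ → ℕ → Prop}
    {x : ℕ → Bool} (h : ∀ a b : Fin n, adj a b ↔ G.Adj a b) :
    (∀ a < n, ∀ b < n, (adj a b ↔ a ≠ b ∧
      ∃ q < m, x (q + m * a) = true ∧ x (q + m * b) = true)) ↔
        G = ofMatrix fun ω => x (matrixVar n m ω) := by
  have h' : ∀ a b : Fin n, (ofMatrix fun ω => x (matrixVar n m ω)).Adj a b ↔ (a : ℕ) ≠ b ∧
      ∃ q < m, x (q + m * a) = true ∧ x (q + m * b) = true := fun a b => by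
    simp only [ofMatrix, matrixVar_apply, ne_eq, Fin.ext_iff, Fin.exists_iff, exists_prop]
  constructor
  · intro H
    ext a b
    rw [← h, H a a.2 b b.2, h']
  · intro H a ha b hb
    rw [h ⟨a, ha⟩ ⟨b, hb⟩, H, h']

theorem decisionCanonization_inNP {δ : ℕ+ × ℕ+ → BoolCircuit}
    (hδ : GeneratesRowColumnSymmetryBreaking δ) :
    InNP FinGraph.encoding (decisionCanonization (FinGraph.canonize (graphCircuit δ))) := by
  let f : Bool → (Bool ⊕ Bool) ⊕ CircuitSymbol := .inl ∘ .inl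
  have hf : f.Injective := Sum.inl_injective.comp Sum.inl_injective
  let N : List ((Bool ⊕ Bool) ⊕ CircuitSymbol) → ℕ := graphOrder (f true) circuitOffset
  let W (C : List CircuitSymbol) (Γ : FinGraph) (w : List Bool) :
      List ((Bool ⊕ Bool) ⊕ CircuitSymbol) :=
    C.map Sum.inr ++ (Γ.encode.map Sum.inl ++ w.map Sum.inr).map Sum.inl
  have hW (C : List CircuitSymbol) (Γ : FinGraph) (w : List Bool) : W C Γ w =
      C.map Sum.inr ++ (Γ.encode.map f ++ w.map (Sum.inl ∘ Sum.inr)) := by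
    simp [W, f]
  have hX (C : List CircuitSymbol) (Γ : FinGraph) (w : List Bool) : circuitOffset (C.map Sum.inr ++
      (Γ.encode.map f ++ w.map (Sum.inl ∘ Sum.inr))) =
        (C.map (Sum.inr : _ → (Bool ⊕ Bool) ⊕ CircuitSymbol)).length := by
    rw [← hW, circuitOffset_eq, List.length_map]
  have hN (C Γ w) : N (W C Γ w) = Γ.1 := by
    rw [hW]
    exact graphOrder_eq hf (hX C Γ w)
  have hA (C : List CircuitSymbol) (Γ : FinGraph) (w : List Bool) (a b : Fin Γ.1) :
      GraphAdj (f true) circuitOffset (W C Γ w) a b ↔ Γ.2.Adj a b := by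
    rw [hW]
    exact graphAdj_iff hf (hX C Γ w) a b
  have ho : Definable (A := (Bool ⊕ Bool) ⊕ CircuitSymbol) id [] circuitOffset := .countP _
  have hn : Definable id [] N := ho.graphOrder
  obtain ⟨p, hp⟩ := exists_certificate_bound hδ.1
  let F : List ((Bool ⊕ Bool) ⊕ CircuitSymbol) → Prop := fun W =>
    N W = 0 ∨ (GraphCertified (f true) circuitOffset 0 W ∧
      ∀ a < N W, ∀ b < N W, (GraphAdj (f true) circuitOffset W a b ↔ a ≠ b ∧
        ∃ q < N W * N W, certificateBit 0 W (q + N W * N W * a) = true ∧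
          certificateBit 0 W (q + N W * N W * b) = true))
  -- The offset is found by counting circuit symbols, so `N` also reads the bare input, as the case
  -- of an empty circuit word.
  refine InNP.of_definable (ea := FinGraph.encoding) (n' := Sigma.fst) (F := F)
    hδ.1 hn (fun Γ w => hN [] Γ w) ?_ p fun Γ => ?_
  · refine .or (.eq hn (.const 0)) (.and (.graphCertified ho 0) (.forall_lt hn
      (.forall_lt hn.closed (.iff (.subst₂ (.graphAdj ho) (.var (by simp)) (.var (by simp)))
      (.and (.not (.eq (.var (by simp)) (.var (by simp)))) (.exists_lt (hn.closed.mul hn.closed)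
      (.and (.subst₁ (P := fun W i => certificateBit 0 W i = true) (.certificateBit 0)
        (.add (.var (by simp)) (.mul (hn.closed.mul hn.closed) (.var (by simp)))))
      (.subst₁ (P := fun W i => certificateBit 0 W i = true) (.certificateBit 0)
        (.add (.var (by simp)) (.mul (hn.closed.mul hn.closed) (.var (by simp))))))))))))
  obtain ⟨n, G⟩ := Γ
  let C := graphCircuit δ n
  have hl : n ≤ (FinGraph.encode ⟨n, G⟩).length := by simp [FinGraph.encode]
  have hcommon (w : List Bool) : (∀ a < n, ∀ b < n,
      (GraphAdj (f true) circuitOffset (W C.encode ⟨n, G⟩ w) a b ↔ a ≠ b ∧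
        ∃ q < n * n, certificateBit 0 (W C.encode ⟨n, G⟩ w) (q + n * n * a) = true ∧
          certificateBit 0 (W C.encode ⟨n, G⟩ w) (q + n * n * b) = true)) ↔
      G = .ofMatrix fun ω => certificateBit 0 (W C.encode ⟨n, G⟩ w) (matrixVar n (n * n) ω) :=
    SimpleGraph.eq_ofMatrix_iff (hA C.encode ⟨n, G⟩ w)
  rw [decisionCanonization, Set.mem_ofPred_eq,
    FinGraph.eq_canonize_iff fun hn => hδ.graphCircuit hn]
  change _ ↔ ∃ w : List Bool, w.length ≤ p.eval (FinGraph.encode ⟨n, G⟩).length ∧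
    F (W C.encode ⟨n, G⟩ w)
  simp only [F, hN, hcommon]
  constructor
  · rintro (hn | ⟨M, hM, hG⟩)
    · exact ⟨[], by simp, .inl hn⟩
    · obtain ⟨θ, u, P, Q, h, hθ⟩ := hM.exists_certifies ([] : List (Bool ⊕ Bool))
      -- Only four of the eight arrays are read for this problem; the default fills the others.
      let X : ℕ → ℕ → Bool := fun r => [θ, u, P, Q].getD r θ
      obtain ⟨h₁, h₂⟩ := graphCertified_interleave (r := 0) (X := X) rfl (by omega)
        (hN C.encode ⟨n, G⟩ _) (Nat.le_add_right _ _) (Nat.le_add_left _ _)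
        (hA C.encode ⟨n, G⟩ _) h
      refine ⟨_, ?_, .inr ⟨h₁, hG.trans (congrArg _ (funext fun ω => ?_))⟩⟩
      · simpa [interleave] using hp n _ hl
      · exact (hθ ω).symm.trans (h₂ ω).symm
  · rintro ⟨w, -, h | ⟨h, h'⟩⟩
    · exact .inl h
    · exact .inr ⟨_, h.represents rfl (hN C.encode ⟨n, G⟩ w) (hA C.encode ⟨n, G⟩ w),
        h'⟩

theorem graphIsomorphism_inCoNP {δ : ℕ+ × ℕ+ → BoolCircuit}
    (hδ : GeneratesRowColumnSymmetryBreaking δ) :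
    InCoNP (encodingProd FinGraph.encoding FinGraph.encoding) graphIsomorphismProblem := by
  let A := ((Bool ⊕ Bool) ⊕ Bool) ⊕ CircuitSymbol
  let f : Bool → A := .inl ∘ .inl ∘ .inl
  let g : Bool → A := .inl ∘ .inl ∘ .inr
  have hf : f.Injective := Sum.inl_injective.comp (Sum.inl_injective.comp Sum.inl_injective)
  have hg : g.Injective := Sum.inl_injective.comp (Sum.inl_injective.comp Sum.inr_injective)
  let s : A → Bool := fun
    | .inl (.inl (.inl _)) => true
    | _ => false
  -- The second graph begins after the circuit and the first graph, whose symbols are those marked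
  -- by `s`.
  let o : List A → ℕ := fun W => circuitOffset W + W.countP s
  let N : List A → ℕ := graphOrder (f true) circuitOffset
  let N' : List A → ℕ := graphOrder (g true) o
  let W (C : List CircuitSymbol) (Γ : FinGraph × FinGraph) (w : List Bool) : List A :=
    C.map Sum.inr ++ ((Γ.1.encode.map Sum.inl ++ Γ.2.encode.map Sum.inr).map Sum.inl ++
      w.map Sum.inr).map Sum.inl
  have hW (C : List CircuitSymbol) (Γ : FinGraph × FinGraph) (w : List Bool) : W C Γ w =
      C.map Sum.inr ++ (Γ.1.encode.map f ++ (Γ.2.encode.map g ++ w.map (Sum.inl ∘ Sum.inr))) := by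
    simp [W, f, g]
  have hW' (C : List CircuitSymbol) (Γ : FinGraph × FinGraph) (w : List Bool) : W C Γ w =
      (C.map Sum.inr ++ Γ.1.encode.map f) ++
        (Γ.2.encode.map g ++ w.map (Sum.inl ∘ Sum.inr)) := by
    rw [hW, List.append_assoc]
  have hX (C : List CircuitSymbol) (Γ : FinGraph × FinGraph) (w : List Bool) :
      circuitOffset (W C Γ w) = (C.map (Sum.inr : _ → A)).length := by
    rw [circuitOffset_eq, List.length_map]
  have hX' (C : List CircuitSymbol) (Γ : FinGraph × FinGraph) (w : List Bool) :
      o (W C Γ w) = (C.map Sum.inr ++ Γ.1.encode.map f).length := by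
    have h₁ : s ∘ Sum.inr = fun _ => false := rfl
    have h₂ : s ∘ f = fun _ => true := rfl
    have h₃ : s ∘ g = fun _ => false := rfl
    have h₄ : s ∘ Sum.inl ∘ Sum.inr = fun _ => false := rfl
    simp only [o, hX]
    rw [hW]
    simp [List.countP_map, h₁, h₂, h₃, h₄]
  have hN (C : List CircuitSymbol) (Γ : FinGraph × FinGraph) (w : List Bool) :
      N (W C Γ w) = Γ.1.1 := by
    rw [hW]
    exact graphOrder_eq hf (hW C Γ w ▸ hX C Γ w)
  have hN' (C : List CircuitSymbol) (Γ : FinGraph × FinGraph) (w : List Bool) :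
      N' (W C Γ w) = Γ.2.1 := by
    rw [hW']
    exact graphOrder_eq hg (hW' C Γ w ▸ hX' C Γ w)
  have hA (C : List CircuitSymbol) (Γ : FinGraph × FinGraph) (w : List Bool)
      (a b : Fin Γ.1.1) : GraphAdj (f true) circuitOffset (W C Γ w) a b ↔ Γ.1.2.Adj a b := by
    rw [hW]
    exact graphAdj_iff hf (hW C Γ w ▸ hX C Γ w) a b
  have hA' (C : List CircuitSymbol) (Γ : FinGraph × FinGraph) (w : List Bool)
      (a b : Fin Γ.2.1) : GraphAdj (g true) o (W C Γ w) a b ↔ Γ.2.2.Adj a b := by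
    rw [hW']
    exact graphAdj_iff hg (hW' C Γ w ▸ hX' C Γ w) a b
  have ho : Definable (A := A) id [] circuitOffset := .countP _
  have ho' : Definable (A := A) id [] o := ho.add (.countP s)
  have hn : Definable id [] N := ho.graphOrder
  have hn' : Definable id [] N' := ho'.graphOrder
  obtain ⟨p, hp⟩ := exists_certificate_bound hδ.1
  -- Graphs of different orders need no certificate. Otherwise one circuit, generated for the order
  -- of the first graph, serves both, with arrays `0` to `3` for the first graph and `4` to `7` for
  -- the second.
  let F : List A → Prop := fun W => N W ≠ N' W ∨ (0 < N W ∧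
    GraphCertified (f true) circuitOffset 0 W ∧ GraphCertified (g true) o 4 W ∧
      ∃ i < N W, ∃ q < N W * N W, ¬ (certificateBit 0 W (q + N W * N W * i) = true ↔
        certificateBit 4 W (q + N W * N W * i) = true))
  refine InNP.of_definable (ea := encodingProd FinGraph.encoding FinGraph.encoding)
    (n' := fun Γ => Γ.1.1) (F := F)
    hδ.1 hn (fun Γ w => hN [] Γ w) ?_ p fun Γ => ?_
  · refine .or (.not (.eq hn hn')) (.and (.lt (.const 0) hn) (.and (.graphCertified ho 0)
      (.and (.graphCertified ho' 4) (.exists_lt hn (.exists_lt (hn.closed.mul hn.closed)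
      (.not (.iff (.subst₁ (P := fun W i => certificateBit 0 W i = true) (.certificateBit 0)
        (.add (.var (by simp)) (.mul (hn.closed.mul hn.closed) (.var (by simp)))))
      (.subst₁ (P := fun W i => certificateBit 4 W i = true) (.certificateBit 4)
        (.add (.var (by simp)) (.mul (hn.closed.mul hn.closed) (.var (by simp))))))))))))
  obtain ⟨⟨n, G⟩, n', H⟩ := Γ
  let C := graphCircuit δ n
  let l := (encodingProd FinGraph.encoding FinGraph.encoding).encode (⟨n, G⟩, ⟨n', H⟩)
  change ¬ FinGraph.Isomorphic _ _ ↔ ∃ w : List Bool, w.length ≤ p.eval l.length ∧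
    F (W C.encode (⟨n, G⟩, ⟨n', H⟩) w)
  simp only [F, hN, hN']
  by_cases hnn : n = n'
  swap
  · exact iff_of_true (fun h => hnn h.order_eq) ⟨[], by simp, .inl hnn⟩
  subst hnn
  have hl : n ≤ l.length := by
    change n ≤ ((FinGraph.encode ⟨n, G⟩).map Sum.inl ++ _).length
    simp only [List.length_append, List.length_map, FinGraph.encode, List.length_replicate]
    omega
  have hne (w : List Bool) : (∃ i < n, ∃ q < n * n,
      ¬ (certificateBit 0 (W C.encode (⟨n, G⟩, ⟨n, H⟩) w) (q + n * n * i) = true ↔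
        certificateBit 4 (W C.encode (⟨n, G⟩, ⟨n, H⟩) w) (q + n * n * i) = true)) ↔
      (fun ω => certificateBit 0 (W C.encode (⟨n, G⟩, ⟨n, H⟩) w) (matrixVar n (n * n) ω)) ≠
        fun ω => certificateBit 4 (W C.encode (⟨n, G⟩, ⟨n, H⟩) w) (matrixVar n (n * n) ω) := by
    simp only [ne_eq, funext_iff, not_forall, Prod.exists, matrixVar_apply, Fin.exists_iff,
      exists_prop, ← Bool.eq_iff_iff]
  simp only [ne_eq, not_true_eq_false, false_or, hne]
  rw [FinGraph.not_isomorphic_iff fun hn => hδ.graphCircuit hn]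
  constructor
  · rintro ⟨hn, M, M', hM, hM', hMM'⟩
    obtain ⟨θ, u, P, Q, h, hθ⟩ := hM.exists_certifies ([] : List ((Bool ⊕ Bool) ⊕ Bool))
    obtain ⟨θ', u', P', Q', h', hθ'⟩ := hM'.exists_certifies ([] : List ((Bool ⊕ Bool) ⊕ Bool))
    let X : ℕ → ℕ → Bool := fun r => [θ, u, P, Q, θ', u', P', Q'].getD r θ
    obtain ⟨h₁, h₂⟩ := graphCertified_interleave (r := 0) (X := X) rfl (by omega)
      (hN C.encode (⟨n, G⟩, ⟨n, H⟩) _) (Nat.le_add_right _ _) (Nat.le_add_left _ _)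
      (hA C.encode (⟨n, G⟩, ⟨n, H⟩) _) h
    obtain ⟨h₃, h₄⟩ := graphCertified_interleave (r := 4) (X := X) rfl (by omega)
      (hN' C.encode (⟨n, G⟩, ⟨n, H⟩) _) (Nat.le_add_right _ _) (Nat.le_add_left _ _)
      (hA' C.encode (⟨n, G⟩, ⟨n, H⟩) _) h'
    refine ⟨_, ?_, hn, h₁, h₃, fun he => hMM' (funext fun ω => ?_)⟩
    · simpa [interleave] using hp n _ hl
    · exact (hθ ω).symm.trans ((h₂ ω).symm.trans
        ((congrFun he ω).trans ((h₄ ω).trans (hθ' ω))))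
  · rintro ⟨w, -, hn, h, h', hw⟩
    exact ⟨hn, _, _,
      h.represents rfl (hN C.encode (⟨n, G⟩, ⟨n, H⟩) w) (hA C.encode (⟨n, G⟩, ⟨n, H⟩) w),
      h'.represents rfl (hN' C.encode (⟨n, G⟩, ⟨n, H⟩) w) (hA' C.encode (⟨n, G⟩, ⟨n, H⟩) w),
      hw⟩

theorem mainTheorem2
    (h : ∃ δ : ℕ+ × ℕ+ → BoolCircuit, GeneratesRowColumnSymmetryBreaking δ) :
    (∃ f : FinGraph → FinGraph,
      IsCanonicalForm f ∧ InNP FinGraph.encoding (decisionCanonization f)) ∧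
    InCoNP (encodingProd FinGraph.encoding FinGraph.encoding) graphIsomorphismProblem := by
  obtain ⟨δ, hδ⟩ := h
  exact ⟨⟨_, FinGraph.isCanonicalForm_canonize fun _ hn => hδ.graphCircuit hn,
    decisionCanonization_inNP hδ⟩, graphIsomorphism_inCoNP hδ⟩
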